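/- **Conventions.** Let $S$ be a scheme. An affine point of $S$ is a pair $(A,x)$ with $A$ a commutative ring and $x:\operatorname{Spec}A\to S$; $S$-functors are set-valued functors on affine points, and an affine point of an $S$-functor $Y$ is a triple $(A,x,y)$ with $y\in Y(A,x)$. A quasi-coherent module (resp. algebra; algebras are associative and unital, not necessarily commutative) on $S$ or on $Y$ is a functor assigning to each affine point $(A,\dots)$ an $A$-module (resp. $A$-algebra), compatible with base change: $\mathcal F(A,\dots)\otimes_A B\simeq\mathcal F(B,\dots)$. A polynomial law $\mathcal F\leadsto\mathcal G$ is a natural transformation of the underlying set-valued functors; it is homogeneous of degree $k$ if $\psi(az)=a^k\psi(z)$. Let $\mathcal O$ be the structure sheaf and $\Gamma^m$ the $m$-th divided power, with universal law $\mathrm l^m:\mathcal F\leadsto\Gamma^m(\mathcal F)$, $z\mapsto z^{[m]}$. **Clifford algebras.** For $d\ge 0$, a weighted polynomial law on $Y$ is a tuple $\Psi=(\mathcal F,\mathcal G,\mathcal A_0,\dots,\mathcal A_d,\psi_{-1},\psi_0,\dots,\psi_d)$ with modules $\mathcal F,\mathcal G$, algebras $\mathcal A_i$ and polynomial laws $\psi_{-1}:\mathcal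 F\leadsto\mathcal G$, $\psi_i:\mathcal F\leadsto\mathcal A_i$. A morphism $\Psi\to\Psi'$ consists of a polynomial law $\mathcal F\leadsto\mathcal F'$, a linear map $\mathcal G\to\mathcal G'$ and algebra maps $\mathcal A_i\to\mathcal A_i'$ compatible with the laws. Let $F^d$ be the functor sending a quasi-coherent algebra $\mathcal A$ to $(\mathcal A^{\oplus(d+1)},\mathcal A,\mathcal A,\dots,\mathcal A,\mathrm{pr}_{-1},\dots,\mathrm{pr}_d)$, where, on a tuple $(a_{-1},a_0,\dots,a_{d-1})$, $\mathrm{pr}_i$ gives $a_i$ for $-1\le i<d$ and $\mathrm{pr}_d$ gives $a_0a_{-1}^d+a_1a_{-1}^{d-1}+\dots+a_{d-1}a_{-1}$. The Clifford algebra $\mathrm{Cl}(\Psi)$ is the value at $\Psi$ of the left adjoint of $F^d$: a quasi-coherent algebra with a universal morphism $\Psi\to F^d(\mathrm{Cl}(\Psi))$. **Setting.** Let $\mathcal F$ be a finite locally free $\mathcal O_S$-module, $m\ge 1$, $d\ge 0$, and for $0\le i\le d$ let $\psi_i:\mathcal F\leadsto\mathcal O_S$ be a homogeneous polynomial law of degree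 $im$, with $\psi_0=1$. Let $\mathbb P(\mathcal F)$ be the $S$-functor sending $(A,x)$ to the set of isomorphism classes of surjections $q:\mathcal F(A,x)^\vee\to L'$ onto line bundles over $A$, let $\mathcal O(-1)$ be its tautological line bundle, with fibre the submodule $L'^\vee$ of $\mathcal F(A,x)$ at $q$, and put $$\Psi|_{\mathcal O(-1)}=\bigl(\mathcal O(-1),\Gamma^m(\mathcal O(-1)),\mathcal O,\dots,\mathcal O,\mathrm l^m_{\mathcal O(-1)},\psi_0|_{\mathcal O(-1)},\dots,\psi_d|_{\mathcal O(-1)}\bigr),$$ a weighted polynomial law on $\mathbb P(\mathcal F)$. Let $\mathbb P_m(\mathcal F\oplus\mathcal O_S)=\operatorname{Proj}(\operatorname{Sym}(\mathcal F^\vee)[x_0])$, where $\mathcal F^\vee$ has degree $1$ and $x_0$ has degree $m$: its $(A,x)$-points are isomorphism classes of pairs $(L,h)$ with $L$ a line bundle over $A$ and $h:\operatorname{Sym}(\mathcal F(A,x)^\vee)[x_0]^{(m)}\to\bigoplus_{j\ge0}L^{\otimes j}$ a homomorphism of graded $A$-algebras from the $m$-th Veronese subalgebra for which $\operatorname{Sym}^m(\mathcal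 F(A,x)^\vee)\oplus A x_0\to L$ is surjective. Let $X_\Psi\subseteq\mathbb P_m(\mathcal F\oplus\mathcal O_S)$ be the subfunctor of the classes $(L,h)$ with $$h\Bigl(\sum_{i=0}^{d-1}\psi_i\,x_0^{\,d-i}-\psi_d\Bigr)=0\in L^{\otimes d},$$ where the restriction of $\psi_i$ to algebras over $(A,x)$ is regarded as an element of $\operatorname{Sym}^{im}(\mathcal F(A,x)^\vee)$. **Theorem.** 1. There is a morphism of $S$-functors $\varphi:X_\Psi\to\mathbb P(\mathcal F)$ characterized as follows: $\varphi$ sends $(L,h)$ to the class of $q:\mathcal F(A,x)^\vee\to L'$ if and only if there is an isomorphism $L\simeq L'^{\otimes m}$ carrying $h|_{\operatorname{Sym}^m(\mathcal F(A,x)^\vee)}$ to $\operatorname{Sym}^m(q)$. 2. The Clifford algebra $\mathrm{Cl}(\Psi|_{\mathcal O(-1)})$ exists as a quasi-coherent sheaf of algebras on $\mathbb P(\mathcal F)$, and it is commutative. 3. The relative spectrum of $\mathrm{Cl}(\Psi|_{\mathcal O(-1)})$ over $\mathbb P(\mathcal F)$, that is the $S$-functor sending $(A,x)$ to the set of pairs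 of a point $y\in\mathbb P(\mathcal F)(A,x)$ and an $A$-algebra homomorphism $\mathrm{Cl}(\Psi|_{\mathcal O(-1)})(A,x,y)\to A$, with its projection to $\mathbb P(\mathcal F)$, is isomorphic over $\mathbb P(\mathcal F)$ to $\varphi:X_\Psi\to\mathbb P(\mathcal F)$. -/

import Mathlib

open CategoryTheory

universe u v w

noncomputable section

namespace CliffordSpec

/-! ### Scalar extension along a ring homomorphism -/

section ScalarExtension

variable {A B : Type u} [CommRing A] [CommRing B] {σ : A →+* B}
variable {M N P : Type u} [AddCommGroup M] [Module A M] [AddCommGroup N] [Module B N]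
  [AddCommGroup P] [Module B P]

/-- A `σ`-semilinear map `φ : M → N` exhibits `N` as the scalar extension of `M` along
`σ : A → B`: the induced `B`-linear map `B ⊗[A] M → N` is an isomorphism. -/
def IsScalarExtension (φ : M →ₛₗ[σ] N) : Prop :=
  letI : Algebra A B := σ.toAlgebra
  letI : Module A N := Module.compHom N σ
  haveI : IsScalarTower A B N := ⟨fun a b n => mul_smul (σ a) b n⟩
  IsBaseChange B ({ toFun := φ, map_add' := φ.map_add, map_smul' := φ.map_smulₛₗ } : M →ₗ[A] N)

theorem IsScalarExtension.exists_lift {φ : M →ₛₗ[σ] N} (h : IsScalarExtension φ)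
    (g : M →ₛₗ[σ] P) : ∃ l : N →ₗ[B] P, ∀ x, l (φ x) = g x := by
  let _ : Algebra A B := σ.toAlgebra
  let _ : Module A N := Module.compHom N σ
  let _ : Module A P := Module.compHom P σ
  have _ : IsScalarTower A B N := ⟨fun a b n => mul_smul (σ a) b n⟩
  have _ : IsScalarTower A B P := ⟨fun a b n => mul_smul (σ a) b n⟩
  refine ⟨IsBaseChange.lift h
    ({ toFun := g, map_add' := g.map_add, map_smul' := g.map_smulₛₗ } : M →ₗ[A] P), fun x => ?_⟩
  exact IsBaseChange.lift_eq h _ x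

/-- The `B`-linear extension of a `σ`-semilinear map along a scalar extension. -/
def IsScalarExtension.lift {φ : M →ₛₗ[σ] N} (h : IsScalarExtension φ) (g : M →ₛₗ[σ] P) :
    N →ₗ[B] P := (h.exists_lift g).choose

theorem IsScalarExtension.lift_apply {φ : M →ₛₗ[σ] N} (h : IsScalarExtension φ)
    (g : M →ₛₗ[σ] P) (x : M) : h.lift g (φ x) = g x := (h.exists_lift g).choose_spec x

theorem IsScalarExtension.span_eq_top {φ : M →ₛₗ[σ] N} (h : IsScalarExtension φ) :
    Submodule.span B (Set.range φ) = ⊤ := by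
  let _ : Algebra A B := σ.toAlgebra
  let _ : Module A N := Module.compHom N σ
  have _ : IsScalarTower A B N := ⟨fun a b n => mul_smul (σ a) b n⟩
  rw [eq_top_iff]
  rintro x -
  refine IsBaseChange.inductionOn h x (· ∈ Submodule.span B (Set.range φ)) (zero_mem _)
    (fun m => Submodule.subset_span ⟨m, rfl⟩) (fun s n hn => Submodule.smul_mem _ s hn)
    (fun _ _ => add_mem)

theorem IsScalarExtension.hom_ext {φ : M →ₛₗ[σ] N} (h : IsScalarExtension φ)
    {g g' : N →ₗ[B] P} (e : ∀ x, g (φ x) = g' (φ x)) : g = g' :=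
  LinearMap.ext_on_range h.span_eq_top e

/-- The scalar extension `B ⊗[A] M` of an `A`-module along `σ : A → B`. -/
def ExtScalars (σ : A →+* B) (M : Type u) [AddCommGroup M] [Module A M] : Type u :=
  letI : Algebra A B := σ.toAlgebra
  TensorProduct A B M

instance : AddCommGroup (ExtScalars σ M) :=
  letI : Algebra A B := σ.toAlgebra
  (inferInstance : AddCommGroup (TensorProduct A B M))

instance : Module B (ExtScalars σ M) :=
  letI : Algebra A B := σ.toAlgebra
  (inferInstance : Module B (TensorProduct A B M))

instance [Module.Invertible A M] : Module.Invertible B (ExtScalars σ M) :=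
  letI : Algebra A B := σ.toAlgebra
  (inferInstance : Module.Invertible B (TensorProduct A B M))

/-- The canonical semilinear map `M → B ⊗[A] M`, `x ↦ 1 ⊗ x`. -/
def toExtScalars (σ : A →+* B) (M : Type u) [AddCommGroup M] [Module A M] :
    M →ₛₗ[σ] ExtScalars σ M where
  toFun x :=
    letI : Algebra A B := σ.toAlgebra
    (TensorProduct.tmul A (1 : B) x : TensorProduct A B M)
  map_add' x y :=
    letI : Algebra A B := σ.toAlgebra
    TensorProduct.tmul_add (1 : B) x y
  map_smul' r x := by
    let _ : Algebra A B := σ.toAlgebra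
    change TensorProduct.tmul A (1 : B) (r • x) = σ r • TensorProduct.tmul A (1 : B) x
    rw [TensorProduct.tmul_smul]
    exact (algebraMap_smul B r (TensorProduct.tmul A (1 : B) x)).symm

theorem IsScalarExtension.of_section {φ : M →ₛₗ[σ] N}
    (hs : Submodule.span B (Set.range φ) = ⊤) (θ : N →ₗ[B] ExtScalars σ M)
    (hθ : ∀ x, θ (φ x) = toExtScalars σ M x) : IsScalarExtension φ := by
  let _ : Algebra A B := σ.toAlgebra
  let _ : Module A N := Module.compHom N σ
  have _ : IsScalarTower A B N := ⟨fun a b n => mul_smul (σ a) b n⟩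
  let L : TensorProduct A B M →ₗ[A] N := TensorProduct.lift
    (((Algebra.linearMap B <| Module.End B (M →ₗ[A] N)).flip
      ({ toFun := φ, map_add' := φ.map_add, map_smul' := φ.map_smulₛₗ } : M →ₗ[A] N)
      ).restrictScalars A)
  have hL : ∀ (b : B) (m : M), L (TensorProduct.tmul A b m) = b • φ m := fun b m => rfl
  change Function.Bijective L
  constructor
  · have hli : ∀ t : TensorProduct A B M, θ (L t) = (t : TensorProduct A B M) := by
      intro t
      induction t using TensorProduct.induction_on with
      | zero => rw [map_zero, map_zero]; rfl
      | add x y hx hy => rw [map_add, map_add, hx, hy]; rfl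
      | tmul b m =>
        rw [hL, map_smul, hθ]
        change b • TensorProduct.tmul A (1 : B) m = TensorProduct.tmul A b m
        rw [TensorProduct.smul_tmul', smul_eq_mul, mul_one]
    intro t t' htt
    have := hli t
    rw [htt, hli t'] at this
    exact this.symm
  · intro n
    have hn : n ∈ Submodule.span B (Set.range φ) := hs ▸ Submodule.mem_top
    induction hn using Submodule.span_induction with
    | mem x hx =>
      obtain ⟨m, rfl⟩ := hx
      exact ⟨TensorProduct.tmul A 1 m, by rw [hL, one_smul]⟩
    | zero => exact ⟨0, map_zero _⟩
    | add x y _ _ hx hy =>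
      obtain ⟨s, rfl⟩ := hx
      obtain ⟨t, rfl⟩ := hy
      exact ⟨s + t, map_add _ _ _⟩
    | smul b x hxm hx =>
      clear hxm
      obtain ⟨s, rfl⟩ := hx
      refine ⟨b • s, ?_⟩
      induction s using TensorProduct.induction_on with
      | zero => rw [smul_zero, map_zero, smul_zero]
      | add x y hx hy => rw [smul_add, map_add, hx, hy, map_add, smul_add]
      | tmul c m => rw [TensorProduct.smul_tmul', hL, hL, smul_eq_mul, mul_smul]

theorem span_range_toExtScalars (σ : A →+* B) (M : Type u) [AddCommGroup M] [Module A M] :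
    Submodule.span B (Set.range (toExtScalars σ M)) = ⊤ := by
  let _ : Algebra A B := σ.toAlgebra
  rw [eq_top_iff]
  rintro x -
  refine TensorProduct.induction_on (motive := fun x : TensorProduct A B M =>
    (show ExtScalars σ M from x) ∈ Submodule.span B (Set.range (toExtScalars σ M))) x
    (zero_mem (Submodule.span B (Set.range (toExtScalars σ M)))) ?_
    (fun x y hx hy => add_mem (S := Submodule B (ExtScalars σ M)) hx hy)
  intro b m
  have h : (show ExtScalars σ M from TensorProduct.tmul A b m) = b • toExtScalars σ M m := by
    change TensorProduct.tmul A b m = b • TensorProduct.tmul A (1 : B) m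
    rw [TensorProduct.smul_tmul', smul_eq_mul, mul_one]
  rw [h]
  exact Submodule.smul_mem _ _ (Submodule.subset_span ⟨m, rfl⟩)

theorem isScalarExtension_toExtScalars : IsScalarExtension (toExtScalars σ M) :=
  .of_section (span_range_toExtScalars σ M) LinearMap.id fun _ => rfl

end ScalarExtension

/-! ### Duals, symmetric algebras and divided powers along semilinear maps -/

section Semilinear

variable {A B : Type u} [CommRing A] [CommRing B] {σ : A →+* B}
variable {M N : Type u} [AddCommGroup M] [Module A M] [AddCommGroup N] [Module B N]

/-- The semilinear map `M^∨ → N^∨` of dual modules attached to a scalar extension `M → N`. -/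
def IsScalarExtension.dualMap {φ : M →ₛₗ[σ] N} (h : IsScalarExtension φ) :
    Module.Dual A M →ₛₗ[σ] Module.Dual B N where
  toFun ξ := h.lift (P := B)
    { toFun := fun x => σ (ξ x), map_add' := fun x y => by simp, map_smul' := fun r x => by simp }
  map_add' ξ ξ' := h.hom_ext fun x => by simp [h.lift_apply]
  map_smul' r ξ := h.hom_ext fun x => by simp [h.lift_apply]

theorem IsScalarExtension.dualMap_apply {φ : M →ₛₗ[σ] N} (h : IsScalarExtension φ)
    (ξ : Module.Dual A M) (x : M) : h.dualMap ξ (φ x) = σ (ξ x) := h.lift_apply _ x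

theorem IsScalarExtension.dual [Module.Finite A M] [Module.Projective A M] {φ : M →ₛₗ[σ] N}
    (h : IsScalarExtension φ) : IsScalarExtension h.dualMap := by
  obtain ⟨n, p, i, -, -, hpi⟩ := Module.Finite.exists_comp_eq_id_of_projective A M
  let x : Fin n → M := fun j => p (Pi.single j 1)
  let f : Fin n → Module.Dual A M := fun j => (LinearMap.proj j).comp i
  have hx : ∀ m : M, ∑ j, f j m • x j = m := fun m => by
    have h1 := LinearMap.congr_fun hpi m
    have h2 : i m = ∑ j, (i m j) • (Pi.single j (1 : A) : Fin n → A) := by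
      ext k
      simp [Finset.sum_apply, Pi.single_apply]
    rw [LinearMap.comp_apply, h2, map_sum] at h1
    simpa [x, f] using h1
  have hf : ∀ ξ : Module.Dual A M, ∑ j, ξ (x j) • f j = ξ := fun ξ => by
    ext m
    conv_rhs => rw [← hx m]
    simp [mul_comm]
  have hN : ∀ η : Module.Dual B N, ∑ j, η (φ (x j)) • h.dualMap (f j) = η := fun η => by
    refine h.hom_ext fun m => ?_
    conv_rhs => rw [← hx m]
    simp [h.dualMap_apply, mul_comm]
  refine .of_section ?_
    { toFun := fun η => ∑ j, η (φ (x j)) • toExtScalars σ (Module.Dual A M) (f j)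
      map_add' := fun η η' => by simp [add_smul, Finset.sum_add_distrib]
      map_smul' := fun b η => by simp [mul_smul, Finset.smul_sum] } ?_
  · rw [eq_top_iff]
    rintro η -
    rw [← hN η]
    exact Submodule.sum_mem _ fun j _ => Submodule.smul_mem _ _ (Submodule.subset_span ⟨_, rfl⟩)
  · intro ξ
    conv_rhs => rw [← hf ξ]
    simp [h.dualMap_apply]

/-- The ring homomorphism `Sym_A(M) → Sym_B(N)` induced by a semilinear map `M → N`. -/
def symMap (φ : M →ₛₗ[σ] N) : SymmetricAlgebra A M →+* SymmetricAlgebra B N :=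
  letI : Algebra A (SymmetricAlgebra B N) := ((algebraMap B (SymmetricAlgebra B N)).comp σ).toAlgebra
  (SymmetricAlgebra.lift
    { toFun := fun x => SymmetricAlgebra.ι B N (φ x)
      map_add' := fun x y => by simp
      map_smul' := fun r x => by
        rw [φ.map_smulₛₗ, map_smul, Algebra.smul_def, Algebra.smul_def]
        rfl } : SymmetricAlgebra A M →ₐ[A] SymmetricAlgebra B N).toRingHom

theorem symMap_ι (φ : M →ₛₗ[σ] N) (x : M) :
    symMap φ (SymmetricAlgebra.ι A M x) = SymmetricAlgebra.ι B N (φ x) := by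
  let _ : Algebra A (SymmetricAlgebra B N) :=
    ((algebraMap B (SymmetricAlgebra B N)).comp σ).toAlgebra
  exact SymmetricAlgebra.lift_ι_apply _ x

theorem symMap_algebraMap (φ : M →ₛₗ[σ] N) (a : A) :
    symMap φ (algebraMap A _ a) = algebraMap B _ (σ a) := by
  let _ : Algebra A (SymmetricAlgebra B N) :=
    ((algebraMap B (SymmetricAlgebra B N)).comp σ).toAlgebra
  exact AlgHom.commutes (SymmetricAlgebra.lift _) a

theorem sym_ringHom_ext {T : Type*} [Semiring T] {f g : SymmetricAlgebra A M →+* T}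
    (h₁ : ∀ a, f (algebraMap A _ a) = g (algebraMap A _ a))
    (h₂ : ∀ x, f (SymmetricAlgebra.ι A M x) = g (SymmetricAlgebra.ι A M x)) : f = g := by
  refine RingHom.ext fun x => ?_
  induction x using SymmetricAlgebra.induction with
  | algebraMap r => exact h₁ r
  | ι x => exact h₂ x
  | mul a b ha hb => rw [map_mul, map_mul, ha, hb]
  | add a b ha hb => rw [map_add, map_add, ha, hb]

/-- The degree `k` part `Sym^k(M)` of the symmetric algebra. -/
def symPiece (A M : Type u) [CommRing A] [AddCommGroup M] [Module A M] (k : ℕ) :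
    Submodule A (SymmetricAlgebra A M) :=
  LinearMap.range (SymmetricAlgebra.ι A M) ^ k

theorem symMap_smul (φ : M →ₛₗ[σ] N) (a : A) (x : SymmetricAlgebra A M) :
    symMap φ (a • x) = σ a • symMap φ x := by
  rw [Algebra.smul_def, map_mul, symMap_algebraMap, Algebra.smul_def]

theorem symMap_mem (φ : M →ₛₗ[σ] N) {k : ℕ} {x : SymmetricAlgebra A M} (hx : x ∈ symPiece A M k) :
    symMap φ x ∈ symPiece B N k := by
  induction k generalizing x with
  | zero =>
    rw [symPiece, pow_zero] at hx ⊢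
    obtain ⟨a, rfl⟩ := Submodule.mem_one.mp hx
    exact Submodule.mem_one.mpr ⟨σ a, (symMap_algebraMap φ a).symm⟩
  | succ k ih =>
    rw [symPiece, pow_succ] at hx ⊢
    induction hx using Submodule.mul_induction_on' with
    | mem_mul_mem y hy z hz =>
      obtain ⟨m, rfl⟩ := hz
      rw [map_mul, symMap_ι]
      exact Submodule.mul_mem_mul (ih hy) ⟨_, rfl⟩
    | add y _ z _ hy hz => rw [map_add]; exact add_mem hy hz

/-- If `M → N` is a scalar extension, then `Sym_B^k(N)` is spanned by the image of `Sym_A^k(M)`. -/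
theorem symPiece_eq_span {φ : M →ₛₗ[σ] N} (h : IsScalarExtension φ) (k : ℕ) :
    symPiece B N k = Submodule.span B (symMap φ '' symPiece A M k) := by
  refine le_antisymm ?_ (Submodule.span_le.mpr ?_)
  · induction k with
    | zero =>
      rw [symPiece, pow_zero, Submodule.one_eq_span, Submodule.span_le]
      rintro _ rfl
      refine Submodule.subset_span ⟨1, ?_, map_one _⟩
      rw [symPiece, pow_zero]
      exact Submodule.one_le.mp le_rfl
    | succ k ih =>
      have h1 : LinearMap.range (SymmetricAlgebra.ι B N) ≤
          Submodule.span B (symMap φ '' LinearMap.range (SymmetricAlgebra.ι A M)) := by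
        rintro _ ⟨n, rfl⟩
        have hn : n ∈ Submodule.span B (Set.range φ) := h.span_eq_top ▸ Submodule.mem_top
        induction hn using Submodule.span_induction with
        | mem x hx =>
          obtain ⟨m, rfl⟩ := hx
          exact Submodule.subset_span ⟨_, ⟨m, rfl⟩, symMap_ι φ m⟩
        | zero => rw [map_zero]; exact zero_mem _
        | add x y _ _ hx hy => rw [map_add]; exact add_mem hx hy
        | smul b x _ hx => rw [map_smul]; exact Submodule.smul_mem _ _ hx
      rw [symPiece, pow_succ]
      refine (mul_le_mul' ih h1).trans ?_
      rw [Submodule.span_mul_span]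
      refine Submodule.span_mono ?_
      rintro _ ⟨_, ⟨x, hx, rfl⟩, _, ⟨y, hy, rfl⟩, rfl⟩
      refine ⟨x * y, ?_, map_mul _ _ _⟩
      simp only [symPiece, pow_succ]
      exact Submodule.mul_mem_mul hx hy
  · rintro _ ⟨x, hx, rfl⟩
    exact symMap_mem φ hx

/-- The degree `k` part `Γ^k(M)` of the divided power algebra: the span of the products
`x₁^[n₁] ⋯ x_r^[n_r]` with `n₁ + ⋯ + n_r = k`. -/
def gammaPiece (A M : Type u) [CommRing A] [AddCommGroup M] [Module A M] (k : ℕ) :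
    Submodule A (DividedPowerAlgebra A M) :=
  Submodule.span A {p | ∃ l : List (ℕ × M), (l.map Prod.fst).sum = k ∧
    p = (l.map fun x => DividedPowerAlgebra.dp A x.1 x.2).prod}

/-- The element `x^[k]` of `Γ^k(M)`. -/
def gammaDp (A : Type u) {M : Type u} [CommRing A] [AddCommGroup M] [Module A M] (k : ℕ) (x : M) :
    gammaPiece A M k :=
  ⟨DividedPowerAlgebra.dp A k x, Submodule.subset_span ⟨[(k, x)], by simp, by simp⟩⟩

/-- The ring homomorphism `Γ_A(M) → Γ_B(N)`, `x^[k] ↦ φ(x)^[k]`, induced by a semilinear map. -/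
def gammaMap (φ : M →ₛₗ[σ] N) : DividedPowerAlgebra A M →+* DividedPowerAlgebra B N :=
  letI : Algebra A B := σ.toAlgebra
  letI : Module A N := Module.compHom N σ
  haveI : IsScalarTower A B N := ⟨fun a b n => mul_smul (σ a) b n⟩
  (DividedPowerAlgebra.map B
    ({ toFun := φ, map_add' := φ.map_add, map_smul' := φ.map_smulₛₗ } : M →ₗ[A] N)).toRingHom

theorem gammaMap_dp (φ : M →ₛₗ[σ] N) (k : ℕ) (x : M) :
    gammaMap φ (DividedPowerAlgebra.dp A k x) = DividedPowerAlgebra.dp B k (φ x) := by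
  let _ : Algebra A B := σ.toAlgebra
  let _ : Module A N := Module.compHom N σ
  have _ : IsScalarTower A B N := ⟨fun a b n => mul_smul (σ a) b n⟩
  exact DividedPowerAlgebra.map_apply_dp _ _

theorem gammaMap_algebraMap (φ : M →ₛₗ[σ] N) (a : A) :
    gammaMap φ (algebraMap A _ a) = algebraMap B _ (σ a) := by
  let _ : Algebra A B := σ.toAlgebra
  let _ : Module A N := Module.compHom N σ
  have _ : IsScalarTower A B N := ⟨fun a b n => mul_smul (σ a) b n⟩
  exact AlgHom.commutes (DividedPowerAlgebra.map B
    ({ toFun := φ, map_add' := φ.map_add, map_smul' := φ.map_smulₛₗ } : M →ₗ[A] N)) a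

theorem gammaMap_smul (φ : M →ₛₗ[σ] N) (a : A) (x : DividedPowerAlgebra A M) :
    gammaMap φ (a • x) = σ a • gammaMap φ x := by
  rw [Algebra.smul_def, map_mul, gammaMap_algebraMap, Algebra.smul_def]

theorem gamma_ringHom_ext {T : Type*} [CommSemiring T] {f g : DividedPowerAlgebra A M →+* T}
    (h₁ : ∀ a, f (algebraMap A _ a) = g (algebraMap A _ a))
    (h₂ : ∀ n x, f (DividedPowerAlgebra.dp A n x) = g (DividedPowerAlgebra.dp A n x)) : f = g := by
  refine RingHom.ext fun x => ?_
  induction x using DividedPowerAlgebra.induction_on with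
  | C a => exact h₁ a
  | add a b ha hb => rw [map_add, map_add, ha, hb]
  | dp a n m ha => rw [map_mul, map_mul, ha, h₂]

theorem gammaMap_mem (φ : M →ₛₗ[σ] N) {k : ℕ} {x : DividedPowerAlgebra A M}
    (hx : x ∈ gammaPiece A M k) : gammaMap φ x ∈ gammaPiece B N k := by
  induction hx using Submodule.span_induction with
  | mem x hx =>
    obtain ⟨l, hl, rfl⟩ := hx
    refine Submodule.subset_span ⟨l.map fun x => (x.1, φ x.2), ?_, ?_⟩
    · rw [← hl, List.map_map]; rfl
    · rw [map_list_prod, List.map_map, List.map_map]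
      congr 1
      exact List.map_congr_left fun x _ => gammaMap_dp φ x.1 x.2
  | zero => rw [map_zero]; exact zero_mem _
  | add x y _ _ hx hy => rw [map_add]; exact add_mem hx hy
  | smul a x _ hx => rw [gammaMap_smul]; exact Submodule.smul_mem _ _ hx

/-- The semilinear map `Γ_A^k(M) → Γ_B^k(N)` induced by a semilinear map `M → N`. -/
def gammaPieceMap (φ : M →ₛₗ[σ] N) (k : ℕ) : gammaPiece A M k →ₛₗ[σ] gammaPiece B N k where
  toFun x := ⟨gammaMap φ x, gammaMap_mem φ x.2⟩
  map_add' _ _ := Subtype.ext (map_add (gammaMap φ) _ _)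
  map_smul' a _ := Subtype.ext (gammaMap_smul φ a _)

end Semilinear

/-! ### The weighted symmetric algebra `Sym(M ⊕ A)` and its Veronese subalgebra -/

section Weighted

/-- The algebra `Sym(M ⊕ A) = Sym(M) ⊗ Sym(A) = Sym(M)[x₀]`. -/
abbrev WSym (A M : Type u) [CommRing A] [AddCommGroup M] [Module A M] : Type u :=
  Polynomial (SymmetricAlgebra A M)

/-- The degree `k` part of `Sym(M)[x₀]`, where the elements of `M` have degree `1` and `x₀` has
degree `m`: it is spanned by the products `s x₀ʲ` with `s ∈ Symⁱ(M)` and `i + m j = k`. -/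
def wPiece (A M : Type u) [CommRing A] [AddCommGroup M] [Module A M] (m k : ℕ) :
    Submodule A (WSym A M) :=
  Submodule.span A {p | ∃ (i j : ℕ) (s : SymmetricAlgebra A M), s ∈ symPiece A M i ∧
    i + m * j = k ∧ p = Polynomial.C s * Polynomial.X ^ j}

/-- The `m`-th Veronese subalgebra `Sym(M ⊕ A)^(m)` of the weighted symmetric algebra: the
subalgebra of the sums of homogeneous elements whose degrees are multiples of `m`. -/
def veronese (A M : Type u) [CommRing A] [AddCommGroup M] [Module A M] (m : ℕ) :
    Subalgebra A (WSym A M) :=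
  Algebra.adjoin A {p | ∃ k : ℕ, p ∈ wPiece A M m (m * k)}

variable {A B : Type u} [CommRing A] [CommRing B] {σ : A →+* B}
variable {M N : Type u} [AddCommGroup M] [Module A M] [AddCommGroup N] [Module B N]

theorem wPiece_le_veronese {m k : ℕ} {p : WSym A M} (hp : p ∈ wPiece A M m (m * k)) :
    p ∈ veronese A M m := Algebra.subset_adjoin ⟨k, hp⟩

theorem C_mul_X_pow_mem_wPiece {m i j k : ℕ} {s : SymmetricAlgebra A M} (hs : s ∈ symPiece A M i)
    (h : i + m * j = k) : Polynomial.C s * Polynomial.X ^ j ∈ wPiece A M m k :=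
  Submodule.subset_span ⟨i, j, s, hs, h, rfl⟩

theorem wPiece_mul {m k l : ℕ} {p q : WSym A M} (hp : p ∈ wPiece A M m k)
    (hq : q ∈ wPiece A M m l) : p * q ∈ wPiece A M m (k + l) := by
  have h := Submodule.mul_mem_mul hp hq
  rw [wPiece, wPiece, Submodule.span_mul_span] at h
  refine Submodule.span_mono ?_ h
  rintro _ ⟨_, ⟨i, j, s, hs, rfl, rfl⟩, _, ⟨i', j', s', hs', rfl, rfl⟩, rfl⟩
  refine ⟨i + i', j + j', s * s', ?_, by ring, ?_⟩
  · rw [symPiece, pow_add]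
    exact Submodule.mul_mem_mul hs hs'
  · simp only [Polynomial.C_mul]
    ring

/-- The ring homomorphism `Sym(M)[x₀] → Sym(N)[x₀]` induced by a semilinear map `M → N`. -/
def wMap (φ : M →ₛₗ[σ] N) : WSym A M →+* WSym B N := Polynomial.mapRingHom (symMap φ)

theorem wMap_C (φ : M →ₛₗ[σ] N) (s : SymmetricAlgebra A M) :
    wMap φ (Polynomial.C s) = Polynomial.C (symMap φ s) := by simp [wMap]

theorem wMap_X (φ : M →ₛₗ[σ] N) : wMap φ Polynomial.X = Polynomial.X := by simp [wMap]

theorem wMap_algebraMap (φ : M →ₛₗ[σ] N) (a : A) :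
    wMap φ (algebraMap A _ a) = algebraMap B _ (σ a) := by
  rw [Polynomial.algebraMap_apply, wMap_C, symMap_algebraMap, Polynomial.algebraMap_apply]

theorem wMap_smul (φ : M →ₛₗ[σ] N) (a : A) (x : WSym A M) :
    wMap φ (a • x) = σ a • wMap φ x := by
  rw [Algebra.smul_def, map_mul, wMap_algebraMap, Algebra.smul_def]

theorem wSym_ringHom_ext {T : Type*} [Semiring T] {f g : WSym A M →+* T}
    (h₁ : ∀ a, f (algebraMap A _ a) = g (algebraMap A _ a))
    (h₂ : ∀ x, f (Polynomial.C (SymmetricAlgebra.ι A M x)) =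
      g (Polynomial.C (SymmetricAlgebra.ι A M x)))
    (h₃ : f Polynomial.X = g Polynomial.X) : f = g :=
  Polynomial.ringHom_ext' (sym_ringHom_ext h₁ h₂) h₃

theorem wMap_mem_wPiece (φ : M →ₛₗ[σ] N) {m k : ℕ} {p : WSym A M} (hp : p ∈ wPiece A M m k) :
    wMap φ p ∈ wPiece B N m k := by
  induction hp using Submodule.span_induction with
  | mem x hx =>
    obtain ⟨i, j, s, hs, hk, rfl⟩ := hx
    rw [map_mul, map_pow, wMap_C, wMap_X]
    exact C_mul_X_pow_mem_wPiece (symMap_mem φ hs) hk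
  | zero => rw [map_zero]; exact zero_mem _
  | add x y _ _ hx hy => rw [map_add]; exact add_mem hx hy
  | smul a x _ hx => rw [wMap_smul]; exact Submodule.smul_mem _ _ hx

theorem wMap_mem_veronese (φ : M →ₛₗ[σ] N) {m : ℕ} {p : WSym A M} (hp : p ∈ veronese A M m) :
    wMap φ p ∈ veronese B N m := by
  induction hp using Algebra.adjoin_induction with
  | mem x hx =>
    obtain ⟨k, hk⟩ := hx
    exact wPiece_le_veronese (wMap_mem_wPiece φ hk)
  | algebraMap r => rw [wMap_algebraMap]; exact Subalgebra.algebraMap_mem _ _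
  | add x y _ _ hx hy => rw [map_add]; exact add_mem hx hy
  | mul x y _ _ hx hy => rw [map_mul]; exact mul_mem hx hy

/-- The ring homomorphism of Veronese subalgebras induced by a semilinear map `M → N`. -/
def veroneseMap (φ : M →ₛₗ[σ] N) (m : ℕ) : veronese A M m →+* veronese B N m :=
  (wMap φ).restrict (veronese A M m) (veronese B N m) fun _ h => wMap_mem_veronese φ h

theorem coe_veroneseMap (φ : M →ₛₗ[σ] N) (m : ℕ) (r : veronese A M m) :
    (veroneseMap φ m r : WSym B N) = wMap φ r := rfl

/-- `veroneseMap` as a semilinear map. -/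
def veroneseLin (φ : M →ₛₗ[σ] N) (m : ℕ) : veronese A M m →ₛₗ[σ] veronese B N m where
  toFun := veroneseMap φ m
  map_add' := map_add _
  map_smul' a x := Subtype.ext (wMap_smul φ a x)

/-- The homomorphism `Sym(M)[x₀] → Sym(M)[x₀][T]` that sends a homogeneous element `p` of
degree `k` to `p Tᵏ`. -/
def degHom (A M : Type u) [CommRing A] [AddCommGroup M] [Module A M] (m : ℕ) :
    WSym A M →+* Polynomial (WSym A M) :=
  Polynomial.eval₂RingHom
    (SymmetricAlgebra.lift (R := A) (A := Polynomial (WSym A M))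
      { toFun := fun x => Polynomial.C (Polynomial.C (SymmetricAlgebra.ι A M x)) * Polynomial.X
        map_add' := fun x y => by simp [add_mul]
        map_smul' := fun a x => by
          simp [← Polynomial.smul_C] }).toRingHom
    (Polynomial.C Polynomial.X * Polynomial.X ^ m)

theorem degHom_algebraMap (m : ℕ) (a : A) :
    degHom A M m (algebraMap A _ a) = Polynomial.C (algebraMap A _ a) := by
  rw [Polynomial.algebraMap_apply]
  simp [degHom]

theorem degHom_ι (m : ℕ) (x : M) : degHom A M m (Polynomial.C (SymmetricAlgebra.ι A M x)) =
    Polynomial.C (Polynomial.C (SymmetricAlgebra.ι A M x)) * Polynomial.X := by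
  simp [degHom]

theorem degHom_X (m : ℕ) : degHom A M m Polynomial.X =
    Polynomial.C Polynomial.X * Polynomial.X ^ m := by
  simp [degHom]

theorem degHom_smul (m : ℕ) (a : A) (p : WSym A M) :
    degHom A M m (a • p) = Polynomial.C (algebraMap A _ a) * degHom A M m p := by
  rw [Algebra.smul_def, map_mul, degHom_algebraMap]

theorem degHom_sym (m : ℕ) {i : ℕ} {s : SymmetricAlgebra A M} (hs : s ∈ symPiece A M i) :
    degHom A M m (Polynomial.C s) = Polynomial.C (Polynomial.C s) * Polynomial.X ^ i := by
  induction i generalizing s with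
  | zero =>
    rw [symPiece, pow_zero] at hs
    obtain ⟨a, rfl⟩ := Submodule.mem_one.mp hs
    have := degHom_algebraMap (M := M) m a
    rw [Polynomial.algebraMap_apply] at this
    rw [this, pow_zero, mul_one]
  | succ i ih =>
    rw [symPiece, pow_succ] at hs
    induction hs using Submodule.mul_induction_on' with
    | mem_mul_mem y hy z hz =>
      obtain ⟨x, rfl⟩ := hz
      rw [Polynomial.C_mul, map_mul, ih hy, degHom_ι]
      simp only [Polynomial.C_mul]
      ring
    | add y _ z _ hy hz => simp only [map_add, hy, hz, add_mul]

theorem degHom_wPiece {m k : ℕ} {p : WSym A M} (hp : p ∈ wPiece A M m k) :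
    degHom A M m p = Polynomial.C p * Polynomial.X ^ k := by
  induction hp using Submodule.span_induction with
  | mem x hx =>
    obtain ⟨i, j, s, hs, rfl, rfl⟩ := hx
    rw [map_mul, map_pow, degHom_sym m hs, degHom_X]
    simp only [Polynomial.C_mul, Polynomial.C_pow]
    ring
  | zero => simp
  | add x y _ _ hx hy => simp only [map_add, hx, hy, add_mul]
  | smul a x _ hx =>
    rw [degHom_smul, hx, Algebra.smul_def, Polynomial.C_mul, mul_assoc]

theorem degHom_coeff_mem (m : ℕ) (p : WSym A M) (k : ℕ) :
    (degHom A M m p).coeff k ∈ wPiece A M m k := by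
  have hone : ∀ a : A, algebraMap A (WSym A M) a ∈ wPiece A M m 0 := fun a => by
    refine Submodule.subset_span ⟨0, 0, algebraMap A _ a, ?_, by simp, by
      simp [Polynomial.algebraMap_apply]⟩
    rw [symPiece, pow_zero]
    exact Submodule.mem_one.mpr ⟨a, rfl⟩
  have hmul : ∀ p q : WSym A M, (∀ k, (degHom A M m p).coeff k ∈ wPiece A M m k) →
      (∀ k, (degHom A M m q).coeff k ∈ wPiece A M m k) →
      ∀ k, (degHom A M m (p * q)).coeff k ∈ wPiece A M m k := by
    intro p q hp hq k
    rw [map_mul, Polynomial.coeff_mul]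
    refine Submodule.sum_mem _ fun x hx => ?_
    rw [← Finset.HasAntidiagonal.mem_antidiagonal.mp hx]
    exact wPiece_mul (hp _) (hq _)
  have hhom : ∀ (l : ℕ) (p : WSym A M), p ∈ wPiece A M m l →
      ∀ k, (degHom A M m p).coeff k ∈ wPiece A M m k := by
    intro l p hp k
    rw [degHom_wPiece hp, Polynomial.coeff_C_mul_X_pow]
    split_ifs with h
    · rw [h]; exact hp
    · exact zero_mem _
  have hadd : ∀ p q : WSym A M, (∀ k, (degHom A M m p).coeff k ∈ wPiece A M m k) →
      (∀ k, (degHom A M m q).coeff k ∈ wPiece A M m k) →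
      ∀ k, (degHom A M m (p + q)).coeff k ∈ wPiece A M m k := by
    intro p q hp hq k
    rw [map_add, Polynomial.coeff_add]
    exact add_mem (hp k) (hq k)
  have hC : ∀ (s : SymmetricAlgebra A M) (k : ℕ),
      (degHom A M m (Polynomial.C s)).coeff k ∈ wPiece A M m k := by
    intro s
    induction s using SymmetricAlgebra.induction with
    | algebraMap r => exact hhom 0 _ (hone r)
    | ι x =>
      refine hhom 1 _ (Submodule.subset_span ⟨1, 0, SymmetricAlgebra.ι A M x, ?_, by simp, by simp⟩)
      rw [symPiece, pow_one]
      exact ⟨x, rfl⟩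
    | mul a b ha hb => rw [Polynomial.C_mul]; exact hmul _ _ ha hb
    | add a b ha hb => rw [Polynomial.C_add]; exact hadd _ _ ha hb
  have hX : ∀ k, (degHom A M m Polynomial.X).coeff k ∈ wPiece A M m k := by
    refine hhom m _ (Submodule.subset_span ⟨0, 1, 1, ?_, by simp, by simp⟩)
    rw [symPiece, pow_zero]
    exact Submodule.one_le.mp le_rfl
  induction p using Polynomial.induction_on' generalizing k with
  | add p q hp hq => exact hadd p q hp hq k
  | monomial n s =>
    rw [← Polynomial.C_mul_X_pow_eq_monomial]
    induction n generalizing k with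
    | zero => rw [pow_zero, mul_one]; exact hC s k
    | succ n ih => rw [pow_succ, ← mul_assoc]; exact hmul _ _ ih hX k

theorem eval_one_degHom (m : ℕ) (p : WSym A M) : (degHom A M m p).eval 1 = p := by
  have : (Polynomial.evalRingHom 1).comp (degHom A M m) = RingHom.id (WSym A M) := by
    refine wSym_ringHom_ext (fun a => ?_) (fun x => ?_) ?_
    · rw [RingHom.comp_apply, degHom_algebraMap]
      simp
    · simp [degHom_ι]
    · simp [degHom_X]
  exact RingHom.congr_fun this p

theorem degHom_veronese {m : ℕ} {p : WSym A M} (hp : p ∈ veronese A M m) :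
    ∃ q, degHom A M m p = Polynomial.expand _ m q := by
  induction hp using Algebra.adjoin_induction with
  | mem x hx =>
    obtain ⟨k, hk⟩ := hx
    exact ⟨Polynomial.C x * Polynomial.X ^ k, by
      rw [degHom_wPiece hk]; simp [← pow_mul]⟩
  | algebraMap r => exact ⟨Polynomial.C (algebraMap A _ r), by
      rw [degHom_algebraMap, Polynomial.expand_C]⟩
  | add x y _ _ hx hy =>
    obtain ⟨p, hp⟩ := hx
    obtain ⟨q, hq⟩ := hy
    exact ⟨p + q, by rw [map_add, map_add, hp, hq]⟩
  | mul x y _ _ hx hy =>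
    obtain ⟨p, hp⟩ := hx
    obtain ⟨q, hq⟩ := hy
    exact ⟨p * q, by rw [map_mul, map_mul, hp, hq]⟩

/-- The projection of `Sym(M)[x₀]` to its `m`-th Veronese subalgebra. -/
def veroneseProj (A M : Type u) [CommRing A] [AddCommGroup M] [Module A M] (m : ℕ) [NeZero m] :
    WSym A M →ₗ[A] veronese A M m where
  toFun p := ⟨(Polynomial.contract m (degHom A M m p)).eval 1, by
    rw [Polynomial.eval_eq_sum_range]
    refine Subalgebra.sum_mem _ fun k _ => ?_
    rw [one_pow, mul_one, Polynomial.coeff_contract (NeZero.ne m), mul_comm]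
    exact wPiece_le_veronese (degHom_coeff_mem m p _)⟩
  map_add' p q := Subtype.ext <| by
    have h : Polynomial.contract m (degHom A M m (p + q)) =
        Polynomial.contract m (degHom A M m p) + Polynomial.contract m (degHom A M m q) :=
      Polynomial.ext fun k => by
        simp only [Polynomial.coeff_contract (NeZero.ne m), Polynomial.coeff_add, map_add]
    change Polynomial.eval 1 (Polynomial.contract m (degHom A M m (p + q))) = _
    rw [h, Polynomial.eval_add]
    rfl
  map_smul' a p := Subtype.ext <| by
    have h : Polynomial.contract m (degHom A M m (a • p)) =
        Polynomial.C (algebraMap A _ a) * Polynomial.contract m (degHom A M m p) :=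
      Polynomial.ext fun k => by
        simp only [Polynomial.coeff_contract (NeZero.ne m), degHom_smul, Polynomial.coeff_C_mul]
    change Polynomial.eval 1 (Polynomial.contract m (degHom A M m (a • p))) = _
    rw [h, Polynomial.eval_C_mul, ← Algebra.smul_def]
    rfl

theorem veroneseProj_coe (m : ℕ) [NeZero m] (r : veronese A M m) :
    veroneseProj A M m r = r := by
  obtain ⟨q, hq⟩ := degHom_veronese r.2
  refine Subtype.ext ?_
  change (Polynomial.contract m (degHom A M m r)).eval 1 = r
  have h := eval_one_degHom m (r : WSym A M)
  rw [hq, Polynomial.expand_eval, one_pow] at h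
  rw [hq, Polynomial.contract_expand _ (NeZero.ne m), h]

theorem IsScalarExtension.exists_wSym {φ : M →ₛₗ[σ] N} (h : IsScalarExtension φ) :
    ∃ θ : WSym B N →ₗ[B] ExtScalars σ (WSym A M),
      ∀ p, θ (wMap φ p) = toExtScalars σ (WSym A M) p := by
  let _ : Algebra A B := σ.toAlgebra
  let j : WSym A M →+* TensorProduct A B (WSym A M) :=
    (Algebra.TensorProduct.includeRight : WSym A M →ₐ[A] TensorProduct A B (WSym A M)).toRingHom
  have hj : ∀ a, j (algebraMap A _ a) = algebraMap B _ (σ a) := fun a =>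
    (AlgHom.commutes
      (Algebra.TensorProduct.includeRight : WSym A M →ₐ[A] TensorProduct A B (WSym A M)) a).trans
      (IsScalarTower.algebraMap_apply A B _ a)
  let g : M →ₛₗ[σ] TensorProduct A B (WSym A M) :=
    { toFun := fun x => j (Polynomial.C (SymmetricAlgebra.ι A M x))
      map_add' := fun x y => by simp
      map_smul' := fun a x => by
        rw [map_smul, ← Polynomial.smul_C, Algebra.smul_def, map_mul, hj]
        exact (Algebra.smul_def _ _).symm }
  let f : WSym B N →+* TensorProduct A B (WSym A M) :=
    Polynomial.eval₂RingHom (SymmetricAlgebra.lift (h.lift g)).toRingHom (j Polynomial.X)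
  have hf : ∀ b, f (algebraMap B _ b) = algebraMap B _ b := fun b => by
    rw [Polynomial.algebraMap_apply]
    simp [f]
  have hfj : f.comp (wMap φ) = j := by
    refine wSym_ringHom_ext (fun a => ?_) (fun x => ?_) ?_
    · rw [RingHom.comp_apply, wMap_algebraMap, hf, hj]
    · rw [RingHom.comp_apply, wMap_C, symMap_ι]
      simp [f, h.lift_apply, g]
    · rw [RingHom.comp_apply, wMap_X]
      simp [f]
  refine ⟨({ toFun := f, map_add' := map_add f, map_smul' := fun b p => ?_ } :
    WSym B N →ₗ[B] TensorProduct A B (WSym A M)), fun p => RingHom.congr_fun hfj p⟩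
  rw [Algebra.smul_def, map_mul, hf, RingHom.id_apply]
  exact (Algebra.smul_def _ _).symm

/-- The Veronese subalgebra commutes with scalar extension. -/
theorem IsScalarExtension.veronese {φ : M →ₛₗ[σ] N} (h : IsScalarExtension φ) (m : ℕ) [NeZero m] :
    IsScalarExtension (M := veronese A M m) (N := veronese B N m) (veroneseLin φ m) := by
  obtain ⟨θ, hθ⟩ := h.exists_wSym
  have hT : IsScalarExtension (toExtScalars σ (WSym A M)) := isScalarExtension_toExtScalars
  let g : WSym A M →ₛₗ[σ] ExtScalars σ (CliffordSpec.veronese A M m) :=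
    (toExtScalars σ (CliffordSpec.veronese A M m)).comp (veroneseProj A M m)
  refine .of_section ?_ ((hT.lift g).comp (θ.comp (CliffordSpec.veronese B N m).val.toLinearMap))
    fun r => ?_
  · let V : Subalgebra B (CliffordSpec.veronese B N m) :=
      (Submodule.span B (Set.range (veroneseLin φ m))).toSubalgebra
        (Submodule.subset_span ⟨1, map_one (veroneseMap φ m)⟩) (by
          intro x y hx hy
          have := Submodule.mul_mem_mul hx hy
          rw [Submodule.span_mul_span] at this
          refine Submodule.span_mono ?_ this
          rintro _ ⟨_, ⟨r, rfl⟩, _, ⟨s, rfl⟩, rfl⟩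
          exact ⟨r * s, map_mul (veroneseMap φ m) r s⟩)
    have hp : ∀ (k : ℕ) (p : WSym B N) (hp : p ∈ wPiece B N m (m * k)),
        (⟨p, wPiece_le_veronese hp⟩ : CliffordSpec.veronese B N m) ∈ V := by
      intro k p hp
      have h1 : wPiece B N m (m * k) ≤ (Submodule.span B (Set.range (veroneseLin φ m))).map
          (CliffordSpec.veronese B N m).val.toLinearMap := by
        refine Submodule.span_le.mpr ?_
        rintro _ ⟨i, j, s, hs, hk, rfl⟩
        rw [symPiece_eq_span h] at hs
        induction hs using Submodule.span_induction with
        | mem x hx =>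
          obtain ⟨t, ht, rfl⟩ := hx
          have hm := wPiece_le_veronese (C_mul_X_pow_mem_wPiece ht hk)
          refine ⟨veroneseLin φ m ⟨_, hm⟩, Submodule.subset_span ⟨_, rfl⟩, ?_⟩
          change wMap φ (Polynomial.C t * Polynomial.X ^ j) = _
          rw [map_mul, map_pow, wMap_C, wMap_X]
        | zero => rw [Polynomial.C_0, zero_mul]; exact zero_mem _
        | add x y _ _ hx hy => rw [Polynomial.C_add, add_mul]; exact add_mem hx hy
        | smul b x _ hx =>
          rw [← Polynomial.smul_C, smul_mul_assoc]
          exact Submodule.smul_mem _ _ hx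
      obtain ⟨q, hq, hqp⟩ := h1 hp
      have : (⟨p, wPiece_le_veronese hp⟩ : CliffordSpec.veronese B N m) = q :=
        Subtype.ext hqp.symm
      rw [this]
      exact hq
    have hV : CliffordSpec.veronese B N m ≤ V.map (CliffordSpec.veronese B N m).val := by
      refine Algebra.adjoin_le ?_
      rintro x ⟨k, hk⟩
      exact ⟨_, hp k x hk, rfl⟩
    rw [eq_top_iff]
    rintro p -
    obtain ⟨q, hq, hqp⟩ := hV p.2
    have hqp' : q = p := Subtype.ext hqp
    rw [← hqp']
    exact hq
  · change hT.lift g (θ (wMap φ r)) = _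
    rw [hθ, hT.lift_apply]
    change toExtScalars σ _ (veroneseProj A M m r) = _
    rw [veroneseProj_coe]

end Weighted

/-! ### Composition of scalar extensions -/

section Composition

variable {A B C : Type u} [CommRing A] [CommRing B] [CommRing C]
variable {σ : A →+* B} {τ : B →+* C} {ρ : A →+* C}
variable {M N P : Type u} [AddCommGroup M] [Module A M] [AddCommGroup N] [Module B N]
  [AddCommGroup P] [Module C P]

theorem IsScalarExtension.of_bijective {φ : M →ₛₗ[σ] N} (hσ : Function.Surjective σ)
    (hφ : Function.Bijective φ) : IsScalarExtension φ := by
  let e := Equiv.ofBijective φ hφ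
  have he : ∀ x, e.symm (φ x) = x := e.symm_apply_apply
  refine .of_section ?_
    { toFun := fun n => toExtScalars σ M (e.symm n)
      map_add' := fun x y => by
        obtain ⟨x, rfl⟩ := hφ.2 x
        obtain ⟨y, rfl⟩ := hφ.2 y
        rw [← map_add, he, he, he, map_add]
      map_smul' := fun b x => by
        obtain ⟨x, rfl⟩ := hφ.2 x
        obtain ⟨a, rfl⟩ := hσ b
        rw [← map_smulₛₗ, he, he, map_smulₛₗ, RingHom.id_apply] } fun x => ?_
  · rw [hφ.2.range_eq, Submodule.span_univ]
  · exact congrArg (toExtScalars σ M) (he x)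

theorem IsScalarExtension.comp {φ : M →ₛₗ[σ] N} {ψ : N →ₛₗ[τ] P} {χ : M →ₛₗ[ρ] P}
    (hφ : IsScalarExtension φ) (hψ : IsScalarExtension ψ) (hρ : ∀ a, ρ a = τ (σ a))
    (hχ : ∀ x, χ x = ψ (φ x)) : IsScalarExtension χ := by
  obtain rfl : ρ = τ.comp σ := RingHom.ext hρ
  let _ : Module B (ExtScalars (τ.comp σ) M) := Module.compHom _ τ
  obtain ⟨g, hg⟩ := hφ.exists_lift (P := ExtScalars (τ.comp σ) M)
    { toFun := toExtScalars (τ.comp σ) M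
      map_add' := map_add _
      map_smul' := fun a x => map_smulₛₗ (toExtScalars (τ.comp σ) M) a x }
  obtain ⟨θ, hθ⟩ := hψ.exists_lift (P := ExtScalars (τ.comp σ) M)
    { toFun := g
      map_add' := map_add _
      map_smul' := fun a x => map_smul g a x }
  refine .of_section ?_ θ fun x => ?_
  · rw [eq_top_iff, ← hψ.span_eq_top, Submodule.span_le]
    rintro _ ⟨n, rfl⟩
    have hn : n ∈ Submodule.span B (Set.range φ) := hφ.span_eq_top ▸ Submodule.mem_top
    induction hn using Submodule.span_induction with
    | mem x hx =>
      obtain ⟨m, rfl⟩ := hx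
      exact Submodule.subset_span ⟨m, hχ m⟩
    | zero => rw [map_zero]; exact zero_mem _
    | add x y _ _ hx hy => rw [map_add]; exact add_mem hx hy
    | smul b x _ hx => rw [map_smulₛₗ]; exact Submodule.smul_mem _ _ hx
  · rw [hχ, hθ]
    exact hg x

theorem IsScalarExtension.exists_equiv {N' : Type u} [AddCommGroup N'] [Module B N']
    {φ : M →ₛₗ[σ] N} {φ' : M →ₛₗ[σ] N'} (h : IsScalarExtension φ) (h' : IsScalarExtension φ') :
    ∃ e : N ≃ₗ[B] N', ∀ x, e (φ x) = φ' x :=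
  ⟨LinearEquiv.ofLinearMap (h.lift φ') (h'.lift φ)
    (h'.hom_ext fun x => by simp [h.lift_apply, h'.lift_apply])
    (h.hom_ext fun x => by simp [h.lift_apply, h'.lift_apply]), h.lift_apply φ'⟩

end Composition

/-! ### Line bundle quotients and points of weighted projective bundles over a ring -/

section LinePt

/-- A line bundle `L` over `Spec A` with a surjection `q : M → L`. -/
structure LinePt (A M : Type u) [CommRing A] [AddCommGroup M] [Module A M] where
  L : Type u
  [grp : AddCommGroup L]
  [mod : Module A L]
  [inv : Module.Invertible A L]
  q : M →ₗ[A] L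
  surj : Function.Surjective q

attribute [instance] LinePt.grp LinePt.mod LinePt.inv

/-- Two quotients `M → L` and `M → L'` are equivalent if there is an isomorphism `L ≅ L'` under
`M`. -/
instance LinePt.setoid (A M : Type u) [CommRing A] [AddCommGroup M] [Module A M] :
    Setoid (LinePt A M) where
  r p p' := ∃ e : p.L ≃ₗ[A] p'.L, ∀ x, e (p.q x) = p'.q x
  iseqv :=
    { refl := fun p => ⟨LinearEquiv.refl A p.L, fun _ => rfl⟩
      symm := fun ⟨e, h⟩ => ⟨e.symm, fun x => by rw [← h, e.symm_apply_apply]⟩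
      trans := fun ⟨e, h⟩ ⟨e', h'⟩ => ⟨e.trans e', fun x => by
        rw [LinearEquiv.trans_apply, h, h']⟩ }

variable {A B C : Type u} [CommRing A] [CommRing B] [CommRing C]
variable {σ : A →+* B} {τ : B →+* C} {ρ : A →+* C}
variable {M N P : Type u} [AddCommGroup M] [Module A M] [AddCommGroup N] [Module B N]
  [AddCommGroup P] [Module C P]

/-- `p' : N → L'` is a pullback of `p : M → L` along `σ`. -/
def LinePt.IsPullback (φ : M →ₛₗ[σ] N) (p : LinePt A M) (p' : LinePt B N) : Prop :=
  ∃ j : p.L →ₛₗ[σ] p'.L, IsScalarExtension j ∧ ∀ x, p'.q (φ x) = j (p.q x)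

/-- The pullback `B ⊗ M → B ⊗ L` of a quotient `M → L`. -/
def LinePt.pullback {φ : M →ₛₗ[σ] N} (h : IsScalarExtension φ) (p : LinePt A M) :
    LinePt B N where
  L := ExtScalars σ p.L
  q := h.lift ((toExtScalars σ p.L).comp p.q)
  surj := by
    rw [← LinearMap.range_eq_top, eq_top_iff, ← span_range_toExtScalars σ p.L, Submodule.span_le]
    rintro _ ⟨l, rfl⟩
    obtain ⟨x, rfl⟩ := p.surj l
    exact ⟨φ x, h.lift_apply _ x⟩

theorem LinePt.isPullback_pullback {φ : M →ₛₗ[σ] N} (h : IsScalarExtension φ) (p : LinePt A M) :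
    p.IsPullback φ (p.pullback h) :=
  ⟨toExtScalars σ p.L, isScalarExtension_toExtScalars, fun x => h.lift_apply _ x⟩

theorem LinePt.IsPullback.equiv {φ : M →ₛₗ[σ] N} (h : IsScalarExtension φ) {p₁ p₂ : LinePt A M}
    {p₁' p₂' : LinePt B N} (hp : p₁ ≈ p₂) (h₁ : p₁.IsPullback φ p₁') (h₂ : p₂.IsPullback φ p₂') :
    p₁' ≈ p₂' := by
  obtain ⟨j₁, hj₁, e₁⟩ := h₁
  obtain ⟨j₂, hj₂, e₂⟩ := h₂
  obtain ⟨e, he⟩ := hp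
  have hj : IsScalarExtension (j₂.comp e.toLinearMap) :=
    IsScalarExtension.comp (σ := RingHom.id A) (φ := e.toLinearMap)
      (.of_bijective Function.surjective_id e.bijective) hj₂ (fun _ => rfl) fun _ => rfl
  obtain ⟨k, hk⟩ := hj₁.exists_equiv hj
  refine ⟨k, fun y => ?_⟩
  refine LinearMap.congr_fun (h.hom_ext (g := k.toLinearMap.comp p₁'.q) (g' := p₂'.q)
    fun x => ?_) y
  change k (p₁'.q (φ x)) = p₂'.q (φ x)
  rw [e₁, hk, e₂, ← he]
  rfl

theorem LinePt.IsPullback.of_id {σ : A →+* A} (hσ : ∀ a, σ a = a) {φ : M →ₛₗ[σ] M}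
    (hφ : ∀ x, φ x = x) (p : LinePt A M) : p.IsPullback φ p := by
  obtain rfl : σ = RingHom.id A := RingHom.ext hσ
  exact ⟨LinearMap.id, .of_bijective Function.surjective_id Function.bijective_id,
    fun x => by rw [hφ]; rfl⟩

theorem LinePt.IsPullback.trans {φ : M →ₛₗ[σ] N} {ψ : N →ₛₗ[τ] P} {χ : M →ₛₗ[ρ] P}
    (hρ : ∀ a, ρ a = τ (σ a)) (hχ : ∀ x, χ x = ψ (φ x)) {p : LinePt A M} {p' : LinePt B N}
    {p'' : LinePt C P} (h : p.IsPullback φ p') (h' : p'.IsPullback ψ p'') :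
    p.IsPullback χ p'' := by
  obtain rfl : ρ = τ.comp σ := RingHom.ext hρ
  obtain ⟨j, hj, e⟩ := h
  obtain ⟨k, hk, e'⟩ := h'
  have _ : RingHomCompTriple σ τ (τ.comp σ) := ⟨rfl⟩
  exact ⟨k.comp j, hj.comp hk (fun _ => rfl) fun _ => rfl, fun x => by rw [hχ, e', e]; rfl⟩

/-- The map on equivalence classes of quotients given by pullback. -/
def LinePt.mapClass {φ : M →ₛₗ[σ] N} (h : IsScalarExtension φ) :
    Quotient (LinePt.setoid A M) → Quotient (LinePt.setoid B N) :=
  Quotient.map (LinePt.pullback h) fun p₁ p₂ hp =>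
    LinePt.IsPullback.equiv h hp (p₁.isPullback_pullback h) (p₂.isPullback_pullback h)

theorem LinePt.mapClass_eq {φ : M →ₛₗ[σ] N} (h : IsScalarExtension φ) {p : LinePt A M}
    {p' : LinePt B N} (hp : p.IsPullback φ p') :
    LinePt.mapClass h (Quotient.mk _ p) = Quotient.mk _ p' :=
  Quotient.sound (LinePt.IsPullback.equiv h (Setoid.refl p) (p.isPullback_pullback h) hp)

end LinePt

section WPt

variable {A B C : Type u} [CommRing A] [CommRing B] [CommRing C]
variable {σ : A →+* B} {τ : B →+* C} {ρ : A →+* C}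
variable {M N P : Type u} [AddCommGroup M] [Module A M] [AddCommGroup N] [Module B N]
  [AddCommGroup P] [Module C P]

theorem symMap_comp {φ : M →ₛₗ[σ] N} {ψ : N →ₛₗ[τ] P} {χ : M →ₛₗ[ρ] P}
    (hρ : ∀ a, ρ a = τ (σ a)) (hχ : ∀ x, χ x = ψ (φ x)) (s : SymmetricAlgebra A M) :
    symMap χ s = symMap ψ (symMap φ s) := by
  have : symMap χ = (symMap ψ).comp (symMap φ) :=
    sym_ringHom_ext (fun a => by
      rw [RingHom.comp_apply, symMap_algebraMap, symMap_algebraMap, symMap_algebraMap, hρ])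
      fun x => by rw [RingHom.comp_apply, symMap_ι, symMap_ι, symMap_ι, hχ]
  rw [this, RingHom.comp_apply]

theorem symMap_id {σ : A →+* A} (hσ : ∀ a, σ a = a) {φ : M →ₛₗ[σ] M}
    (hφ : ∀ x, φ x = x) (s : SymmetricAlgebra A M) : symMap φ s = s := by
  have : symMap φ = RingHom.id _ :=
    sym_ringHom_ext (fun a => by rw [symMap_algebraMap, hσ]; rfl)
      fun x => by rw [symMap_ι, hφ]; rfl
  rw [this, RingHom.id_apply]

/-- A line bundle `L` over `Spec A` with a homomorphism `h` of graded algebras from the `m`-th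
Veronese subalgebra of `Sym(M)[x₀]` to `⨁ⱼ L^{⊗ j} = Sym(L)`, which is surjective in degree one,
that is `Sym^m(M) ⊕ A x₀ → L` is surjective. -/
structure WPt (A M : Type u) [CommRing A] [AddCommGroup M] [Module A M] (m : ℕ) where
  L : Type u
  [grp : AddCommGroup L]
  [mod : Module A L]
  [inv : Module.Invertible A L]
  h : veronese A M m →ₐ[A] SymmetricAlgebra A L
  graded : ∀ (k : ℕ) (r : veronese A M m), (r : WSym A M) ∈ wPiece A M m (m * k) →
    h r ∈ symPiece A L k
  surj : ∀ l : L, ∃ r : veronese A M m, (r : WSym A M) ∈ wPiece A M m m ∧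
    h r = SymmetricAlgebra.ι A L l

attribute [instance] WPt.grp WPt.mod WPt.inv

/-- Two points `(L, h)` and `(L', h')` are equivalent if there is an isomorphism `L ≅ L'` that
carries `h` to `h'`. -/
instance WPt.setoid (A M : Type u) [CommRing A] [AddCommGroup M] [Module A M] (m : ℕ) :
    Setoid (WPt A M m) where
  r p p' := ∃ e : p.L ≃ₗ[A] p'.L, ∀ r, symMap e.toLinearMap (p.h r) = p'.h r
  iseqv :=
    { refl := fun p => ⟨LinearEquiv.refl A p.L, fun r => symMap_id (fun _ => rfl) (fun _ => rfl) _⟩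
      symm := fun {p p'} ⟨e, h⟩ => ⟨e.symm, fun r => by
        rw [← h, ← symMap_comp (χ := LinearMap.id) (fun _ => rfl)
          (fun x => (e.symm_apply_apply x).symm), symMap_id (fun _ => rfl) (fun _ => rfl)]⟩
      trans := fun {p p' p''} ⟨e, h⟩ ⟨e', h'⟩ => ⟨e.trans e', fun r => by
        rw [← h', ← h]
        exact symMap_comp (fun _ => rfl) (fun _ => rfl) _⟩ }

/-- `p'` is a pullback of `p` along `σ`. -/
def WPt.IsPullback {m : ℕ} (φ : M →ₛₗ[σ] N) (p : WPt A M m) (p' : WPt B N m) : Prop :=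
  ∃ j : p.L →ₛₗ[σ] p'.L, IsScalarExtension j ∧
    ∀ r, p'.h (veroneseMap φ m r) = symMap j (p.h r)

theorem wMap_comp {φ : M →ₛₗ[σ] N} {ψ : N →ₛₗ[τ] P} {χ : M →ₛₗ[ρ] P}
    (hρ : ∀ a, ρ a = τ (σ a)) (hχ : ∀ x, χ x = ψ (φ x)) (s : WSym A M) :
    wMap χ s = wMap ψ (wMap φ s) := by
  have : wMap χ = (wMap ψ).comp (wMap φ) :=
    wSym_ringHom_ext (fun a => by
      rw [RingHom.comp_apply, wMap_algebraMap, wMap_algebraMap, wMap_algebraMap, hρ])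
      (fun x => by rw [RingHom.comp_apply, wMap_C, wMap_C, wMap_C, symMap_comp hρ hχ])
      (by rw [RingHom.comp_apply, wMap_X, wMap_X, wMap_X])
  rw [this, RingHom.comp_apply]

theorem wMap_id {σ : A →+* A} (hσ : ∀ a, σ a = a) {φ : M →ₛₗ[σ] M}
    (hφ : ∀ x, φ x = x) (s : WSym A M) : wMap φ s = s := by
  have : wMap φ = RingHom.id _ :=
    wSym_ringHom_ext (fun a => by rw [wMap_algebraMap, hσ]; rfl)
      (fun x => by rw [wMap_C, symMap_id hσ hφ]; rfl) (by rw [wMap_X]; rfl)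
  rw [this, RingHom.id_apply]

/-- The graded pieces of `Sym(M)[x₀]` commute with scalar extension. -/
theorem IsScalarExtension.wPiece_eq_span {φ : M →ₛₗ[σ] N} (hφ : IsScalarExtension φ) (m k : ℕ) :
    wPiece B N m k ≤ Submodule.span B (wMap φ '' wPiece A M m k) := by
  refine Submodule.span_le.mpr ?_
  rintro _ ⟨i, j, s, hs, hk, rfl⟩
  rw [symPiece_eq_span hφ] at hs
  induction hs using Submodule.span_induction with
  | mem x hx =>
    obtain ⟨t, ht, rfl⟩ := hx
    refine Submodule.subset_span ⟨_, C_mul_X_pow_mem_wPiece ht hk, ?_⟩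
    rw [map_mul, map_pow, wMap_C, wMap_X]
  | zero => rw [Polynomial.C_0, zero_mul]; exact zero_mem _
  | add x y _ _ hx hy => rw [Polynomial.C_add, add_mul]; exact add_mem hx hy
  | smul b x _ hx =>
    rw [← Polynomial.smul_C, smul_mul_assoc]
    exact Submodule.smul_mem _ _ hx

/-- The pullback of a point along a ring homomorphism. -/
theorem WPt.exists_pullback {m : ℕ} [NeZero m] {φ : M →ₛₗ[σ] N} (hφ : IsScalarExtension φ)
    (p : WPt A M m) : ∃ p' : WPt B N m, p.IsPullback φ p' := by
  have hv := hφ.veronese m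
  let j := toExtScalars σ p.L
  let g : CliffordSpec.veronese A M m →ₛₗ[σ] SymmetricAlgebra B (ExtScalars σ p.L) :=
    { toFun := fun r => symMap j (p.h r)
      map_add' := fun x y => by rw [map_add, map_add]
      map_smul' := fun a x => by rw [map_smul, symMap_smul] }
  let l := hv.lift g
  have hl : ∀ r, l (veroneseMap φ m r) = symMap j (p.h r) := hv.lift_apply g
  have hspan : ∀ x : CliffordSpec.veronese B N m,
      x ∈ Submodule.span B (Set.range (veroneseLin φ m)) := fun x =>
    hv.span_eq_top ▸ Submodule.mem_top
  have hmul : ∀ x y, l (x * y) = l x * l y := by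
    intro x y
    induction hspan x using Submodule.span_induction with
    | zero => rw [zero_mul, map_zero, zero_mul]
    | add a b _ _ ha hb => rw [add_mul, map_add, map_add, ha, hb, add_mul]
    | smul b a _ ha => rw [smul_mul_assoc, map_smul, map_smul, ha, smul_mul_assoc]
    | mem a ha =>
      obtain ⟨r, rfl⟩ := ha
      induction hspan y using Submodule.span_induction with
      | zero => rw [mul_zero, map_zero, mul_zero]
      | add a b _ _ ha hb => rw [mul_add, map_add, map_add, ha, hb, mul_add]
      | smul b a _ ha => rw [mul_smul_comm, map_smul, map_smul, ha, mul_smul_comm]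
      | mem b hb =>
        obtain ⟨s, rfl⟩ := hb
        change l (veroneseMap φ m r * veroneseMap φ m s) =
          l (veroneseMap φ m r) * l (veroneseMap φ m s)
        rw [← map_mul, hl, hl, hl, map_mul, map_mul]
  have hone : l 1 = 1 := by
    rw [← map_one (veroneseMap φ m), hl, map_one, map_one]
  let h' : CliffordSpec.veronese B N m →ₐ[B] SymmetricAlgebra B (ExtScalars σ p.L) :=
    AlgHom.ofLinearMap l hone hmul
  refine ⟨{ L := ExtScalars σ p.L, h := h', graded := ?_, surj := ?_ }, j,
    isScalarExtension_toExtScalars, hl⟩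
  · intro k r hr
    have h1 : wPiece B N m (m * k) ≤
        ((symPiece B (ExtScalars σ p.L) k).comap l).map
          (CliffordSpec.veronese B N m).val.toLinearMap := by
      refine (hφ.wPiece_eq_span m (m * k)).trans (Submodule.span_le.mpr ?_)
      rintro _ ⟨s, hs, rfl⟩
      refine ⟨veroneseMap φ m ⟨s, wPiece_le_veronese hs⟩, ?_, rfl⟩
      change l _ ∈ symPiece B (ExtScalars σ p.L) k
      rw [hl]
      exact symMap_mem j (p.graded k _ hs)
    obtain ⟨r', hr', he⟩ := h1 hr
    obtain rfl : r' = r := Subtype.ext he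
    exact hr'
  · intro x
    have hx : x ∈ Submodule.span B (Set.range j) :=
      span_range_toExtScalars σ p.L ▸ Submodule.mem_top
    induction hx using Submodule.span_induction with
    | zero => exact ⟨0, zero_mem _, by rw [map_zero, map_zero]⟩
    | add a b _ _ ha hb =>
      obtain ⟨r, hr, hr'⟩ := ha
      obtain ⟨s, hs, hs'⟩ := hb
      exact ⟨r + s, add_mem hr hs, by rw [map_add, map_add, hr', hs']⟩
    | smul b a _ ha =>
      obtain ⟨r, hr, hr'⟩ := ha
      exact ⟨b • r, Submodule.smul_mem _ b hr, by rw [map_smul, map_smul, hr']⟩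
    | mem a ha =>
      obtain ⟨y, rfl⟩ := ha
      obtain ⟨r, hr, hr'⟩ := p.surj y
      refine ⟨veroneseMap φ m r, wMap_mem_wPiece φ hr, ?_⟩
      change l _ = _
      rw [hl, hr', symMap_ι]

theorem WPt.IsPullback.equiv {m : ℕ} [NeZero m] {φ : M →ₛₗ[σ] N} (hφ : IsScalarExtension φ)
    {p₁ p₂ : WPt A M m} {p₁' p₂' : WPt B N m} (hp : p₁ ≈ p₂) (h₁ : p₁.IsPullback φ p₁')
    (h₂ : p₂.IsPullback φ p₂') : p₁' ≈ p₂' := by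
  obtain ⟨j₁, hj₁, e₁⟩ := h₁
  obtain ⟨j₂, hj₂, e₂⟩ := h₂
  obtain ⟨e, he⟩ := hp
  have hj : IsScalarExtension (j₂.comp e.toLinearMap) :=
    IsScalarExtension.comp (σ := RingHom.id A) (φ := e.toLinearMap)
      (.of_bijective Function.surjective_id e.bijective) hj₂ (fun _ => rfl) fun _ => rfl
  obtain ⟨k, hk⟩ := hj₁.exists_equiv hj
  refine ⟨k, fun y => ?_⟩
  let g : CliffordSpec.veronese B N m →ₗ[B] SymmetricAlgebra B p₂'.L :=
    { toFun := fun r => symMap k.toLinearMap (p₁'.h r)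
      map_add' := fun x y => by rw [map_add, map_add]
      map_smul' := fun b x => by rw [map_smul, symMap_smul] }
  refine LinearMap.congr_fun ((hφ.veronese m).hom_ext (g := g) (g' := p₂'.h.toLinearMap)
    fun x => ?_) y
  change symMap k.toLinearMap (p₁'.h (veroneseMap φ m x)) = p₂'.h (veroneseMap φ m x)
  rw [e₁, e₂, ← he, ← symMap_comp (χ := j₂.comp e.toLinearMap) (fun _ => rfl) (fun _ => rfl)]
  exact (symMap_comp (fun _ => rfl) (fun x => (hk x).symm) _).symm

theorem WPt.IsPullback.of_id {m : ℕ} {σ : A →+* A} (hσ : ∀ a, σ a = a) {φ : M →ₛₗ[σ] M}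
    (hφ : ∀ x, φ x = x) (p : WPt A M m) : p.IsPullback φ p := by
  obtain rfl : σ = RingHom.id A := RingHom.ext hσ
  refine ⟨LinearMap.id, .of_bijective Function.surjective_id Function.bijective_id, fun r => ?_⟩
  have hr : veroneseMap φ m r = r := Subtype.ext (wMap_id hσ hφ _)
  rw [hr, symMap_id (fun _ => rfl) (fun _ => rfl)]

theorem WPt.IsPullback.trans {m : ℕ} {φ : M →ₛₗ[σ] N} {ψ : N →ₛₗ[τ] P} {χ : M →ₛₗ[ρ] P}
    (hρ : ∀ a, ρ a = τ (σ a)) (hχ : ∀ x, χ x = ψ (φ x)) {p : WPt A M m} {p' : WPt B N m}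
    {p'' : WPt C P m} (h : p.IsPullback φ p') (h' : p'.IsPullback ψ p'') :
    p.IsPullback χ p'' := by
  obtain rfl : ρ = τ.comp σ := RingHom.ext hρ
  obtain ⟨j, hj, e⟩ := h
  obtain ⟨k, hk, e'⟩ := h'
  have _ : RingHomCompTriple σ τ (τ.comp σ) := ⟨rfl⟩
  refine ⟨k.comp j, hj.comp hk (fun _ => rfl) fun _ => rfl, fun r => ?_⟩
  have hr : veroneseMap χ m r = veroneseMap ψ m (veroneseMap φ m r) :=
    Subtype.ext (wMap_comp hρ hχ _)
  rw [hr, e', e, symMap_comp (χ := k.comp j) (fun _ => rfl) fun _ => rfl]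

/-- A chosen pullback of a point along a ring homomorphism. -/
def WPt.pullback {m : ℕ} [NeZero m] {φ : M →ₛₗ[σ] N} (hφ : IsScalarExtension φ) (p : WPt A M m) :
    WPt B N m := (p.exists_pullback hφ).choose

theorem WPt.isPullback_pullback {m : ℕ} [NeZero m] {φ : M →ₛₗ[σ] N} (hφ : IsScalarExtension φ)
    (p : WPt A M m) : p.IsPullback φ (p.pullback hφ) := (p.exists_pullback hφ).choose_spec

/-- The map on equivalence classes of points given by pullback. -/
def WPt.mapClass {m : ℕ} [NeZero m] {φ : M →ₛₗ[σ] N} (h : IsScalarExtension φ) :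
    Quotient (WPt.setoid A M m) → Quotient (WPt.setoid B N m) :=
  Quotient.map (WPt.pullback h) fun p₁ p₂ hp =>
    WPt.IsPullback.equiv h hp (p₁.isPullback_pullback h) (p₂.isPullback_pullback h)

theorem WPt.mapClass_eq {m : ℕ} [NeZero m] {φ : M →ₛₗ[σ] N} (h : IsScalarExtension φ)
    {p : WPt A M m} {p' : WPt B N m} (hp : p.IsPullback φ p') :
    WPt.mapClass h (Quotient.mk _ p) = Quotient.mk _ p' :=
  Quotient.sound (WPt.IsPullback.equiv h (Setoid.refl p) (p.isPullback_pullback h) hp)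

end WPt

/-! ### Quasi-coherent modules, algebras, and polynomial laws

A functor `R : C ⥤ CommRingCat` is fixed. In the application, the objects of `C` are the affine
points `Spec A → S` of a scheme (or functor) `S`, and `R` maps such a point to `A`. -/

section Sheaves

variable {C : Type v} [Category.{w} C]

/-- A presheaf of modules: an `R(c)`-module for every `c`, with semilinear transition maps. -/
structure ModPsh (R : C ⥤ CommRingCat.{u}) where
  obj : C → Type u
  [grp : ∀ c, AddCommGroup (obj c)]
  [mod : ∀ c, Module (R.obj c) (obj c)]
  map : ∀ {c c' : C} (f : c ⟶ c'), obj c →ₛₗ[(R.map f).hom] obj c'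
  map_id : ∀ (c : C) (x : obj c), map (𝟙 c) x = x
  map_comp : ∀ {c c' c'' : C} (f : c ⟶ c') (g : c' ⟶ c'') (x : obj c),
    map (f ≫ g) x = map g (map f x)

attribute [instance] ModPsh.grp ModPsh.mod

/-- A presheaf of modules is quasi-coherent if `F(c) ⊗ R(c') → F(c')` is an isomorphism for all
`c ⟶ c'`. -/
def ModPsh.IsQuasiCoherent {R : C ⥤ CommRingCat.{u}} (F : ModPsh R) : Prop :=
  ∀ ⦃c c' : C⦄ (f : c ⟶ c'), IsScalarExtension (F.map f)

/-- A presheaf of associative unital (not necessarily commutative) `R`-algebras. -/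
structure AlgPsh (R : C ⥤ CommRingCat.{u}) where
  obj : C → Type u
  [ring : ∀ c, Ring (obj c)]
  [alg : ∀ c, Algebra (R.obj c) (obj c)]
  map : ∀ {c c' : C} (_ : c ⟶ c'), obj c →+* obj c'
  map_algebraMap : ∀ {c c' : C} (f : c ⟶ c') (a : R.obj c),
    map f (algebraMap (R.obj c) (obj c) a) = algebraMap (R.obj c') (obj c') ((R.map f).hom a)
  map_id : ∀ (c : C) (x : obj c), map (𝟙 c) x = x
  map_comp : ∀ {c c' c'' : C} (f : c ⟶ c') (g : c' ⟶ c'') (x : obj c),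
    map (f ≫ g) x = map g (map f x)

attribute [instance] AlgPsh.ring AlgPsh.alg

variable {R : C ⥤ CommRingCat.{u}}

/-- The presheaf of modules underlying a presheaf of algebras. -/
abbrev AlgPsh.toMod (A : AlgPsh R) : ModPsh R where
  obj := A.obj
  map f :=
    { toFun := A.map f
      map_add' := map_add _
      map_smul' := fun a x => by
        rw [Algebra.smul_def, map_mul, A.map_algebraMap, ← Algebra.smul_def] }
  map_id := A.map_id
  map_comp := A.map_comp

/-- The structure sheaf. -/
def structureSheaf (R : C ⥤ CommRingCat.{u}) : AlgPsh R where
  obj c := R.obj c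
  map f := (R.map f).hom
  map_algebraMap _ _ := rfl
  map_id c x := by simp
  map_comp f g x := by simp

/-- The direct sum of `n` copies of a presheaf of modules. -/
abbrev ModPsh.power (F : ModPsh R) (n : ℕ) : ModPsh R where
  obj c := Fin n → F.obj c
  map f :=
    { toFun := fun b i => F.map f (b i)
      map_add' := fun _ _ => funext fun _ => map_add _ _ _
      map_smul' := fun _ _ => funext fun _ => map_smulₛₗ _ _ _ }
  map_id c x := funext fun i => F.map_id c (x i)
  map_comp f g x := funext fun i => F.map_comp f g (x i)

/-- A morphism of presheaves of modules. -/
structure ModHom (F G : ModPsh R) where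
  app : ∀ c, F.obj c →ₗ[R.obj c] G.obj c
  naturality : ∀ {c c' : C} (f : c ⟶ c') (x : F.obj c), G.map f (app c x) = app c' (F.map f x)

/-- A morphism of presheaves of algebras. -/
@[ext]
structure AlgPshHom (A B : AlgPsh R) where
  app : ∀ c, A.obj c →ₐ[R.obj c] B.obj c
  naturality : ∀ {c c' : C} (f : c ⟶ c') (x : A.obj c), B.map f (app c x) = app c' (A.map f x)

instance : Category (AlgPsh R) where
  Hom := AlgPshHom
  id A := ⟨fun c => AlgHom.id _ _, fun _ _ => rfl⟩
  comp u v := ⟨fun c => (v.app c).comp (u.app c), fun f x => by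
    rw [AlgHom.comp_apply, AlgHom.comp_apply, v.naturality, u.naturality]⟩

/-- The category of quasi-coherent sheaves of algebras. -/
abbrev QCohAlg (R : C ⥤ CommRingCat.{u}) :=
  ObjectProperty.FullSubcategory fun A : AlgPsh R => A.toMod.IsQuasiCoherent

/-- A polynomial law `F ⇝ G`: a natural transformation of the underlying presheaves of sets. -/
@[ext]
structure PolyLaw (F G : ModPsh R) where
  app : ∀ c, F.obj c → G.obj c
  naturality : ∀ {c c' : C} (f : c ⟶ c') (x : F.obj c), G.map f (app c x) = app c' (F.map f x)

/-- A polynomial law is homogeneous of degree `k` if `ψ(a x) = aᵏ ψ(x)`. -/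
def PolyLaw.IsHomogeneous {F G : ModPsh R} (ψ : PolyLaw F G) (k : ℕ) : Prop :=
  ∀ (c : C) (a : R.obj c) (x : F.obj c), ψ.app c (a • x) = a ^ k • ψ.app c x

/-- The category `Poly^d` of weighted polynomial laws
`(F, G, A₀, …, A_d, ψ₋₁, ψ₀, …, ψ_d)` where `ψ₋₁ : F ⇝ G` and `ψᵢ : F ⇝ Aᵢ`. The tuples of
quasi-coherent modules and algebras form a full subcategory: morphisms and the universal property
of the Clifford algebra are the same there. -/
structure WeightedLaw (R : C ⥤ CommRingCat.{u}) (d : ℕ) where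
  F : ModPsh R
  G : ModPsh R
  A : Fin (d + 1) → AlgPsh R
  neg : PolyLaw F G
  law : ∀ i, PolyLaw F (A i).toMod

/-- A morphism of weighted polynomial laws: a polynomial law `u : F ⇝ F'`, a linear morphism
`u₋₁ : G → G'` and morphisms of algebras `uᵢ : Aᵢ → Aᵢ'`, compatible with the weights. -/
structure WeightedLawHom {d : ℕ} (Ψ Ψ' : WeightedLaw R d) where
  u : PolyLaw Ψ.F Ψ'.F
  uneg : ModHom Ψ.G Ψ'.G
  ualg : ∀ i, Ψ.A i ⟶ Ψ'.A i
  comm_neg : ∀ c x, Ψ'.neg.app c (u.app c x) = uneg.app c (Ψ.neg.app c x)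
  comm_law : ∀ i c x, (Ψ'.law i).app c (u.app c x) = (ualg i).app c ((Ψ.law i).app c x)

instance (d : ℕ) : Category (WeightedLaw R d) where
  Hom := WeightedLawHom
  id Ψ :=
    { u := ⟨fun c x => x, fun _ _ => rfl⟩
      uneg := ⟨fun c => LinearMap.id, fun _ _ => rfl⟩
      ualg := fun i => 𝟙 (Ψ.A i)
      comm_neg := fun _ _ => rfl
      comm_law := fun _ _ _ => rfl }
  comp U V :=
    { u := ⟨fun c x => V.u.app c (U.u.app c x), fun f x => by
        rw [V.u.naturality, U.u.naturality]⟩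
      uneg := ⟨fun c => (V.uneg.app c).comp (U.uneg.app c), fun f x => by
        rw [LinearMap.comp_apply, LinearMap.comp_apply, V.uneg.naturality, U.uneg.naturality]⟩
      ualg := fun i => U.ualg i ≫ V.ualg i
      comm_neg := fun c x => by
        rw [V.comm_neg, U.comm_neg]; rfl
      comm_law := fun i c x => by
        rw [V.comm_law, U.comm_law]; rfl }

/-- The law `pr_d : 𝒜^{d+1} ⇝ 𝒜`,
`(a₋₁, a₀, …, a_{d-1}) ↦ a₀ a₋₁^d + a₁ a₋₁^(d-1) + ⋯ + a_{d-1} a₋₁`. -/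
def lastLaw (A : AlgPsh R) (d : ℕ) : PolyLaw (A.toMod.power (d + 1)) A.toMod where
  app c b := ∑ i : Fin d, b i.succ * b 0 ^ (d - (i : ℕ))
  naturality {c c'} f b := by
    change A.map f _ = _
    rw [map_sum]
    exact Finset.sum_congr rfl fun i _ => by rw [map_mul, map_pow]; rfl

/-- The `j`-th coordinate projection `𝒜^{n} ⇝ 𝒜`. -/
def coordLaw (A : AlgPsh R) {n : ℕ} (j : Fin n) : PolyLaw (A.toMod.power n) A.toMod where
  app _ b := b j
  naturality _ _ := rfl

/-- The functor `F^d` from quasi-coherent algebras to weighted polynomial laws, with values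
`(𝒜^{d+1}, 𝒜, …, 𝒜, pr₋₁, pr₀, …, pr_d)`. A tuple `(a₋₁, a₀, …, a_{d-1})` is indexed by
`Fin (d + 1)`, starting with `a₋₁`. -/
def weightFunctor (R : C ⥤ CommRingCat.{u}) (d : ℕ) : QCohAlg R ⥤ WeightedLaw R d where
  obj A :=
    { F := A.obj.toMod.power (d + 1)
      G := A.obj.toMod
      A := fun _ => A.obj
      neg := coordLaw A.obj 0
      law := Fin.lastCases (lastLaw A.obj d) fun i => coordLaw A.obj i.succ }
  map {A B} g :=
    { u := ⟨fun c b i => g.hom.app c (b i), fun f b => funext fun i => g.hom.naturality f (b i)⟩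
      uneg := ⟨fun c => (g.hom.app c).toLinearMap, fun f x => g.hom.naturality f x⟩
      ualg := fun _ => g.hom
      comm_neg := fun _ _ => rfl
      comm_law := fun i c x => by
        induction i using Fin.lastCases with
        | last =>
          simp only [Fin.lastCases_last]
          change ∑ i : Fin d, g.hom.app c _ * g.hom.app c _ ^ _ = g.hom.app c (∑ i : Fin d, _)
          rw [map_sum]
          exact Finset.sum_congr rfl fun i _ => by rw [map_mul, map_pow]
        | cast i => simp only [Fin.lastCases_castSucc]; rfl }

/-- `𝒜`, with the morphism `η : Ψ → F^d(𝒜)`, is the Clifford algebra of `Ψ`: the value at `Ψ` of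
the left adjoint of `F^d`, that is, every morphism `Ψ → F^d(ℬ)` factors through `η` by a unique
morphism of algebras `𝒜 → ℬ`. -/
def IsClifford {d : ℕ} (Ψ : WeightedLaw R d) (A : QCohAlg R)
    (η : Ψ ⟶ (weightFunctor R d).obj A) : Prop :=
  ∀ (B : QCohAlg R) (θ : Ψ ⟶ (weightFunctor R d).obj B),
    ∃! g : A ⟶ B, η ≫ (weightFunctor R d).map g = θ

/-- A vector bundle: a quasi-coherent module whose values are finite projective. -/
structure VectorBundle (R : C ⥤ CommRingCat.{u}) where
  toMod : ModPsh R
  quasiCoherent : toMod.IsQuasiCoherent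
  finite : ∀ c, Module.Finite (R.obj c) (toMod.obj c)
  projective : ∀ c, Module.Projective (R.obj c) (toMod.obj c)

attribute [instance] VectorBundle.finite VectorBundle.projective

/-- The dual vector bundle `F^∨`, with `F^∨(c) = Hom(F(c), R(c))`, as a presheaf of modules. -/
abbrev VectorBundle.dual (F : VectorBundle R) : ModPsh R where
  obj c := Module.Dual (R.obj c) (F.toMod.obj c)
  map f := (F.quasiCoherent f).dualMap
  map_id c ξ := (F.quasiCoherent (𝟙 c)).hom_ext fun x => by
    rw [(F.quasiCoherent (𝟙 c)).dualMap_apply, F.toMod.map_id]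
    simp
  map_comp f g ξ := (F.quasiCoherent (f ≫ g)).hom_ext fun x => by
    rw [(F.quasiCoherent (f ≫ g)).dualMap_apply, F.toMod.map_comp,
      (F.quasiCoherent g).dualMap_apply, (F.quasiCoherent f).dualMap_apply]
    simp

theorem VectorBundle.dual_isQuasiCoherent (F : VectorBundle R) : F.dual.IsQuasiCoherent :=
  fun _ _ f => (F.quasiCoherent f).dual

theorem VectorBundle.dual_map_apply (F : VectorBundle R) {c c' : C} (f : c ⟶ c')
    (ξ : F.dual.obj c) (x : F.toMod.obj c) :
    F.dual.map f ξ (F.toMod.map f x) =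
      (R.map f).hom (ξ x) :=
  (F.quasiCoherent f).dualMap_apply ξ x

end Sheaves

/-! ### The projective bundle, its tautological line bundle, and weighted projective bundles -/

section Bundles

universe t

variable {C : Type v} [Category.{w} C]

/-- The rings of the points of a functor `Y : C ⥤ Type`: a point `(c, y)` with `y ∈ Y(c)` has the
ring `R(c)`. Sheaves on `Y` are sheaves on the category of points of `Y`. -/
abbrev pointRing (R : C ⥤ CommRingCat.{u}) (Y : C ⥤ Type t) : Y.Elements ⥤ CommRingCat.{u} where
  obj e := R.obj e.1
  map f := R.map f.1
  map_id e := R.map_id e.1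
  map_comp f g := R.map_comp f.1 g.1

variable {R : C ⥤ CommRingCat.{u}}

/-- The projective bundle `P(F) = Proj(Sym(F^∨))` as a functor of points: `P(F)(c)` is the set of
equivalence classes of surjections `F(c)^∨ → L` onto a line bundle `L`. -/
def projBundle (F : VectorBundle R) : C ⥤ Type (u + 1) where
  obj c := Quotient (LinePt.setoid (R.obj c) (F.dual.obj c))
  map f := TypeCat.ofHom (LinePt.mapClass (F.dual_isQuasiCoherent f))
  map_id c := by
    ext y
    induction y using Quotient.inductionOn with
    | h p =>
      exact LinePt.mapClass_eq _ (.of_id (fun a => by simp) (fun x => F.dual.map_id c x) p)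
  map_comp f g := by
    ext y
    induction y using Quotient.inductionOn with
    | h p =>
      have h₁ := p.isPullback_pullback (F.dual_isQuasiCoherent f)
      have h₂ := (p.pullback (F.dual_isQuasiCoherent f)).isPullback_pullback
        (F.dual_isQuasiCoherent g)
      exact LinePt.mapClass_eq _ (h₁.trans (fun a => by simp) (fun x => F.dual.map_comp f g x) h₂)

/-- The weighted projective bundle `P_m(F ⊕ O) = Proj(Sym(F^∨ ⊕ O))`, where `F^∨` has degree `1` and
the generator `x₀` of `O` has degree `m`, as a functor of points: equivalence classes of
homomorphisms of graded algebras from the `m`-th Veronese subalgebra of `Sym(F(c)^∨)[x₀]` to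
`⨁ⱼ L^{⊗ j}` that are surjective in degree one, where `L` is a line bundle. -/
def weightedBundle (F : VectorBundle R) (m : ℕ) [NeZero m] : C ⥤ Type (u + 1) where
  obj c := Quotient (WPt.setoid (R.obj c) (F.dual.obj c) m)
  map f := TypeCat.ofHom (WPt.mapClass (F.dual_isQuasiCoherent f))
  map_id c := by
    ext y
    induction y using Quotient.inductionOn with
    | h p =>
      exact WPt.mapClass_eq _ (.of_id (fun a => by simp) (fun x => F.dual.map_id c x) p)
  map_comp f g := by
    ext y
    induction y using Quotient.inductionOn with
    | h p =>
      have h₁ := p.isPullback_pullback (F.dual_isQuasiCoherent f)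
      have h₂ := (p.pullback (F.dual_isQuasiCoherent f)).isPullback_pullback
        (F.dual_isQuasiCoherent g)
      exact WPt.mapClass_eq _ (h₁.trans (fun a => by simp) (fun x => F.dual.map_comp f g x) h₂)

/-- The element `s` of `Sym(F(c)^∨)` represents the polynomial law `ψ : F ⇝ O` over `c`: for every
`f : c ⟶ c'` and `z ∈ F(c')` the value at `z` of the image of `s` in `Sym(F(c')^∨)` is `ψ(z)`. -/
def Represents (F : VectorBundle R) (ψ : PolyLaw F.toMod (structureSheaf R).toMod) (c : C)
    (s : SymmetricAlgebra (R.obj c) (F.dual.obj c)) : Prop :=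
  ∀ (c' : C) (f : c ⟶ c') (z : F.toMod.obj c'),
    SymmetricAlgebra.lift (R := R.obj c') (M := F.dual.obj c') (A := R.obj c')
      (Module.Dual.eval (R.obj c') (F.toMod.obj c') z) (symMap (F.dual.map f) s) = ψ.app c' z

theorem Represents.map {F : VectorBundle R} {ψ : PolyLaw F.toMod (structureSheaf R).toMod} {c : C}
    {s : SymmetricAlgebra (R.obj c) (F.dual.obj c)} (h : Represents F ψ c s) {c' : C}
    (f : c ⟶ c') : Represents F ψ c' (symMap (F.dual.map f) s) := by
  intro c'' g z
  rw [← h c'' (f ≫ g) z,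
    symMap_comp (ρ := (R.map (f ≫ g)).hom) (fun a => by simp) (F.dual.map_comp f g)]

/-- The element `s₀ x₀^d + s₁ x₀^(d-1) + ⋯ + s_{d-1} x₀ - s_d` of `Sym(M)[x₀]`. -/
def hyperElement {A M : Type u} [CommRing A] [AddCommGroup M] [Module A M] {d : ℕ}
    (s : Fin (d + 1) → SymmetricAlgebra A M) : WSym A M :=
  ∑ i : Fin d, Polynomial.C (s i.castSucc) * Polynomial.X ^ (d - (i : ℕ)) -
    Polynomial.C (s (Fin.last d))

theorem hyperElement_mem {A M : Type u} [CommRing A] [AddCommGroup M] [Module A M] {d m : ℕ}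
    {s : Fin (d + 1) → SymmetricAlgebra A M} (hs : ∀ i : Fin (d + 1), s i ∈ symPiece A M (i * m)) :
    hyperElement s ∈ veronese A M m := by
  refine wPiece_le_veronese (k := d) (sub_mem (Submodule.sum_mem _ fun i _ => ?_) ?_)
  · refine C_mul_X_pow_mem_wPiece (hs i.castSucc) ?_
    rw [Fin.val_castSucc, mul_comm, ← mul_add, Nat.add_sub_cancel' i.2.le]
  · rw [← mul_one (Polynomial.C _), ← pow_zero Polynomial.X]
    refine C_mul_X_pow_mem_wPiece (hs (Fin.last d)) ?_
    rw [Fin.val_last, mul_zero, add_zero, mul_comm]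

theorem wMap_hyperElement {A B : Type u} [CommRing A] [CommRing B] {σ : A →+* B} {M N : Type u}
    [AddCommGroup M] [Module A M] [AddCommGroup N] [Module B N] (φ : M →ₛₗ[σ] N) {d : ℕ}
    (s : Fin (d + 1) → SymmetricAlgebra A M) :
    wMap φ (hyperElement s) = hyperElement fun i => symMap φ (s i) := by
  simp only [hyperElement, map_sub, map_sum, map_mul, map_pow, wMap_C, wMap_X]

/-- The subfunctor `X_Ψ` of `P_m(F ⊕ O)`: the points `(L, h)` such that `h` maps the element
`ψ₀ x₀^d + ψ₁ x₀^(d-1) + ⋯ + ψ_{d-1} x₀ - ψ_d` to zero, where `ψᵢ` is regarded as an element of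
`Sym^(i m)(F(c)^∨)`. -/
def hypersurface (F : VectorBundle R) (m : ℕ) [NeZero m] {d : ℕ}
    (ψ : Fin (d + 1) → PolyLaw F.toMod (structureSheaf R).toMod) :
    Subfunctor (weightedBundle F m) where
  obj c := {y | ∃ (p : WPt (R.obj c) (F.dual.obj c) m)
    (s : Fin (d + 1) → SymmetricAlgebra (R.obj c) (F.dual.obj c))
    (hs : ∀ i : Fin (d + 1), s i ∈ symPiece (R.obj c) (F.dual.obj c) (i * m)),
    (∀ i, Represents F (ψ i) c (s i)) ∧ y = Quotient.mk _ p ∧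
      p.h ⟨hyperElement s, hyperElement_mem hs⟩ = 0}
  map {c c'} f := by
    rintro _ ⟨p, s, hs, hr, rfl, h⟩
    have hp := p.isPullback_pullback (F.dual_isQuasiCoherent f)
    refine ⟨p.pullback (F.dual_isQuasiCoherent f), fun i => symMap (F.dual.map f) (s i),
      fun i => symMap_mem _ (hs i), fun i => (hr i).map f, rfl, ?_⟩
    obtain ⟨j, -, hj⟩ := hp
    have h1 := hj ⟨hyperElement s, hyperElement_mem hs⟩
    rw [h, map_zero] at h1
    rw [← h1]
    exact congrArg _ (Subtype.ext (wMap_hyperElement _ s).symm)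

/-- The point `(L, h)` of `P_m(F ⊕ O)` lies over the point `q : F^∨ → L'` of `P(F)`: there is an
isomorphism `L ≅ L'^{⊗ m}` that carries the restriction of `h` to `Sym^m(F^∨)` to
`Sym^m(q) : Sym^m(F^∨) → L'^{⊗ m}`. -/
def WPt.LiesOver {A M : Type u} [CommRing A] [AddCommGroup M] [Module A M] {m : ℕ} (p : WPt A M m)
    (p' : LinePt A M) : Prop :=
  ∃ e : p.L ≃ₗ[A] symPiece A p'.L m, ∀ (r : veronese A M m) (s : SymmetricAlgebra A M) (l : p.L),
    s ∈ symPiece A M m → (r : WSym A M) = Polynomial.C s → p.h r = SymmetricAlgebra.ι A p.L l →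
      (e l : SymmetricAlgebra A p'.L) = symMap p'.q s

/-- The relation between points of `P_m(F ⊕ O)` and `P(F)` given by `WPt.LiesOver`. -/
def LiesOver (F : VectorBundle R) (m : ℕ) [NeZero m] {c : C} (x : (weightedBundle F m).obj c)
    (y : (projBundle F).obj c) : Prop :=
  ∃ (p : WPt (R.obj c) (F.dual.obj c) m) (p' : LinePt (R.obj c) (F.dual.obj c)),
    x = Quotient.mk _ p ∧ y = Quotient.mk _ p' ∧ p.LiesOver p'

/-- For a quotient `q : M^∨ → L`, the image of the dual map `L^∨ → M^∨^∨ = M`. -/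
def LinePt.taut {A M : Type u} [CommRing A] [AddCommGroup M] [Module A M]
    (p : LinePt A (Module.Dual A M)) : Submodule A M where
  carrier := {v | ∃ l : Module.Dual A p.L, ∀ ξ : Module.Dual A M, ξ v = l (p.q ξ)}
  zero_mem' := ⟨0, fun ξ => by simp⟩
  add_mem' := by
    rintro v v' ⟨l, h⟩ ⟨l', h'⟩
    exact ⟨l + l', fun ξ => by simp [h, h']⟩
  smul_mem' := by
    rintro a v ⟨l, h⟩
    exact ⟨a • l, fun ξ => by simp [h]⟩

theorem LinePt.taut_le {A M : Type u} [CommRing A] [AddCommGroup M] [Module A M]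
    {p p' : LinePt A (Module.Dual A M)} (h : p ≈ p') : p.taut ≤ p'.taut := by
  obtain ⟨e, he⟩ := h
  rintro v ⟨l, hl⟩
  exact ⟨l.comp e.symm.toLinearMap, fun ξ => by simp [hl, ← he]⟩

theorem LinePt.IsPullback.map_taut {A B : Type u} [CommRing A] [CommRing B] {σ : A →+* B}
    {M N : Type u} [AddCommGroup M] [Module A M] [AddCommGroup N] [Module B N]
    {φ : M →ₛₗ[σ] N} {φ' : Module.Dual A M →ₛₗ[σ] Module.Dual B N} (h : IsScalarExtension φ')
    (hφ : ∀ ξ v, φ' ξ (φ v) = σ (ξ v)) {p : LinePt A (Module.Dual A M)}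
    {p' : LinePt B (Module.Dual B N)} (hp : p.IsPullback φ' p') {v : M} (hv : v ∈ p.taut) :
    φ v ∈ p'.taut := by
  obtain ⟨l, hl⟩ := hv
  obtain ⟨j, hj, e⟩ := hp
  obtain ⟨l', hl'⟩ := hj.exists_lift (P := B)
    { toFun := fun x => σ (l x), map_add' := fun x y => by simp, map_smul' := fun r x => by simp }
  refine ⟨l', fun ξ => ?_⟩
  refine LinearMap.congr_fun (h.hom_ext (g := Module.Dual.eval B N (φ v)) (g' := l'.comp p'.q)
    fun x => ?_) ξ
  rw [LinearMap.comp_apply, e, hl', Module.Dual.eval_apply, hφ, hl]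
  rfl

/-- The fibre of `O(-1)` at a point `y` of `P(F)`, as a submodule of `F`. -/
def tautFibre (F : VectorBundle R) {c : C} (y : (projBundle F).obj c) :
    Submodule (R.obj c) (F.toMod.obj c) :=
  Quotient.lift (s := LinePt.setoid (R.obj c) (F.dual.obj c)) LinePt.taut
    (fun _ _ h => le_antisymm (LinePt.taut_le h) (LinePt.taut_le (Setoid.symm h))) y

theorem map_mem_tautFibre (F : VectorBundle R) {c c' : C} (f : c ⟶ c') {y : (projBundle F).obj c}
    {y' : (projBundle F).obj c'} (h : (projBundle F).map f y = y') {v : F.toMod.obj c}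
    (hv : v ∈ tautFibre F y) : F.toMod.map f v ∈ tautFibre F y' := by
  subst h
  induction y using Quotient.inductionOn with
  | h p =>
    exact LinePt.IsPullback.map_taut (F.dual_isQuasiCoherent f) (F.dual_map_apply f)
      (p.isPullback_pullback (F.dual_isQuasiCoherent f)) hv

/-- The tautological line bundle `O(-1)` on `P(F)`, a subbundle of the pullback of `F`. -/
def taut (F : VectorBundle R) : ModPsh (pointRing R (projBundle F)) where
  obj e := tautFibre F e.2
  map f :=
    { toFun := fun v => ⟨F.toMod.map f.1 v, map_mem_tautFibre F f.1 f.2 v.2⟩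
      map_add' := fun _ _ => Subtype.ext (map_add _ _ _)
      map_smul' := fun _ _ => Subtype.ext (map_smulₛₗ _ _ _) }
  map_id e v := Subtype.ext (F.toMod.map_id e.1 v)
  map_comp f g v := Subtype.ext (F.toMod.map_comp f.1 g.1 v)

/-- The divided power `Γ^m(F)`. -/
def gammaMod (F : ModPsh R) (m : ℕ) : ModPsh R where
  obj c := gammaPiece (R.obj c) (F.obj c) m
  map f := gammaPieceMap (F.map f) m
  map_id c x := Subtype.ext <| by
    have h : gammaMap (F.map (𝟙 c)) = RingHom.id _ := gamma_ringHom_ext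
      (fun a => by rw [gammaMap_algebraMap]; simp) fun n y => by
        rw [gammaMap_dp, F.map_id]; rfl
    exact RingHom.congr_fun h x
  map_comp f g x := Subtype.ext <| by
    have h : gammaMap (F.map (f ≫ g)) = (gammaMap (F.map g)).comp (gammaMap (F.map f)) :=
      gamma_ringHom_ext
        (fun a => by rw [RingHom.comp_apply, gammaMap_algebraMap, gammaMap_algebraMap,
          gammaMap_algebraMap]; simp)
        fun n y => by rw [RingHom.comp_apply, gammaMap_dp, gammaMap_dp, gammaMap_dp, F.map_comp]
    exact RingHom.congr_fun h x

/-- The universal homogeneous polynomial law `l^m : F ⇝ Γ^m(F)`, `x ↦ x^[m]`. -/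
def gammaLaw (F : ModPsh R) (m : ℕ) : PolyLaw F (gammaMod F m) where
  app c x := gammaDp (R.obj c) m x
  naturality f x := Subtype.ext (gammaMap_dp (F.map f) m x)

/-- The restriction of a polynomial law `F ⇝ O` to `O(-1)`. -/
def restrictTaut (F : VectorBundle R) (ψ : PolyLaw F.toMod (structureSheaf R).toMod) :
    PolyLaw (taut F) (structureSheaf (pointRing R (projBundle F))).toMod where
  app e v := ψ.app e.1 v.1
  naturality f v := ψ.naturality f.1 v.1

/-- The weighted polynomial law
`Ψ|_{O(-1)} = (O(-1), Γ^m(O(-1)), O, …, O, l^m, ψ₀|_{O(-1)}, …, ψ_d|_{O(-1)})` on `P(F)`. -/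
def restrictedWeights (F : VectorBundle R) (m : ℕ) {d : ℕ}
    (ψ : Fin (d + 1) → PolyLaw F.toMod (structureSheaf R).toMod) :
    WeightedLaw (pointRing R (projBundle F)) d where
  F := taut F
  G := gammaMod (taut F) m
  A _ := structureSheaf _
  neg := gammaLaw (taut F) m
  law i := restrictTaut F (ψ i)

end Bundles

/-! ### Relative spectra -/

section RelativeSpectrum

variable {C : Type v} [Category.{w} C] {R : C ⥤ CommRingCat.{u}}

/-- The algebra homomorphisms `A(c) → R(c)`, that is the sections of the spectrum of `A` over the
point `c`. -/
abbrev QCohAlg.Section (A : QCohAlg R) (c : C) : Type u := A.obj.obj c →ₐ[R.obj c] R.obj c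

/-- The extension of an algebra homomorphism along a morphism of points. -/
theorem QCohAlg.exists_extend (A : QCohAlg R) {c c' : C} (f : c ⟶ c')
    (g : A.Section c) :
    ∃! g' : A.Section c', ∀ x, g' (A.obj.map f x) = (R.map f).hom (g x) := by
  have hA : IsScalarExtension (A.obj.toMod.map f) := A.property f
  obtain ⟨l, hl⟩ := hA.exists_lift (P := R.obj c')
    { toFun := fun x => (R.map f).hom (g x)
      map_add' := fun x y => by rw [map_add, map_add]
      map_smul' := fun a x => by rw [map_smul, smul_eq_mul, map_mul, smul_eq_mul] }
  have hl' : ∀ x, l (A.obj.map f x) = (R.map f).hom (g x) := hl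
  have hspan : ∀ x : A.obj.obj c', x ∈ Submodule.span (R.obj c') (Set.range (A.obj.map f)) :=
    fun x => hA.span_eq_top ▸ Submodule.mem_top
  refine ⟨AlgHom.ofLinearMap l ?_ ?_, hl', fun g' hg' => ?_⟩
  · rw [← map_one (A.obj.map f), hl', map_one, map_one]
  · intro x y
    induction hspan x using Submodule.span_induction with
    | zero => rw [zero_mul, map_zero, zero_mul]
    | add a b _ _ ha hb => rw [add_mul, map_add, map_add, ha, hb, add_mul]
    | smul b a _ ha => rw [smul_mul_assoc, map_smul, map_smul, ha, smul_mul_assoc]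
    | mem a ha =>
      obtain ⟨r, rfl⟩ := ha
      induction hspan y using Submodule.span_induction with
      | zero => rw [mul_zero, map_zero, mul_zero]
      | add a b _ _ ha hb => rw [mul_add, map_add, map_add, ha, hb, mul_add]
      | smul b a _ ha => rw [mul_smul_comm, map_smul, map_smul, ha, mul_smul_comm]
      | mem b hb =>
        obtain ⟨s, rfl⟩ := hb
        rw [← map_mul, hl', hl', hl', map_mul, map_mul]
  · refine AlgHom.toLinearMap_injective (hA.hom_ext fun x => ?_)
    exact (hg' x).trans (hl' x).symm

/-- The pullback of a section `A(c) → R(c)` of the spectrum of `A` along `f : c ⟶ c'`. -/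
def QCohAlg.extend (A : QCohAlg R) {c c' : C} (f : c ⟶ c')
    (g : A.Section c) : A.Section c' :=
  (A.exists_extend f g).choose

theorem QCohAlg.extend_apply (A : QCohAlg R) {c c' : C} (f : c ⟶ c')
    (g : A.Section c) (x : A.obj.obj c) :
    A.extend f g (A.obj.map f x) = (R.map f).hom (g x) :=
  (A.exists_extend f g).choose_spec.1 x

variable {Y : C ⥤ Type (u + 1)} (A : QCohAlg (pointRing R Y))

/-- The points over `c` of the relative spectrum of `A`. -/
def RelSpecPt (c : C) : Type (u + 1) :=
  Σ y : Y.obj c, A.Section (Y.elementsMk c y)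

variable {A}

/-- The pullback of a point of the relative spectrum. -/
def RelSpecPt.map {c c' : C} (f : c ⟶ c') (z : RelSpecPt A c) : RelSpecPt A c' :=
  ⟨Y.map f z.1, A.extend (c := Y.elementsMk c z.1) (c' := Y.elementsMk c' (Y.map f z.1)) ⟨f, rfl⟩ z.2⟩

theorem RelSpecPt.map_eq {c c' : C} (f : c ⟶ c') (z : RelSpecPt A c) (z' : RelSpecPt A c')
    (h : Y.map f z.1 = z'.1)
    (h' : ∀ x, z'.2 (A.obj.map (c := Y.elementsMk c z.1) (c' := Y.elementsMk c' z'.1) ⟨f, h⟩ x) =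
      (R.map f).hom (z.2 x)) : z.map f = z' := by
  obtain ⟨y', g'⟩ := z'
  obtain rfl : Y.map f z.1 = y' := h
  refine Sigma.ext rfl (heq_of_eq ?_)
  exact (A.exists_extend (c := Y.elementsMk c z.1) (c' := Y.elementsMk c' (Y.map f z.1)) ⟨f, rfl⟩ z.2).unique
    (A.extend_apply _ _) h'

variable (A)

/-- The relative spectrum over `Y` of a quasi-coherent algebra `A` on `Y` as a functor of points:
a point over `c` is a point `y ∈ Y(c)` with an algebra homomorphism `A(c, y) → R(c)`. -/
def relSpec : C ⥤ Type (u + 1) where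
  obj c := RelSpecPt A c
  map f := TypeCat.ofHom fun z => z.map f
  map_id c := by
    ext z
    refine RelSpecPt.map_eq (𝟙 c) z z (by simp) fun x => ?_
    have := A.obj.map_id (Y.elementsMk c z.1) x
    refine (congrArg z.2 this).trans ?_
    simp
  map_comp {c c' c''} f g := by
    ext z
    refine RelSpecPt.map_eq (f ≫ g) z ((z.map f).map g) (by simp [RelSpecPt.map]) fun x => ?_
    have := A.obj.map_comp (c := Y.elementsMk c z.1) (c' := Y.elementsMk c' (Y.map f z.1))
      (c'' := Y.elementsMk c'' (Y.map g (Y.map f z.1))) ⟨f, rfl⟩ ⟨g, rfl⟩ x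
    refine (congrArg ((z.map f).map g).2 this).trans ?_
    refine (A.extend_apply (c := Y.elementsMk c' (Y.map f z.1)) (c' := Y.elementsMk c'' (Y.map g (Y.map f z.1))) ⟨g, rfl⟩
      (z.map f).2 _).trans ?_
    refine (congrArg (R.map g).hom (A.extend_apply (c := Y.elementsMk c z.1) (c' := Y.elementsMk c' (Y.map f z.1))
      ⟨f, rfl⟩ z.2 x)).trans ?_
    simp

/-- The structure morphism of the relative spectrum. -/
def relSpecProj : relSpec A ⟶ Y where
  app c := TypeCat.ofHom fun z => z.1

end RelativeSpectrum

/-! ### The points of a scheme -/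

/-- The functor of points of a scheme on affine schemes: `A ↦ Hom(Spec A, S)`. -/
abbrev affinePoints (S : AlgebraicGeometry.Scheme.{u}) : CommRingCat.{u} ⥤ Type u :=
  AlgebraicGeometry.Scheme.Spec.rightOp ⋙ yoneda.obj S

/-- The category of affine points `(A, x : Spec A → S)` of a scheme, with its rings
`(A, x) ↦ A`. -/
abbrev affineRing (S : AlgebraicGeometry.Scheme.{u}) : (affinePoints S).Elements ⥤ CommRingCat.{u} :=
  CategoryOfElements.π (affinePoints S)

end CliffordSpec

end

/-!
Points of the relative spectrum of the Clifford algebra and points of the hypersurface are both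
described by the same data: a point `q : F^∨ → L'` of `P(F)` and a *weight* on the line `T ⊆ F` at
`q`, that is a function `t : T → A` with `t(a x) = aᵐ t(x)` and `∑ ψᵢ(x) t(x)^(d-i) = ψ_d(x)`. The
resulting bijection is natural in the point, hence an isomorphism (`exists_iso_hypersurface`), and
`φ` is the composite of its inverse with the projection to `P(F)`.

*Locality.* Nothing in the argument is localized. For an invertible module `L` over a ring `A`, the
values `l(y)` of linear forms `l` at elements `y` generate the unit ideal, and `l(y) x = l(x) y`. So
an equation, or membership in a submodule, may be tested after multiplication by powers of the
elements `l(y)`, where `y` behaves like a basis of `L` (`mem_of_pairing`, `eq_of_pairing`).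
Existence statements become membership in the range of a linear map.

*The Clifford algebra.* Let `T` be a line bundle with homogeneous functions `ψᵢ` of degree `i m`.
Linear maps out of `Γ^m(T)` are the same as functions `t` with `t(a x) = aᵐ t(x)`
(`exists_gammaPiece_lift`, `gammaPiece_hom_ext`), so the Clifford algebra has generators `[x]` for
`x ∈ T` with the relations `[a x] = aᵐ [x]` and
`ψ₀(x) [x]^d + ⋯ + ψ_{d-1}(x) [x] = ψ_d(x)` (`LineClifford`). It is commutative because `T` has rank
one, and it commutes with scalar extension because homogeneous functions on `T` extend to the scalar
extension (`LineClifford.isScalarExtension_mapLin`). The resulting sheaf has the universal property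
(`isClifford_lineCliffordHom`), and the sections of its spectrum are the weights on `T`
(`IsClifford.existsUnique_section`).

*The hypersurface.* A point `(L, h)` of `P_m(F ⊕ O)` corresponds to a point `q : F^∨ → L'` of `P(F)`
with a function `t` on the tautological line `T ⊆ F` if for every `v ∈ T` some linear form on `L`
carries `h` to the evaluation of `Sym(F^∨)[x₀]` at `(v, t(v))` (`WPt.Compat`). The pair `(q, t)`
determines `(L, h)` and conversely (`WPt.Compat.equiv`, `WPt.Compat.linePt_unique`,
`WPt.Compat.weight_unique`), compatibility is stable under pullback (`WPt.Compat.pullback`), and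
`(L, h)` lies over `q` if and only if it is compatible with some `t` (`WPt.LiesOver.exists_compat`,
`WPt.Compat.liesOver`). Given `q` and a weight `t`, one takes `L = L'^{⊗ m}` and lets `h(x₀)` be the
section `t` of `L` (`LinePt.exists_compat`). Conversely, on the hypersurface the equation shows that
`h(x₀)^d` lies in the ideal generated by `h(Sym^m(F^∨))`, so that `Sym^m(F^∨) → L` is surjective;
then `F^∨` modulo the elements `ξ` with `h(ξ Sym^{m-1}(F^∨)) = 0` is the required line bundle `L'`
(`WPt.exists_compat_of_hyperElement`).

*The polynomial laws.* That the `ψᵢ` are elements of symmetric powers, so that the hypersurface is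
defined, is `exists_represents`: one evaluates `ψᵢ` at the generic point of `F`.
-/

noncomputable section

namespace CliffordSpec

/-! ### Invertible modules without localization -/

section Invertible

variable {A L N : Type*} [CommRing A] [AddCommGroup L] [Module A L] [AddCommGroup N] [Module A N]

theorem smul_swap [Module.Invertible A L] (l : Module.Dual A L) (x y : L) :
    l x • y = l y • x := by
  have h := congrArg (TensorProduct.lift ((LinearMap.lsmul A L).comp l))
    (Module.Invertible.tmul_comm (R := A) (m₁ := x) (m₂ := y))
  simpa using h

theorem mul_swap [Module.Invertible A L] (l l' : Module.Dual A L) (x y : L) :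
    l x * l' y = l y * l' x := by
  simpa using congrArg l' (smul_swap l x y)

variable (A L) in
/-- The values `l(y)` of linear forms generate the unit ideal. -/
theorem span_pairing_eq_top [Module.Invertible A L] :
    Ideal.span {c : A | ∃ (l : Module.Dual A L) (y : L), l y = c} = ⊤ := by
  obtain ⟨t, ht⟩ := (Module.Invertible.bijective (R := A) (M := L)).2 1
  rw [Ideal.eq_top_iff_one, ← ht]
  clear ht
  induction t using TensorProduct.induction_on with
  | zero => rw [map_zero]; exact zero_mem _
  | tmul l y => exact Ideal.subset_span ⟨l, y, rfl⟩
  | add s t hs ht => rw [map_add]; exact add_mem hs ht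

/-- The locality principle for an invertible module `L`: membership in a submodule may be tested
after multiplication by a power of each of the values `l(y)`. On the open set where `l(y)` is a
unit, the module `L` is free with generator `y`, so that this replaces the passage to a
trivializing open cover. -/
theorem mem_of_pairing (L : Type*) [AddCommGroup L] [Module A L] [Module.Invertible A L]
    (N' : Submodule A N) {x : N} (n : ℕ)
    (h : ∀ (l : Module.Dual A L) (y : L), l y ^ n • x ∈ N') : x ∈ N' := by
  refine Submodule.mem_of_span_eq_top_of_smul_pow_mem N' _ (span_pairing_eq_top A L) x ?_
  rintro ⟨_, l, y, rfl⟩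
  exact ⟨n, h l y⟩

theorem eq_of_pairing (L : Type*) [AddCommGroup L] [Module A L] [Module.Invertible A L]
    {x x' : N} (n : ℕ) (h : ∀ (l : Module.Dual A L) (y : L), l y ^ n • x = l y ^ n • x') :
    x = x' := by
  rw [← sub_eq_zero, ← Submodule.mem_bot A]
  exact mem_of_pairing L ⊥ n fun l y => by rw [Submodule.mem_bot, smul_sub, h, sub_self]

theorem eq_zero_of_forall_dual [Module.Invertible A L] {x : L}
    (h : ∀ l : Module.Dual A L, l x = 0) : x = 0 :=
  eq_of_pairing (A := A) L 1 fun l y => by rw [pow_one, smul_swap, h, zero_smul, smul_zero]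

/-- A module is invertible if the values `l(y)` of those linear forms `l` and elements `y` for which
`y` generates the module after inverting `l(y)` generate the unit ideal. -/
theorem invertible_of_swap
    (h : Ideal.span {c : A | ∃ (l : Module.Dual A L) (y : L), l y = c ∧
      ∀ x, l y • x = l x • y} = ⊤) : Module.Invertible A L := by
  refine ⟨?_, ?_⟩
  · rw [injective_iff_map_eq_zero]
    intro t ht
    rw [← Submodule.mem_bot A]
    refine Submodule.mem_of_span_eq_top_of_smul_pow_mem ⊥ _ h t ?_
    rintro ⟨_, l, y, rfl, hy⟩
    refine ⟨2, ?_⟩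
    have key : ∀ t : TensorProduct A (Module.Dual A L) L,
        l y ^ 2 • t = (l y * contractLeft A L t) • TensorProduct.tmul A l y := by
      intro t
      induction t using TensorProduct.induction_on with
      | zero => simp
      | add s t hs ht => rw [smul_add, hs, ht, map_add, mul_add, add_smul]
      | tmul f x =>
        have h1 : (l y * l x) • f = (l y * f x) • l := by
          ext z
          have hx := congrArg f (hy x)
          have hz := congrArg f (hy z)
          simp only [map_smul, smul_eq_mul] at hx hz
          simp only [LinearMap.smul_apply, smul_eq_mul]
          linear_combination l x * hz - l z * hx
        rw [contractLeft_apply, TensorProduct.smul_tmul' (l y * f x), ← h1,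
          ← TensorProduct.smul_tmul', mul_smul, ← TensorProduct.tmul_smul _ f y, ← hy x,
          TensorProduct.tmul_smul _ f x, smul_smul, pow_two]
    change l y ^ 2 • t ∈ _
    rw [key, ht, mul_zero, zero_smul]
    exact zero_mem _
  · rw [← LinearMap.range_eq_top, eq_top_iff, ← h, Ideal.span, Submodule.span_le]
    rintro _ ⟨l, y, rfl, -⟩
    exact ⟨TensorProduct.tmul A l y, contractLeft_apply l y⟩

end Invertible

/-! ### Divided powers of invertible modules -/

section Gamma

variable {A T N : Type u} [CommRing A] [AddCommGroup T] [Module A T] [AddCommGroup N] [Module A N]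

/-- The algebra generated by the Hasse derivatives of `A[X]`. These operators satisfy
the relations `D_k D_l = (k + l choose k) D_(k + l)` of divided powers. -/
abbrev hasseAlgebra (A : Type u) [CommRing A] : Subalgebra A (Module.End A (Polynomial A)) :=
  Algebra.adjoin A (Set.range fun n => (Polynomial.hasseDeriv n : Module.End A (Polynomial A)))

theorem hasseDeriv_mul_hasseDeriv (k l : ℕ) :
    (Polynomial.hasseDeriv k * Polynomial.hasseDeriv l : Module.End A (Polynomial A)) =
      (k + l).choose k • Polynomial.hasseDeriv (k + l) :=
  Polynomial.hasseDeriv_comp k l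

instance : IsMulCommutative (hasseAlgebra A) :=
  Algebra.isMulCommutative_adjoin A <| by
    rintro _ ⟨k, rfl⟩ _ ⟨l, rfl⟩
    rw [hasseDeriv_mul_hasseDeriv, hasseDeriv_mul_hasseDeriv, add_comm l k, Nat.choose_symm_add]

open scoped IsMulCommutative in
instance : CommRing (hasseAlgebra A) := inferInstance

/-- The Hasse derivative as an element of `hasseAlgebra`. -/
def hasseGen (A : Type u) [CommRing A] (n : ℕ) : hasseAlgebra A :=
  ⟨Polynomial.hasseDeriv n, Algebra.subset_adjoin ⟨n, rfl⟩⟩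

theorem hasseGen_zero : hasseGen A 0 = 1 := Subtype.ext Polynomial.hasseDeriv_zero

theorem hasseGen_mul (k l : ℕ) :
    hasseGen A k * hasseGen A l = (k + l).choose k • hasseGen A (k + l) :=
  Subtype.ext (hasseDeriv_mul_hasseDeriv k l)

/-- The algebra homomorphism `x^[n] ↦ ξ(x)ⁿ D_n` from the divided power algebra of `T` to the
algebra of Hasse derivatives. -/
def gammaHasse (ξ : Module.Dual A T) : DividedPowerAlgebra A T →ₐ[A] hasseAlgebra A :=
  DividedPowerAlgebra.lift' (f := fun p : ℕ × T => ξ p.2 ^ p.1 • hasseGen A p.1)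
    (fun x => by simp [hasseGen_zero])
    (fun n r x => by simp [mul_pow, mul_smul])
    (fun n p x => by
      simp only [smul_mul_smul_comm, hasseGen_mul, ← pow_add]
      rw [smul_comm])
    (fun n x y => by
      simp only [map_add, smul_mul_smul_comm, hasseGen_mul]
      rw [add_pow, Finset.sum_smul, Finset.Nat.sum_antidiagonal_eq_sum_range_succ
        (fun i j => (ξ x ^ i * ξ y ^ j) • (i + j).choose i • hasseGen A (i + j))]
      refine Finset.sum_congr rfl fun k hk => ?_
      rw [Nat.add_sub_cancel' (Nat.lt_succ_iff.mp (Finset.mem_range.mp hk)), mul_smul,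
        Nat.cast_smul_eq_nsmul])

theorem gammaHasse_dp (ξ : Module.Dual A T) (n : ℕ) (x : T) :
    gammaHasse ξ (DividedPowerAlgebra.dp A n x) = ξ x ^ n • hasseGen A n :=
  DividedPowerAlgebra.lift'_apply_dp _ _ _ _ n x

/-- The linear form on `Γ(T)` that maps `x^[m]` to `ξ(x)ᵐ`. -/
def gammaForm (ξ : Module.Dual A T) (m : ℕ) : DividedPowerAlgebra A T →ₗ[A] A where
  toFun g := ((gammaHasse ξ g).1 (Polynomial.X ^ m)).coeff 0
  map_add' g g' := by simp
  map_smul' a g := by simp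

theorem gammaForm_of_eq {ξ : Module.Dual A T} {m : ℕ} {g : DividedPowerAlgebra A T} {a : A}
    (h : gammaHasse ξ g = a • hasseGen A m) : gammaForm ξ m g = a := by
  change ((gammaHasse ξ g).1 (Polynomial.X ^ m)).coeff 0 = a
  rw [h]
  simp [hasseGen, Polynomial.hasseDeriv_coeff]

theorem gammaForm_dp (ξ : Module.Dual A T) (m : ℕ) (x : T) :
    gammaForm ξ m (DividedPowerAlgebra.dp A m x) = ξ x ^ m :=
  gammaForm_of_eq (gammaHasse_dp ξ m x)

/-- If `y` generates `T` after inverting `ξ(y)`, then `y^[m]` generates `Γ^m(T)`. -/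
theorem pow_smul_gamma [Module.Invertible A T] (ξ : Module.Dual A T) (y : T) (m : ℕ)
    {g : DividedPowerAlgebra A T} (hg : g ∈ gammaPiece A T m) :
    ξ y ^ m • g = gammaForm ξ m g • DividedPowerAlgebra.dp A m y := by
  induction hg using Submodule.span_induction with
  | zero => simp
  | add g g' _ _ hg hg' => rw [smul_add, hg, hg', map_add, add_smul]
  | smul a g _ hg => rw [smul_comm, hg, map_smul, smul_eq_mul, mul_smul]
  | mem g hg =>
    obtain ⟨l, hl, rfl⟩ := hg
    have key : ∃ a : A, gammaHasse ξ (l.map fun x => DividedPowerAlgebra.dp A x.1 x.2).prod =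
        a • hasseGen A m ∧ ξ y ^ m • (l.map fun x => DividedPowerAlgebra.dp A x.1 x.2).prod =
          a • DividedPowerAlgebra.dp A m y := by
      subst hl
      induction l with
      | nil => exact ⟨1, by simp [hasseGen_zero], by simp [DividedPowerAlgebra.dp_zero]⟩
      | cons x l ih =>
        obtain ⟨a, h₁, h₂⟩ := ih
        refine ⟨ξ x.2 ^ x.1 * a * ((x.1 + (l.map Prod.fst).sum).choose x.1 : ℕ), ?_, ?_⟩
        · rw [List.map_cons, List.prod_cons, map_mul, h₁, gammaHasse_dp, smul_mul_smul_comm,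
            hasseGen_mul, List.map_cons, List.sum_cons, mul_smul _ (Nat.cast _),
            Nat.cast_smul_eq_nsmul]
        · simp only [List.map_cons, List.prod_cons, List.sum_cons]
          rw [pow_add,
            ← smul_mul_smul_comm, h₂, ← DividedPowerAlgebra.dp_smul, smul_swap,
            DividedPowerAlgebra.dp_smul, smul_mul_smul_comm, DividedPowerAlgebra.dp_mul,
            mul_smul _ (Nat.cast _), Nat.cast_smul_eq_nsmul]
    obtain ⟨a, h₁, h₂⟩ := key
    rw [h₂, gammaForm_of_eq h₁]

/-- Semilinear maps on `Γ^m(T)` are determined by their values at the elements `x^[m]`. -/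
theorem gammaPiece_hom_ext [Module.Invertible A T] {B N' : Type*} [CommRing B] {σ : A →+* B}
    [AddCommGroup N'] [Module B N'] {m : ℕ} {U U' : gammaPiece A T m →ₛₗ[σ] N'}
    (h : ∀ x, U (gammaDp A m x) = U' (gammaDp A m x)) : U = U' := by
  refine LinearMap.ext fun g => ?_
  refine mem_of_pairing (N := gammaPiece A T m) T (LinearMap.eqLocus U U') m fun ξ y => ?_
  have : ξ y ^ m • g = gammaForm ξ m (g : DividedPowerAlgebra A T) • gammaDp A m y :=
    Subtype.ext (pow_smul_gamma ξ y m g.2)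
  rw [this, LinearMap.mem_eqLocus, map_smulₛₗ, map_smulₛₗ, h]

/-- The functions `t : T → N` with `t(a x) = aᵐ t(x)` on an invertible module are the linear maps
`Γ^m(T) → N`. -/
theorem exists_gammaPiece_lift [Module.Invertible A T] {m : ℕ} (t : T → N)
    (ht : ∀ (a : A) (x : T), t (a • x) = a ^ m • t x) :
    ∃ U : gammaPiece A T m →ₗ[A] N, ∀ x, U (gammaDp A m x) = t x := by
  let Φ : (gammaPiece A T m →ₗ[A] N) →ₗ[A] (T → N) :=
    { toFun := fun U x => U (gammaDp A m x)
      map_add' := fun _ _ => rfl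
      map_smul' := fun _ _ => rfl }
  suffices h : t ∈ LinearMap.range Φ by
    obtain ⟨U, hU⟩ := h
    exact ⟨U, congrFun hU⟩
  refine mem_of_pairing T _ m fun ξ y =>
    ⟨((gammaForm ξ m).comp (gammaPiece A T m).subtype).smulRight (t y), funext fun x => ?_⟩
  change gammaForm ξ m (DividedPowerAlgebra.dp A m x) • t y = ξ y ^ m • t x
  rw [gammaForm_dp, ← ht, ← ht, smul_swap]

end Gamma

/-! ### Graded pieces of symmetric algebras -/

section Sym

variable {A B M N L : Type u} [CommRing A] [CommRing B] {σ : A →+* B} [AddCommGroup M] [Module A M]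
  [AddCommGroup N] [Module B N] [AddCommGroup L] [Module A L]

theorem ι_mem_symPiece (x : M) : SymmetricAlgebra.ι A M x ∈ symPiece A M 1 := by
  rw [symPiece, pow_one]
  exact ⟨x, rfl⟩

theorem exists_ι_of_mem_symPiece {s : SymmetricAlgebra A M} (hs : s ∈ symPiece A M 1) :
    ∃ x, SymmetricAlgebra.ι A M x = s := by
  rwa [symPiece, pow_one] at hs

theorem mul_mem_symPiece {k l : ℕ} {s t : SymmetricAlgebra A M} (hs : s ∈ symPiece A M k)
    (ht : t ∈ symPiece A M l) : s * t ∈ symPiece A M (k + l) := by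
  rw [symPiece, pow_add]
  exact Submodule.mul_mem_mul hs ht

theorem pow_mem_symPiece {k : ℕ} {s : SymmetricAlgebra A M} (hs : s ∈ symPiece A M k) (n : ℕ) :
    s ^ n ∈ symPiece A M (k * n) := by
  rw [symPiece, pow_mul]
  exact Submodule.pow_mem_pow _ hs n

theorem ι_pow_mem_symPiece (x : M) (n : ℕ) : SymmetricAlgebra.ι A M x ^ n ∈ symPiece A M n := by
  simpa using pow_mem_symPiece (ι_mem_symPiece (A := A) x) n

theorem mem_symPiece_zero {s : SymmetricAlgebra A M} (hs : s ∈ symPiece A M 0) :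
    ∃ a, algebraMap A _ a = s := by
  rw [symPiece, pow_zero] at hs
  exact Submodule.mem_one.mp hs

/-- Induction over the products of a homogeneous element and an element of degree one. -/
theorem symPiece_succ_induction {k : ℕ} {P : ∀ s, s ∈ symPiece A M (k + 1) → Prop}
    (mul : ∀ s (hs : s ∈ symPiece A M k) x,
      P (s * SymmetricAlgebra.ι A M x) (mul_mem_symPiece hs (ι_mem_symPiece x)))
    (add : ∀ s hs t ht, P s hs → P t ht → P (s + t) (add_mem hs ht)) {s : SymmetricAlgebra A M}
    (hs : s ∈ symPiece A M (k + 1)) : P s hs := by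
  have hs' := hs
  rw [symPiece, pow_succ] at hs'
  have h : ∃ hs, P s hs := by
    induction hs' using Submodule.mul_induction_on' with
    | mem_mul_mem y hy z hz =>
      obtain ⟨x, rfl⟩ := hz
      exact ⟨_, mul y hy x⟩
    | add y hy z hz hy' hz' =>
      rw [symPiece, pow_succ] at hs
      obtain ⟨_, hy'⟩ := hy' (by rwa [symPiece, pow_succ])
      obtain ⟨_, hz'⟩ := hz' (by rwa [symPiece, pow_succ])
      exact ⟨_, add y _ z _ hy' hz'⟩
  exact h.2

/-- The homomorphism `Sym(M) → Sym(M)[T]` that sends a homogeneous element `s` of degree `k` to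
`s Tᵏ`. -/
def symGrade (A M : Type u) [CommRing A] [AddCommGroup M] [Module A M] :
    SymmetricAlgebra A M →ₐ[A] Polynomial (SymmetricAlgebra A M) :=
  SymmetricAlgebra.lift
    { toFun := fun x => Polynomial.C (SymmetricAlgebra.ι A M x) * Polynomial.X
      map_add' := fun x y => by simp [add_mul]
      map_smul' := fun a x => by simp [← Polynomial.smul_C] }

theorem symGrade_ι (x : M) : symGrade A M (SymmetricAlgebra.ι A M x) =
    Polynomial.C (SymmetricAlgebra.ι A M x) * Polynomial.X :=
  SymmetricAlgebra.lift_ι_apply _ x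

theorem symGrade_of_mem {k : ℕ} {s : SymmetricAlgebra A M} (hs : s ∈ symPiece A M k) :
    symGrade A M s = Polynomial.C s * Polynomial.X ^ k := by
  induction k generalizing s with
  | zero =>
    obtain ⟨a, rfl⟩ := mem_symPiece_zero hs
    rw [AlgHom.commutes, pow_zero, mul_one, Polynomial.algebraMap_apply]
  | succ k ih =>
    induction hs using symPiece_succ_induction with
    | mul s hs x =>
      rw [map_mul, ih hs, symGrade_ι, Polynomial.C_mul]
      ring
    | add s _ t _ hs ht => rw [map_add, hs, ht, Polynomial.C_add, add_mul]

theorem symGrade_coeff_mem (s : SymmetricAlgebra A M) (k : ℕ) :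
    (symGrade A M s).coeff k ∈ symPiece A M k := by
  have hom : ∀ (l : ℕ) (s : SymmetricAlgebra A M), s ∈ symPiece A M l →
      ∀ k, (symGrade A M s).coeff k ∈ symPiece A M k := by
    intro l s hs k
    rw [symGrade_of_mem hs, Polynomial.coeff_C_mul_X_pow]
    split_ifs with h
    · rw [h]; exact hs
    · exact zero_mem _
  induction s using SymmetricAlgebra.induction generalizing k with
  | algebraMap a =>
    refine hom 0 _ ?_ k
    rw [symPiece, pow_zero]
    exact Submodule.mem_one.mpr ⟨a, rfl⟩
  | ι x => exact hom 1 _ (ι_mem_symPiece x) k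
  | mul s t hs ht =>
    rw [map_mul, Polynomial.coeff_mul]
    refine Submodule.sum_mem _ fun x hx => ?_
    rw [← Finset.HasAntidiagonal.mem_antidiagonal.mp hx]
    exact mul_mem_symPiece (hs _) (ht _)
  | add s t hs ht => rw [map_add, Polynomial.coeff_add]; exact add_mem (hs k) (ht k)

theorem eval_one_symGrade (s : SymmetricAlgebra A M) : (symGrade A M s).eval 1 = s := by
  have : (Polynomial.evalRingHom 1).comp (symGrade A M).toRingHom =
      RingHom.id (SymmetricAlgebra A M) :=
    sym_ringHom_ext (fun a => by simp [Polynomial.algebraMap_apply]) fun x => by simp [symGrade_ι]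
  exact RingHom.congr_fun this s

/-- The projection of the symmetric algebra to its part of degree one. -/
def symProj (A M : Type u) [CommRing A] [AddCommGroup M] [Module A M] :
    SymmetricAlgebra A M →ₗ[A] M :=
  letI : Module Aᵐᵒᵖ M := Module.compHom _ ((RingHom.id A).fromOpposite mul_comm)
  haveI : IsCentralScalar A M := ⟨fun _ _ => rfl⟩
  (TrivSqZeroExt.sndHom A M).comp
    (SymmetricAlgebra.lift (TrivSqZeroExt.inrHom A M)).toLinearMap

theorem symProj_ι (x : M) : symProj A M (SymmetricAlgebra.ι A M x) = x := by
  simp [symProj]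

theorem ι_injective : Function.Injective (SymmetricAlgebra.ι A M) :=
  Function.LeftInverse.injective symProj_ι

theorem ι_symProj {s : SymmetricAlgebra A M} (hs : s ∈ symPiece A M 1) :
    SymmetricAlgebra.ι A M (symProj A M s) = s := by
  obtain ⟨x, rfl⟩ := exists_ι_of_mem_symPiece hs
  rw [symProj_ι]

/-- The evaluation of the elements of `Sym(M)` at a linear form on `M`. -/
abbrev evalSym (l : Module.Dual A M) : SymmetricAlgebra A M →ₐ[A] A := SymmetricAlgebra.lift l

theorem evalSym_smul (a : A) (l : Module.Dual A M) {k : ℕ} {s : SymmetricAlgebra A M}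
    (hs : s ∈ symPiece A M k) : evalSym (a • l) s = a ^ k * evalSym l s := by
  induction k generalizing s with
  | zero =>
    obtain ⟨b, rfl⟩ := mem_symPiece_zero hs
    rw [AlgHom.commutes, AlgHom.commutes, pow_zero, one_mul]
  | succ k ih =>
    induction hs using symPiece_succ_induction with
    | mul s hs x =>
      rw [map_mul, map_mul, ih hs, SymmetricAlgebra.lift_ι_apply, SymmetricAlgebra.lift_ι_apply,
        LinearMap.smul_apply, smul_eq_mul]
      ring
    | add s _ t _ hs ht => rw [map_add, map_add, hs, ht, mul_add]

theorem evalSym_symMap {φ : M →ₛₗ[σ] N} {l : Module.Dual A M} {l' : Module.Dual B N}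
    (h : ∀ x, l' (φ x) = σ (l x)) (s : SymmetricAlgebra A M) :
    evalSym l' (symMap φ s) = σ (evalSym l s) := by
  have : (evalSym l').toRingHom.comp (symMap φ) = σ.comp (evalSym l).toRingHom :=
    sym_ringHom_ext (fun a => by simp [symMap_algebraMap]) fun x => by simp [symMap_ι, h]
  exact RingHom.congr_fun this s

theorem exists_symMap_eq {q : M →ₗ[A] L} (hq : Function.Surjective q) {k : ℕ}
    {a : SymmetricAlgebra A L} (ha : a ∈ symPiece A L k) :
    ∃ s ∈ symPiece A M k, symMap q s = a := by
  induction k generalizing a with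
  | zero =>
    obtain ⟨b, rfl⟩ := mem_symPiece_zero ha
    refine ⟨algebraMap A _ b, ?_, symMap_algebraMap q b⟩
    rw [symPiece, pow_zero]
    exact Submodule.mem_one.mpr ⟨b, rfl⟩
  | succ k ih =>
    induction ha using symPiece_succ_induction with
    | mul a ha x =>
      obtain ⟨s, hs, rfl⟩ := ih ha
      obtain ⟨x, rfl⟩ := hq x
      exact ⟨_, mul_mem_symPiece hs (ι_mem_symPiece x), by rw [map_mul, symMap_ι]⟩
    | add a _ b _ ha hb =>
      obtain ⟨s, hs, rfl⟩ := ha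
      obtain ⟨t, ht, rfl⟩ := hb
      exact ⟨s + t, add_mem hs ht, map_add _ _ _⟩

/-- If `y` generates `L` after inverting `l(y)`, then `yᵏ` generates `Symᵏ(L)`. -/
theorem pow_smul_sym [Module.Invertible A L] (l : Module.Dual A L) (y : L) {k : ℕ}
    {a : SymmetricAlgebra A L} (ha : a ∈ symPiece A L k) :
    l y ^ k • a = evalSym l a • SymmetricAlgebra.ι A L y ^ k := by
  induction k generalizing a with
  | zero =>
    obtain ⟨b, rfl⟩ := mem_symPiece_zero ha
    rw [pow_zero, one_smul, AlgHom.commutes, pow_zero, Algebra.algebraMap_eq_smul_one,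
      Algebra.algebraMap_self_apply]
  | succ k ih =>
    induction ha using symPiece_succ_induction with
    | mul a ha x =>
      rw [pow_succ, ← smul_mul_smul_comm, ih ha, ← map_smul, smul_swap, map_smul,
        smul_mul_smul_comm, map_mul, SymmetricAlgebra.lift_ι_apply, pow_succ]
    | add a _ b _ ha hb => rw [smul_add, ha, hb, map_add, add_smul]

theorem symPiece_eq_zero [Module.Invertible A L] {k : ℕ} {a : SymmetricAlgebra A L}
    (ha : a ∈ symPiece A L k) (h : ∀ l : Module.Dual A L, evalSym l a = 0) : a = 0 :=
  eq_of_pairing (A := A) L k fun l y => by rw [pow_smul_sym l y ha, h, zero_smul, smul_zero]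

instance [Module.Invertible A L] (m : ℕ) : Module.Invertible A (symPiece A L m) := by
  refine invertible_of_swap ?_
  rw [eq_top_iff, ← Ideal.span_pow_eq_top _ (span_pairing_eq_top A L) m]
  refine Ideal.span_mono ?_
  rintro _ ⟨_, ⟨l, y, rfl⟩, rfl⟩
  refine ⟨(evalSym l).toLinearMap.comp (symPiece A L m).subtype, ⟨_, ι_pow_mem_symPiece y m⟩,
    by simp, fun a => Subtype.ext ?_⟩
  have h : evalSym l (SymmetricAlgebra.ι A L y ^ m) = l y ^ m := by simp
  change evalSym l (SymmetricAlgebra.ι A L y ^ m) • (a : SymmetricAlgebra A L) = evalSym l a • _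
  rw [h, pow_smul_sym l y a.2]

/-- The canonical homomorphism `Sym(Sym^m(L)) → Sym(L)`. -/
def symSym (A L : Type u) [CommRing A] [AddCommGroup L] [Module A L] (m : ℕ) :
    SymmetricAlgebra A (symPiece A L m) →ₐ[A] SymmetricAlgebra A L :=
  SymmetricAlgebra.lift (symPiece A L m).subtype

theorem symSym_ι {m : ℕ} (a : symPiece A L m) :
    symSym A L m (SymmetricAlgebra.ι A _ a) = a :=
  SymmetricAlgebra.lift_ι_apply _ a

theorem exists_symSym_eq {m k : ℕ} {a : SymmetricAlgebra A L} (ha : a ∈ symPiece A L (m * k)) :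
    ∃ b ∈ symPiece A (symPiece A L m) k, symSym A L m b = a := by
  have h : symPiece A L (m * k) =
      (symPiece A (symPiece A L m) k).map (symSym A L m).toLinearMap := by
    change LinearMap.range _ ^ (m * k) = Submodule.map _ (LinearMap.range _ ^ k)
    rw [pow_mul, Submodule.map_pow]
    congr 1
    ext a
    constructor
    · intro ha
      exact ⟨_, ⟨⟨a, ha⟩, rfl⟩, symSym_ι _⟩
    · rintro ⟨_, ⟨b, rfl⟩, rfl⟩
      rw [AlgHom.toLinearMap_apply, symSym_ι]
      exact b.2
  rw [h] at ha
  exact ha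

/-- For an invertible module `L`, the algebra `⨁ₖ Symᵏ(Sym^m(L))` is the Veronese subalgebra
`⨁ₖ Sym^(m k)(L)` of `Sym(L)`. -/
theorem symSym_injective [Module.Invertible A L] {m : ℕ} (hm : m ≠ 0) :
    Function.Injective (symSym A L m) := by
  rw [injective_iff_map_eq_zero]
  intro x hx
  have hcomm : (symGrade A L).toRingHom.comp (symSym A L m).toRingHom =
      ((Polynomial.expand _ m).toRingHom.comp (Polynomial.mapRingHom (symSym A L m).toRingHom)).comp
        (symGrade A (symPiece A L m)).toRingHom :=
    sym_ringHom_ext (fun a => by simp [Polynomial.algebraMap_apply]) fun a => by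
      simp [symSym_ι, symGrade_ι, symGrade_of_mem a.2]
  have h0 : (symGrade A (symPiece A L m) x).map (symSym A L m).toRingHom = 0 := by
    refine Polynomial.expand_injective (Nat.pos_of_ne_zero hm) ?_
    have := RingHom.congr_fun hcomm x
    simp only [RingHom.comp_apply, AlgHom.toRingHom_eq_coe, RingHom.coe_coe, hx, map_zero] at this
    rw [map_zero]
    exact this.symm
  have hk : ∀ k, (symGrade A (symPiece A L m) x).coeff k = 0 := by
    intro k
    refine eq_of_pairing (A := A) L (m * k) fun l y => ?_
    let μ : Module.Dual A (symPiece A L m) :=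
      (evalSym l).toLinearMap.comp (symPiece A L m).subtype
    have hμ : evalSym μ = (evalSym l).comp (symSym A L m) :=
      SymmetricAlgebra.algHom_ext (LinearMap.ext fun a => by simp [μ, symSym_ι])
    have hy : l y ^ m = μ ⟨_, ι_pow_mem_symPiece y m⟩ := by simp [μ]
    have hc := congrArg (fun p => p.coeff k) h0
    rw [Polynomial.coeff_map, Polynomial.coeff_zero] at hc
    rw [pow_mul, hy, pow_smul_sym μ _ (symGrade_coeff_mem x k), hμ, smul_zero, AlgHom.comp_apply]
    change evalSym l ((symSym A L m).toRingHom _) • _ = 0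
    rw [hc, map_zero, zero_smul]
  rw [← eval_one_symGrade x, show symGrade A (symPiece A L m) x = 0 from
    Polynomial.ext fun k => by rw [hk, Polynomial.coeff_zero], Polynomial.eval_zero]

end Sym

/-! ### The Clifford algebra of a line bundle over a ring -/

section LineClifford

variable {A : Type u} [CommRing A] {T : Type u} [AddCommGroup T] [Module A T]

/-- The relations `[a x] = aᵐ [x]` and `c₀(x) [x]^d + ⋯ + c_{d-1}(x) [x] = c_d(x)` between
generators `[x]`, where `x ∈ T`. -/
inductive LineCliffordRel (m : ℕ) {d : ℕ} (c : Fin (d + 1) → T → A) :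
    FreeAlgebra A T → FreeAlgebra A T → Prop
  | smul (a : A) (x : T) :
    LineCliffordRel m c (FreeAlgebra.ι A (a • x)) (a ^ m • FreeAlgebra.ι A x)
  | law (x : T) :
    LineCliffordRel m c (∑ i : Fin d, c i.castSucc x • FreeAlgebra.ι A x ^ (d - (i : ℕ)))
      (algebraMap A _ (c (Fin.last d) x))

/-- The algebra generated by elements `[x]`, for `x ∈ T`, with the relations `[a x] = aᵐ [x]` and
`c₀(x) [x]^d + ⋯ + c_{d-1}(x) [x] = c_d(x)`. If `T` is invertible, the functions `x ↦ [x]` with the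
first relation are the linear maps on `Γ^m(T)`, and this is the Clifford algebra of
`(T, Γ^m(T), A, …, A, l^m, c₀, …, c_d)`. -/
def LineClifford (m : ℕ) {d : ℕ} (c : Fin (d + 1) → T → A) : Type u :=
  RingQuot (LineCliffordRel m c)

namespace LineClifford

variable {m d : ℕ} {c : Fin (d + 1) → T → A}

instance : Ring (LineClifford m c) := inferInstanceAs (Ring (RingQuot (LineCliffordRel m c)))

instance : Algebra A (LineClifford m c) :=
  inferInstanceAs (Algebra A (RingQuot (LineCliffordRel m c)))

/-- The generator `[x]`. -/
def gen (m : ℕ) {d : ℕ} (c : Fin (d + 1) → T → A) (x : T) : LineClifford m c :=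
  RingQuot.mkAlgHom A (LineCliffordRel m c) (FreeAlgebra.ι A x)

theorem gen_smul (a : A) (x : T) : gen m c (a • x) = a ^ m • gen m c x := by
  have h := RingQuot.mkAlgHom_rel A (LineCliffordRel.smul (m := m) (c := c) a x)
  rwa [map_smul] at h

theorem gen_law (x : T) : ∑ i : Fin d, c i.castSucc x • gen m c x ^ (d - (i : ℕ)) =
    algebraMap A (LineClifford m c) (c (Fin.last d) x) := by
  have h := RingQuot.mkAlgHom_rel A (LineCliffordRel.law (m := m) (c := c) x)
  rw [map_sum, AlgHom.commutes] at h
  refine Eq.trans ?_ h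
  exact Finset.sum_congr rfl fun i _ => by rw [map_smul, map_pow]; rfl

/-- The universal property of the Clifford algebra. -/
theorem existsUnique_lift {E : Type*} [Ring E] [Algebra A E] (t : T → E)
    (h₁ : ∀ (a : A) (x : T), t (a • x) = a ^ m • t x)
    (h₂ : ∀ x, ∑ i : Fin d, c i.castSucc x • t x ^ (d - (i : ℕ)) =
      algebraMap A E (c (Fin.last d) x)) :
    ∃! g : LineClifford m c →ₐ[A] E, ∀ x, g (gen m c x) = t x := by
  refine ⟨RingQuot.liftAlgHom A ⟨FreeAlgebra.lift A t, ?_⟩, fun x => ?_, fun g hg => ?_⟩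
  · rintro _ _ (⟨a, x⟩ | ⟨x⟩)
    · simp [h₁]
    · simp [h₂]
  · exact (RingQuot.liftAlgHom_mkAlgHom_apply _ _ _ _).trans (FreeAlgebra.lift_ι_apply _ _)
  · refine RingQuot.ringQuot_ext' A _ _ (FreeAlgebra.hom_ext (funext fun x => ?_))
    refine (hg x).trans ?_
    exact ((RingQuot.liftAlgHom_mkAlgHom_apply _ _ _ _).trans (FreeAlgebra.lift_ι_apply _ _)).symm

theorem induction {P : LineClifford m c → Prop} (algebraMap : ∀ a, P (algebraMap A _ a))
    (gen : ∀ x, P (gen m c x)) (add : ∀ x y, P x → P y → P (x + y))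
    (mul : ∀ x y, P x → P y → P (x * y)) (x : LineClifford m c) : P x := by
  obtain ⟨x, rfl⟩ := RingQuot.mkAlgHom_surjective A (LineCliffordRel m c) x
  induction x using FreeAlgebra.induction with
  | grade0 a => rw [AlgHom.commutes]; exact algebraMap a
  | grade1 x => exact gen x
  | mul a b ha hb => rw [map_mul]; exact mul _ _ ha hb
  | add a b ha hb => rw [map_add]; exact add _ _ ha hb

/-- After inverting a value `l(y)`, the algebra is generated by the single element `[y]`. This is
why it is commutative. -/
theorem gen_mul_comm [Module.Invertible A T] (x y : T) :
    gen m c x * gen m c y = gen m c y * gen m c x := by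
  refine eq_of_pairing (A := A) T (m + m) fun l z => ?_
  rw [pow_add, ← smul_mul_smul_comm, ← smul_mul_smul_comm, ← gen_smul, ← gen_smul, smul_swap,
    smul_swap l z y, gen_smul, gen_smul, smul_mul_smul_comm, smul_mul_smul_comm, mul_comm]

theorem commute [Module.Invertible A T] (a b : LineClifford m c) : Commute a b := by
  induction a using induction with
  | algebraMap r => exact Algebra.commute_algebraMap_left r b
  | add a a' h h' => exact h.add_left h'
  | mul a a' h h' => exact h.mul_left h'
  | gen x =>
    induction b using induction with
    | algebraMap r => exact Algebra.commute_algebraMap_right r _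
    | add a a' h h' => exact h.add_right h'
    | mul a a' h h' => exact h.mul_right h'
    | gen y => exact gen_mul_comm x y

section BaseChange

variable {B : Type u} [CommRing B] {σ : A →+* B} {T' : Type u} [AddCommGroup T'] [Module B T']
  {c' : Fin (d + 1) → T' → B}

theorem exists_map (φ : T →ₛₗ[σ] T') (hc : ∀ i x, c' i (φ x) = σ (c i x)) :
    ∃ f : LineClifford m c →+* LineClifford m c',
      (∀ a, f (algebraMap A _ a) = algebraMap B _ (σ a)) ∧
      ∀ x, f (gen m c x) = gen m c' (φ x) := by
  let _ : Algebra A (LineClifford m c') := Algebra.compHom _ σ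
  have hsmul : ∀ (a : A) (x : LineClifford m c'), a • x = σ a • x := fun _ _ => rfl
  obtain ⟨f, hf, -⟩ := existsUnique_lift (m := m) (c := c) (E := LineClifford m c')
    (fun x => gen m c' (φ x))
    (fun a x => by rw [map_smulₛₗ, gen_smul, hsmul, map_pow])
    (fun x => by
      refine Eq.trans ?_ ((gen_law (m := m) (c := c') (φ x)).trans ?_)
      · exact Finset.sum_congr rfl fun i _ => by rw [hsmul, hc]
      · rw [hc]; rfl)
  exact ⟨f.toRingHom, fun a => f.commutes a, hf⟩

/-- The homomorphism `[x] ↦ [φ(x)]` induced by a semilinear map `φ`. -/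
def map (φ : T →ₛₗ[σ] T') (hc : ∀ i x, c' i (φ x) = σ (c i x)) :
    LineClifford m c →+* LineClifford m c' := (exists_map φ hc).choose

theorem map_algebraMap (φ : T →ₛₗ[σ] T') (hc : ∀ i x, c' i (φ x) = σ (c i x)) (a : A) :
    map (m := m) φ hc (algebraMap A _ a) = algebraMap B _ (σ a) :=
  (exists_map φ hc).choose_spec.1 a

theorem map_gen (φ : T →ₛₗ[σ] T') (hc : ∀ i x, c' i (φ x) = σ (c i x)) (x : T) :
    map φ hc (gen m c x) = gen m c' (φ x) :=
  (exists_map φ hc).choose_spec.2 x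

theorem map_smul (φ : T →ₛₗ[σ] T') (hc : ∀ i x, c' i (φ x) = σ (c i x)) (a : A)
    (x : LineClifford m c) : map φ hc (a • x) = σ a • map φ hc x := by
  rw [Algebra.smul_def, map_mul, map_algebraMap, Algebra.smul_def]

/-- `map` as a semilinear map. -/
def mapLin (φ : T →ₛₗ[σ] T') (hc : ∀ i x, c' i (φ x) = σ (c i x)) :
    LineClifford m c →ₛₗ[σ] LineClifford m c' where
  toFun := map φ hc
  map_add' := map_add _
  map_smul' := map_smul φ hc

theorem ringHom_ext {E : Type*} [Semiring E] {f g : LineClifford m c →+* E}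
    (h₁ : ∀ a, f (algebraMap A _ a) = g (algebraMap A _ a))
    (h₂ : ∀ x, f (gen m c x) = g (gen m c x)) : f = g := by
  refine RingHom.ext fun x => ?_
  induction x using induction with
  | algebraMap a => exact h₁ a
  | gen x => exact h₂ x
  | add x y hx hy => rw [map_add, map_add, hx, hy]
  | mul x y hx hy => rw [map_mul, map_mul, hx, hy]

/-- The values `σ(l(y))` generate the unit ideal, so that the locality principle also applies over
an extension of the ring. -/
theorem mem_of_pairing_map (σ : A →+* B) (T : Type*) [AddCommGroup T] [Module A T]
    [Module.Invertible A T] {N : Type*} [AddCommGroup N] [Module B N] (N' : Submodule B N) {x : N}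
    (n : ℕ) (h : ∀ (l : Module.Dual A T) (y : T), σ (l y) ^ n • x ∈ N') : x ∈ N' := by
  have hs := congrArg (Ideal.map σ) (span_pairing_eq_top A T)
  rw [Ideal.map_span, Ideal.map_top] at hs
  refine Submodule.mem_of_span_eq_top_of_smul_pow_mem N' _ hs x ?_
  rintro ⟨_, _, ⟨l, y, rfl⟩, rfl⟩
  exact ⟨n, h l y⟩

/-- The functions `t` with `t(a x) = aᵐ t(x)` extend along a scalar extension. -/
theorem exists_homogeneous_extension [Module.Invertible A T] [Module.Invertible B T']
    (φ : T →ₛₗ[σ] T')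
    (hφ : ∀ l : Module.Dual A T, ∃ l' : Module.Dual B T', ∀ x, l' (φ x) = σ (l x))
    {E : Type u} [AddCommGroup E] [Module B E] (t : T → E)
    (ht : ∀ (a : A) (x : T), t (a • x) = σ a ^ m • t x) :
    ∃ t' : T' → E, (∀ (b : B) (x : T'), t' (b • x) = b ^ m • t' x) ∧ ∀ x, t' (φ x) = t x := by
  let H : Submodule B (T' → E) :=
    { carrier := {t' | ∀ (b : B) (x : T'), t' (b • x) = b ^ m • t' x}
      zero_mem' := fun b x => by simp
      add_mem' := fun h h' b x => by
        rw [Pi.add_apply, Pi.add_apply, h, h', smul_add]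
      smul_mem' := fun r t' h b x => by
        rw [Pi.smul_apply, Pi.smul_apply, h, smul_comm] }
  let Φ : (T' → E) →ₗ[B] (T → E) :=
    { toFun := fun t' x => t' (φ x)
      map_add' := fun _ _ => rfl
      map_smul' := fun _ _ => rfl }
  suffices h : t ∈ H.map Φ by
    obtain ⟨t', h, h'⟩ := h
    exact ⟨t', h, congrFun h'⟩
  refine mem_of_pairing_map σ T _ m fun l y => ?_
  obtain ⟨l', hl'⟩ := hφ l
  refine ⟨fun x => l' x ^ m • t y, fun b x => ?_, funext fun x => ?_⟩
  · beta_reduce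
    rw [_root_.map_smul, smul_eq_mul, mul_pow, mul_smul]
  · change l' (φ x) ^ m • t y = σ (l y) ^ m • t x
    rw [hl', ← ht, ← ht, smul_swap]

/-- The Clifford algebra of a line bundle commutes with scalar extension. -/
theorem isScalarExtension_mapLin [Module.Invertible A T] [Module.Invertible B T']
    (φ : T →ₛₗ[σ] T')
    (hφ : ∀ l : Module.Dual A T, ∃ l' : Module.Dual B T', ∀ x, l' (φ x) = σ (l x))
    (hc : ∀ i x, c' i (φ x) = σ (c i x))
    (hhom : ∀ (i : Fin (d + 1)) (b : B) (x : T'), c' i (b • x) = b ^ ((i : ℕ) * m) * c' i x) :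
    IsScalarExtension (mapLin (m := m) φ hc) := by
  have hswap : ∀ (l : Module.Dual A T) (l' : Module.Dual B T'), (∀ x, l' (φ x) = σ (l x)) →
      ∀ y x', σ (l y) • x' = l' x' • φ y := fun l l' h y x' => by rw [← h, smul_swap]
  have hspan : Submodule.span B (Set.range (mapLin (m := m) φ hc)) = ⊤ := by
    rw [eq_top_iff]
    rintro x -
    induction x using induction with
    | algebraMap b =>
      rw [Algebra.algebraMap_eq_smul_one]
      exact Submodule.smul_mem _ _ (Submodule.subset_span ⟨1, map_one (map φ hc)⟩)
    | add x y hx hy => exact add_mem hx hy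
    | mul x y hx hy =>
      have := Submodule.mul_mem_mul hx hy
      rw [Submodule.span_mul_span] at this
      refine Submodule.span_mono ?_ this
      rintro _ ⟨_, ⟨r, rfl⟩, _, ⟨s, rfl⟩, rfl⟩
      exact ⟨r * s, map_mul (map φ hc) r s⟩
    | gen x =>
      refine mem_of_pairing_map σ T _ m fun l y => ?_
      obtain ⟨l', hl'⟩ := hφ l
      rw [← gen_smul, hswap l l' hl', gen_smul, ← map_gen (c := c) φ hc]
      exact Submodule.smul_mem _ _ (Submodule.subset_span ⟨_, rfl⟩)
  let _ : Algebra A B := σ.toAlgebra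
  let E := TensorProduct A B (LineClifford m c)
  let j : LineClifford m c →ₐ[A] E := Algebra.TensorProduct.includeRight
  have hj : ∀ (a : A) (x : LineClifford m c), j (a • x) = σ a • j x := fun a x => by
    rw [_root_.map_smul]
    exact (algebraMap_smul B a (j x)).symm
  obtain ⟨t, ht, htφ⟩ := exists_homogeneous_extension (m := m) φ hφ (fun x => j (gen m c x))
    fun a x => by rw [gen_smul, hj, map_pow]
  -- The second relation holds at the elements `φ(y)`, and it is homogeneous of degree `d m`.
  have hlaw : ∀ x, ∑ i : Fin d, c' i.castSucc x • t x ^ (d - (i : ℕ)) =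
      algebraMap B E (c' (Fin.last d) x) := by
    let D : T' → E := fun x => ∑ i : Fin d, c' i.castSucc x • t x ^ (d - (i : ℕ)) -
      algebraMap B E (c' (Fin.last d) x)
    have hD : ∀ (b : B) (x : T'), D (b • x) = b ^ (d * m) • D x := by
      intro b x
      simp only [D, smul_sub, Finset.smul_sum]
      congr 1
      · refine Finset.sum_congr rfl fun i _ => ?_
        rw [ht, hhom, smul_pow, smul_smul, smul_smul, ← pow_mul, mul_right_comm, ← pow_add,
          Fin.val_castSucc, mul_comm m, ← add_mul, Nat.add_sub_cancel' i.2.le]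
      · rw [hhom, map_mul, ← Algebra.smul_def, Fin.val_last]
    have hDφ : ∀ y, D (φ y) = 0 := by
      intro y
      have := congrArg j (gen_law (m := m) (c := c) y)
      rw [map_sum, AlgHom.commutes] at this
      refine sub_eq_zero.mpr (Eq.trans ?_ (this.trans ?_))
      · exact Finset.sum_congr rfl fun i _ => by rw [hc, htφ, hj, map_pow]
      · rw [hc]
        exact IsScalarTower.algebraMap_apply A B E _
    intro x
    rw [← sub_eq_zero, ← Submodule.mem_bot B]
    refine mem_of_pairing_map σ T _ (d * m) fun l y => ?_
    obtain ⟨l', hl'⟩ := hφ l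
    change _ • D x ∈ _
    rw [← hD, hswap l l' hl', hD, hDφ, smul_zero]
    exact zero_mem _
  obtain ⟨θ, hθ, -⟩ := existsUnique_lift (m := m) (c := c') t ht hlaw
  have hθj : θ.toRingHom.comp (map φ hc) = j.toRingHom :=
    ringHom_ext
      (fun a => by
        change θ (map φ hc (algebraMap A _ a)) = j (algebraMap A _ a)
        rw [map_algebraMap, AlgHom.commutes, AlgHom.commutes]
        exact (IsScalarTower.algebraMap_apply A B E a).symm)
      fun x => by
        change θ (map φ hc (gen m c x)) = j (gen m c x)
        rw [map_gen, hθ, htφ]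
  exact .of_section hspan θ.toLinearMap fun x => RingHom.congr_fun hθj x

end BaseChange

end LineClifford

end LineClifford

/-! ### The Clifford algebra of a line bundle as a sheaf -/

section LineWeights

variable {C : Type v} [Category.{w} C] {R : C ⥤ CommRingCat.{u}}

/-- The weighted polynomial law `(T, Γ^m(T), O, …, O, l^m, ψ₀, …, ψ_d)`. -/
def lineWeights (T : ModPsh R) (m : ℕ) {d : ℕ}
    (ψ : Fin (d + 1) → PolyLaw T (structureSheaf R).toMod) : WeightedLaw R d where
  F := T
  G := gammaMod T m
  A _ := structureSheaf _
  neg := gammaLaw T m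
  law := ψ

/-- The functions `x ↦ ψᵢ(x)` over a single point. -/
abbrev lawValues {T : ModPsh R} {d : ℕ} (ψ : Fin (d + 1) → PolyLaw T (structureSheaf R).toMod)
    (c : C) : Fin (d + 1) → T.obj c → R.obj c :=
  fun i x => (ψ i).app c x

theorem lawValues_map {T : ModPsh R} {d : ℕ}
    (ψ : Fin (d + 1) → PolyLaw T (structureSheaf R).toMod) {c c' : C} (f : c ⟶ c')
    (i : Fin (d + 1)) (x : T.obj c) :
    lawValues ψ c' i (T.map f x) = (R.map f).hom (lawValues ψ c i x) :=
  ((ψ i).naturality f x).symm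

theorem gammaDp_smul {A T : Type u} [CommRing A] [AddCommGroup T] [Module A T] (m : ℕ) (a : A)
    (x : T) : gammaDp A m (a • x) = a ^ m • gammaDp A m x :=
  Subtype.ext DividedPowerAlgebra.dp_smul

theorem WeightedLawHom.eq_of {d : ℕ} {Ψ Ψ' : WeightedLaw R d} {U V : WeightedLawHom Ψ Ψ'}
    (h₁ : ∀ c x, U.u.app c x = V.u.app c x) (h₂ : ∀ c x, U.uneg.app c x = V.uneg.app c x)
    (h₃ : ∀ i c x, AlgPshHom.app (U.ualg i) c x = AlgPshHom.app (V.ualg i) c x) : U = V := by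
  obtain ⟨⟨u, hu⟩, ⟨n, hn⟩, a, _, _⟩ := U
  obtain ⟨⟨u', hu'⟩, ⟨n', hn'⟩, a', _, _⟩ := V
  obtain rfl : u = u' := funext fun c => funext fun x => h₁ c x
  obtain rfl : n = n' := funext fun c => LinearMap.ext fun x => h₂ c x
  obtain rfl : a = a' :=
    funext fun i => AlgPshHom.ext (funext fun c => AlgHom.ext fun x => h₃ i c x)
  rfl

theorem weightFunctor_law_castSucc {d : ℕ} (B : QCohAlg R) (i : Fin d) :
    ((weightFunctor R d).obj B).law i.castSucc = coordLaw B.obj i.succ :=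
  Fin.lastCases_castSucc (motive := fun _ => PolyLaw (B.obj.toMod.power (d + 1)) B.obj.toMod) ..

theorem weightFunctor_law_last {d : ℕ} (B : QCohAlg R) :
    ((weightFunctor R d).obj B).law (Fin.last d) = lastLaw B.obj d :=
  Fin.lastCases_last (motive := fun _ => PolyLaw (B.obj.toMod.power (d + 1)) B.obj.toMod) ..

variable {T : ModPsh R} {m d : ℕ} {ψ : Fin (d + 1) → PolyLaw T (structureSheaf R).toMod}

section Weights

variable {B : QCohAlg R} (θ : WeightedLawHom (lineWeights T m ψ) ((weightFunctor R d).obj B))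

/-- The function `x ↦ θ(x^[m])` attached to a morphism `θ` of weighted polynomial laws. -/
def weightGen (c : C) (x : T.obj c) : B.obj.obj c := θ.uneg.app c (gammaDp (R.obj c) m x)

theorem weightGen_smul (c : C) (a : R.obj c) (x : T.obj c) :
    weightGen θ c (a • x) = a ^ m • weightGen θ c x := by
  refine (congrArg _ (gammaDp_smul m a x)).trans ?_
  exact map_smul (θ.uneg.app c) _ _

theorem weightGen_map {c c' : C} (f : c ⟶ c') (x : T.obj c) :
    B.obj.map f (weightGen θ c x) = weightGen θ c' (T.map f x) := by
  refine (θ.uneg.naturality f _).trans (congrArg (θ.uneg.app c') ?_)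
  exact Subtype.ext (gammaMap_dp (T.map f) m x)

theorem u_zero_eq (c : C) (x : T.obj c) :
    (show Fin (d + 1) → B.obj.obj c from θ.u.app c x) 0 = weightGen θ c x :=
  θ.comm_neg c x

theorem u_succ_eq (i : Fin d) (c : C) (x : T.obj c) :
    (show Fin (d + 1) → B.obj.obj c from θ.u.app c x) i.succ =
      algebraMap (R.obj c) (B.obj.obj c) (lawValues ψ c i.castSucc x) := by
  have h := θ.comm_law i.castSucc c x
  rw [weightFunctor_law_castSucc] at h
  exact h.trans (AlgHom.commutes (AlgPshHom.app (θ.ualg i.castSucc) c) (lawValues ψ c i.castSucc x))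

theorem weightGen_law (c : C) (x : T.obj c) :
    ∑ i : Fin d, lawValues ψ c i.castSucc x • weightGen θ c x ^ (d - (i : ℕ)) =
      algebraMap (R.obj c) (B.obj.obj c) (lawValues ψ c (Fin.last d) x) := by
  have h := θ.comm_law (Fin.last d) c x
  rw [weightFunctor_law_last] at h
  refine Eq.trans ?_ (h.trans (AlgHom.commutes (AlgPshHom.app (θ.ualg (Fin.last d)) c)
    (lawValues ψ c (Fin.last d) x)))
  refine Finset.sum_congr rfl fun i _ => ?_
  rw [Algebra.smul_def, ← u_succ_eq θ, ← u_zero_eq θ]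

/-- Morphisms from the weighted polynomial law of a line bundle are determined by the
function `x ↦ θ(x^[m])`. -/
theorem eq_of_weightGen (hT : ∀ c, Module.Invertible (R.obj c) (T.obj c))
    {θ θ' : WeightedLawHom (lineWeights T m ψ) ((weightFunctor R d).obj B)}
    (h : ∀ c x, weightGen θ c x = weightGen θ' c x) : θ = θ' := by
  refine WeightedLawHom.eq_of (fun c x => ?_) (fun c x => ?_) fun i c x => ?_
  · refine funext fun j => ?_
    induction j using Fin.cases with
    | zero => exact (u_zero_eq θ c x).trans ((h c x).trans (u_zero_eq θ' c x).symm)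
    | succ i => exact (u_succ_eq θ i c x).trans (u_succ_eq θ' i c x).symm
  · have := hT c
    exact LinearMap.congr_fun (gammaPiece_hom_ext (U := θ.uneg.app c) (U' := θ'.uneg.app c)
      fun x => h c x) x
  · exact (AlgHom.commutes (AlgPshHom.app (θ.ualg i) c) x).trans
      (AlgHom.commutes (AlgPshHom.app (θ'.ualg i) c) x).symm

end Weights

variable (m ψ) in
/-- The presheaf of the Clifford algebras `LineClifford`. -/
def lineCliffordPsh : AlgPsh R where
  obj c := LineClifford m (lawValues ψ c)
  map f := LineClifford.map (T.map f) (lawValues_map ψ f)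
  map_algebraMap f a := LineClifford.map_algebraMap _ _ a
  map_id c x := by
    have h : LineClifford.map (m := m) (T.map (𝟙 c)) (lawValues_map ψ (𝟙 c)) = RingHom.id _ :=
      LineClifford.ringHom_ext (fun a => by rw [LineClifford.map_algebraMap]; simp) fun x => by
        rw [LineClifford.map_gen, T.map_id]; rfl
    exact RingHom.congr_fun h x
  map_comp f g x := by
    have h : LineClifford.map (m := m) (T.map (f ≫ g)) (lawValues_map ψ (f ≫ g)) =
        (LineClifford.map (T.map g) (lawValues_map ψ g)).comp
          (LineClifford.map (T.map f) (lawValues_map ψ f)) :=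
      LineClifford.ringHom_ext
        (fun a => by
          rw [RingHom.comp_apply, LineClifford.map_algebraMap, LineClifford.map_algebraMap,
            LineClifford.map_algebraMap]
          simp)
        fun x => by
          rw [RingHom.comp_apply, LineClifford.map_gen, LineClifford.map_gen, LineClifford.map_gen,
            T.map_comp]
    exact RingHom.congr_fun h x

variable (T) in
/-- The linear forms on the values of `T` extend along all morphisms, as they do for a line
bundle. -/
def FormsExtend : Prop :=
  ∀ ⦃c c' : C⦄ (f : c ⟶ c') (l : Module.Dual (R.obj c) (T.obj c)),
    ∃ l' : Module.Dual (R.obj c') (T.obj c'), ∀ x, l' (T.map f x) = (R.map f).hom (l x)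

theorem lineCliffordPsh_isQuasiCoherent (hT : ∀ c, Module.Invertible (R.obj c) (T.obj c))
    (hext : FormsExtend T) (hψ : ∀ i : Fin (d + 1), (ψ i).IsHomogeneous (i * m)) :
    (lineCliffordPsh m ψ).toMod.IsQuasiCoherent := fun c c' f => by
  have := hT c
  have := hT c'
  exact LineClifford.isScalarExtension_mapLin (m := m) (T.map f) (hext f) (lawValues_map ψ f)
    fun i b x => hψ i c' b x

/-- The Clifford algebra of `lineWeights`. -/
def lineCliffordAlg (hT : ∀ c, Module.Invertible (R.obj c) (T.obj c))
    (hext : FormsExtend T) (hψ : ∀ i : Fin (d + 1), (ψ i).IsHomogeneous (i * m)) : QCohAlg R :=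
  ⟨lineCliffordPsh m ψ, lineCliffordPsh_isQuasiCoherent hT hext hψ⟩

section Universal

variable (hT : ∀ c, Module.Invertible (R.obj c) (T.obj c))
  (hext : FormsExtend T) (hψ : ∀ i : Fin (d + 1), (ψ i).IsHomogeneous (i * m))

theorem exists_genLinear (c : C) (hT : Module.Invertible (R.obj c) (T.obj c)) :
    ∃ U : gammaPiece (R.obj c) (T.obj c) m →ₗ[R.obj c] LineClifford m (lawValues ψ c),
      ∀ x, U (gammaDp (R.obj c) m x) = LineClifford.gen m (lawValues ψ c) x :=
  exists_gammaPiece_lift _ LineClifford.gen_smul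

/-- The universal morphism, which maps `x^[m]` to the generator `[x]`. -/
def lineCliffordHom :
    WeightedLawHom (lineWeights T m ψ) ((weightFunctor R d).obj (lineCliffordAlg hT hext hψ)) where
  u :=
    { app := fun c x => (Fin.cons (LineClifford.gen m (lawValues ψ c) x) fun i : Fin d =>
        algebraMap (R.obj c) (LineClifford m (lawValues ψ c)) (lawValues ψ c i.castSucc x) :
        Fin (d + 1) → LineClifford m (lawValues ψ c))
      naturality := fun f x => funext fun j => by
        induction j using Fin.cases with
        | zero => exact LineClifford.map_gen (T.map f) (lawValues_map ψ f) x
        | succ i =>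
          exact (LineClifford.map_algebraMap (T.map f) (lawValues_map ψ f) _).trans
            (congrArg _ (lawValues_map ψ f i.castSucc x).symm) }
  uneg :=
    { app := fun c => (exists_genLinear c (hT c)).choose
      naturality := fun {c c'} f x => by
        have := hT c
        have h := (exists_genLinear (m := m) (ψ := ψ) c (hT c)).choose_spec
        have h' := (exists_genLinear (m := m) (ψ := ψ) c' (hT c')).choose_spec
        refine LinearMap.congr_fun (gammaPiece_hom_ext
          (U := (LineClifford.mapLin (T.map f) (lawValues_map ψ f)).comp
            (exists_genLinear (m := m) (ψ := ψ) c (hT c)).choose)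
          (U' := (exists_genLinear (m := m) (ψ := ψ) c' (hT c')).choose.comp
            (gammaPieceMap (T.map f) m)) fun y => ?_) x
        rw [LinearMap.comp_apply, LinearMap.comp_apply, h]
        have hy : gammaPieceMap (T.map f) m (gammaDp (R.obj c) m y) =
            gammaDp (R.obj c') m (T.map f y) := Subtype.ext (gammaMap_dp (T.map f) m y)
        rw [hy, h']
        exact LineClifford.map_gen (T.map f) (lawValues_map ψ f) y }
  ualg i :=
    { app := fun c => Algebra.ofId (R.obj c) (LineClifford m (lawValues ψ c))
      naturality := fun f x => LineClifford.map_algebraMap (T.map f) (lawValues_map ψ f) x }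
  comm_neg c x := ((exists_genLinear (m := m) (ψ := ψ) c (hT c)).choose_spec x).symm
  comm_law i c x := by
    induction i using Fin.lastCases with
    | last =>
      rw [weightFunctor_law_last]
      have h := LineClifford.gen_law (m := m) (c := lawValues ψ c) x
      simp only [Algebra.smul_def] at h
      exact h
    | cast i =>
      rw [weightFunctor_law_castSucc]
      rfl

theorem weightGen_lineCliffordHom (c : C) (x : T.obj c) :
    weightGen (lineCliffordHom hT hext hψ) c x = LineClifford.gen m (lawValues ψ c) x := by
  change (exists_genLinear (m := m) (ψ := ψ) c (hT c)).choose (gammaDp (R.obj c) m x) = _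
  exact (exists_genLinear (m := m) (ψ := ψ) c (hT c)).choose_spec x

theorem isClifford_lineCliffordHom :
    IsClifford (lineWeights T m ψ) (lineCliffordAlg hT hext hψ) (lineCliffordHom hT hext hψ) := by
  intro B θ
  have hl := fun c => LineClifford.existsUnique_lift (m := m) (c := lawValues ψ c)
    (weightGen θ c) (weightGen_smul θ c) (weightGen_law θ c)
  choose g hg hu using hl
  have hnat : ∀ {c c' : C} (f : c ⟶ c') (x : LineClifford m (lawValues ψ c)),
      B.obj.map f (g c x) = g c' (LineClifford.map (T.map f) (lawValues_map ψ f) x) := by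
    intro c c' f x
    refine RingHom.congr_fun (f := (B.obj.map f).comp (g c).toRingHom)
      (g := (g c').toRingHom.comp (LineClifford.map (T.map f) (lawValues_map ψ f)))
      (LineClifford.ringHom_ext (fun a => ?_) fun y => ?_) x
    · change B.obj.map f (g c _) = g c' (LineClifford.map _ _ _)
      rw [LineClifford.map_algebraMap, AlgHom.commutes, AlgHom.commutes, B.obj.map_algebraMap]
    · change B.obj.map f (g c _) = g c' (LineClifford.map _ _ _)
      rw [LineClifford.map_gen, hg, hg, weightGen_map]
  refine ⟨⟨⟨g, hnat⟩⟩, ?_, fun g' hg' => ?_⟩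
  · refine eq_of_weightGen hT fun c x => ?_
    exact (congrArg (g c) (weightGen_lineCliffordHom hT hext hψ c x)).trans (hg c x)
  · refine ObjectProperty.hom_ext _ (AlgPshHom.ext (funext fun c => hu c _ fun x => ?_))
    have h := congrArg (fun U : WeightedLawHom _ _ => weightGen U c x) hg'
    exact (congrArg (AlgPshHom.app g'.hom c)
      (weightGen_lineCliffordHom hT hext hψ c x)).symm.trans h

end Universal

section Sections

variable {Cl : QCohAlg R} {η : WeightedLawHom (lineWeights T m ψ) ((weightFunctor R d).obj Cl)}

/-- Any Clifford algebra of a line bundle is isomorphic to the algebra of generators and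
relations. -/
theorem IsClifford.exists_algEquiv (h : IsClifford (lineWeights T m ψ) Cl η)
    (hT : ∀ c, Module.Invertible (R.obj c) (T.obj c)) (hext : FormsExtend T)
    (hψ : ∀ i : Fin (d + 1), (ψ i).IsHomogeneous (i * m)) (c : C) :
    ∃ e : LineClifford m (lawValues ψ c) ≃ₐ[R.obj c] Cl.obj.obj c,
      ∀ x, e (LineClifford.gen m _ x) = weightGen η c x := by
  have h₀ := isClifford_lineCliffordHom hT hext hψ
  obtain ⟨a, ha, -⟩ := h₀ Cl η
  obtain ⟨b, hb, -⟩ := h _ (lineCliffordHom hT hext hψ)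
  have hab : a ≫ b = 𝟙 _ := by
    refine (h₀ _ (lineCliffordHom hT hext hψ)).unique ?_ ?_
    · rw [Functor.map_comp, ← Category.assoc, ha, hb]
    · rw [CategoryTheory.Functor.map_id, Category.comp_id]
  have hba : b ≫ a = 𝟙 _ := by
    refine (h _ η).unique ?_ ?_
    · rw [Functor.map_comp, ← Category.assoc, hb, ha]
    · rw [CategoryTheory.Functor.map_id, Category.comp_id]
  refine ⟨AlgEquiv.ofAlgHom (AlgPshHom.app a.hom c) (AlgPshHom.app b.hom c) ?_ ?_, fun x => ?_⟩
  · exact congrArg (fun g : Cl ⟶ Cl => AlgPshHom.app g.hom c) hba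
  · exact congrArg (fun g : lineCliffordAlg hT hext hψ ⟶ lineCliffordAlg hT hext hψ =>
      AlgPshHom.app g.hom c) hab
  · have h := congrArg (fun U : WeightedLawHom _ _ => weightGen U c x) ha
    exact (congrArg (AlgPshHom.app a.hom c) (weightGen_lineCliffordHom hT hext hψ c x)).symm.trans h

theorem IsClifford.mul_comm (h : IsClifford (lineWeights T m ψ) Cl η)
    (hT : ∀ c, Module.Invertible (R.obj c) (T.obj c)) (hext : FormsExtend T)
    (hψ : ∀ i : Fin (d + 1), (ψ i).IsHomogeneous (i * m)) (c : C) (a b : Cl.obj.obj c) :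
    a * b = b * a := by
  have := hT c
  obtain ⟨e, -⟩ := h.exists_algEquiv hT hext hψ c
  refine e.symm.injective ?_
  rw [map_mul, map_mul]
  exact LineClifford.commute _ _

/-- A function `t : T(c) → R(c)` is a weight if it is homogeneous of degree `m` and satisfies the
equation `ψ₀(x) t(x)^d + ⋯ + ψ_{d-1}(x) t(x) = ψ_d(x)`. -/
structure IsWeight (m : ℕ) {d : ℕ} {A T : Type*} [CommRing A] [AddCommGroup T] [Module A T]
    (ψ : Fin (d + 1) → T → A) (t : T → A) : Prop where
  smul : ∀ (a : A) (x : T), t (a • x) = a ^ m * t x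
  law : ∀ x, ∑ i : Fin d, ψ i.castSucc x * t x ^ (d - (i : ℕ)) = ψ (Fin.last d) x

theorem isWeight_section (η : WeightedLawHom (lineWeights T m ψ) ((weightFunctor R d).obj Cl))
    (c : C) (g : Cl.Section c) :
    IsWeight m (lawValues ψ c) fun x => g (weightGen η c x) where
  smul a x := by rw [weightGen_smul, map_smul, smul_eq_mul]
  law x := by
    have h := congrArg g (weightGen_law η c x)
    rw [AlgHom.commutes, map_sum] at h
    refine Eq.trans (Finset.sum_congr rfl fun i _ => ?_) h
    rw [map_smul, map_pow, smul_eq_mul]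

/-- The sections of the spectrum of the Clifford algebra are the weights. -/
theorem IsClifford.existsUnique_section (h : IsClifford (lineWeights T m ψ) Cl η)
    (hT : ∀ c, Module.Invertible (R.obj c) (T.obj c)) (hext : FormsExtend T)
    (hψ : ∀ i : Fin (d + 1), (ψ i).IsHomogeneous (i * m)) (c : C) {t : T.obj c → R.obj c}
    (ht : IsWeight m (lawValues ψ c) t) :
    ∃! g : Cl.Section c, ∀ x, g (weightGen η c x) = t x := by
  obtain ⟨e, he⟩ := h.exists_algEquiv hT hext hψ c
  obtain ⟨g, hg, hu⟩ := LineClifford.existsUnique_lift (m := m) (c := lawValues ψ c)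
    (E := R.obj c) t ht.smul ht.law
  refine ⟨g.comp e.symm.toAlgHom, fun x => ?_, fun g' hg' => ?_⟩
  · rw [← he]
    exact (congrArg g (e.symm_apply_apply _)).trans (hg x)
  · have h := hu (g'.comp e.toAlgHom) fun x => (congrArg g' (he x)).trans (hg' x)
    refine AlgHom.ext fun y => ?_
    rw [← h]
    exact (congrArg g' (e.apply_symm_apply y)).symm

end Sections

end LineWeights

/-! ### Points of weighted projective bundles -/

section Veronese

variable {A M : Type u} [CommRing A] [AddCommGroup M] [Module A M] {m : ℕ}

/-- The elements of `Sym^m(M)` as elements of the Veronese subalgebra. -/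
def veroneseC (s : symPiece A M m) : veronese A M m :=
  ⟨Polynomial.C (s : SymmetricAlgebra A M), wPiece_le_veronese (k := 1) <| by
    rw [← mul_one (Polynomial.C _), ← pow_zero Polynomial.X]
    exact C_mul_X_pow_mem_wPiece s.2 (by simp)⟩

variable (A M m) in
/-- The generator `x₀` as an element of the Veronese subalgebra. -/
def veroneseX : veronese A M m :=
  ⟨Polynomial.X, wPiece_le_veronese (k := 1) <| by
    rw [← one_mul Polynomial.X, ← Polynomial.C_1, ← pow_one Polynomial.X]
    exact C_mul_X_pow_mem_wPiece (i := 0) (Submodule.one_le.mp (pow_zero _).ge) (by simp)⟩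

theorem veroneseC_mem_wPiece (s : symPiece A M m) : (veroneseC s : WSym A M) ∈ wPiece A M m m := by
  change Polynomial.C (s : SymmetricAlgebra A M) ∈ _
  rw [← mul_one (Polynomial.C _), ← pow_zero Polynomial.X]
  exact C_mul_X_pow_mem_wPiece s.2 (by simp)

theorem veroneseX_mem_wPiece : (veroneseX A M m : WSym A M) ∈ wPiece A M m m := by
  change Polynomial.X ∈ _
  rw [← one_mul Polynomial.X, ← Polynomial.C_1, ← pow_one Polynomial.X]
  exact C_mul_X_pow_mem_wPiece (i := 0) (Submodule.one_le.mp (pow_zero _).ge) (by simp)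

/-- The part of degree `m` of `Sym(M)[x₀]` is `Sym^m(M) ⊕ A x₀`. -/
theorem exists_of_mem_wPiece [NeZero m] {r : WSym A M} (hr : r ∈ wPiece A M m m) :
    ∃ (s : symPiece A M m) (a : A), r = veroneseC s + a • (veroneseX A M m : WSym A M) := by
  have hm := Nat.pos_of_neZero m
  induction hr using Submodule.span_induction with
  | zero => exact ⟨0, 0, by simp [veroneseC]⟩
  | add r r' _ _ h h' =>
    obtain ⟨s, a, rfl⟩ := h
    obtain ⟨s', a', rfl⟩ := h'
    exact ⟨s + s', a + a', by simp [veroneseC, add_smul]; abel⟩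
  | smul b r _ h =>
    obtain ⟨s, a, rfl⟩ := h
    exact ⟨b • s, b • a, by simp [veroneseC, smul_smul, ← Polynomial.smul_C]⟩
  | mem r hr =>
    obtain ⟨i, j, s, hs, hij, rfl⟩ := hr
    rcases Nat.eq_zero_or_pos j with rfl | hj
    · obtain rfl : i = m := by simpa using hij
      exact ⟨⟨s, hs⟩, 0, by simp [veroneseC]⟩
    · obtain rfl : j = 1 := by nlinarith
      obtain rfl : i = 0 := by omega
      obtain ⟨a, rfl⟩ := mem_symPiece_zero hs
      refine ⟨0, a, ?_⟩
      simp [veroneseC, veroneseX, Algebra.smul_def, Polynomial.algebraMap_apply]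

/-- The Veronese subalgebra is generated by `Sym^m(M)` and `x₀`. -/
theorem veronese_algHom_ext [NeZero m] {E : Type*} [Semiring E] [Algebra A E]
    {f g : veronese A M m →ₐ[A] E} (h₁ : ∀ s, f (veroneseC s) = g (veroneseC s))
    (h₂ : f (veroneseX A M m) = g (veroneseX A M m)) : f = g := by
  have hm := Nat.pos_of_neZero m
  let V : Subalgebra A (WSym A M) := (AlgHom.equalizer f g).map (veronese A M m).val
  have hX : Polynomial.X ∈ V := ⟨veroneseX A M m, h₂, rfl⟩
  have hC : ∀ (k : ℕ) (s : SymmetricAlgebra A M), s ∈ symPiece A M (m * k) →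
      Polynomial.C s ∈ V := by
    intro k s hs
    have h : symPiece A M m ≤ Subalgebra.toSubmodule (V.comap Polynomial.CAlgHom) :=
      fun s hs => ⟨veroneseC ⟨s, hs⟩, h₁ _, rfl⟩
    rw [symPiece, pow_mul] at hs
    have h' : symPiece A M m ^ k ≤ Subalgebra.toSubmodule (V.comap Polynomial.CAlgHom) := by
      clear hs
      induction k with
      | zero =>
        rw [pow_zero, Submodule.one_le]
        exact one_mem (V.comap Polynomial.CAlgHom)
      | succ k ih =>
        rw [pow_succ, Submodule.mul_le]
        exact fun a ha b hb => mul_mem (S := Subalgebra A (SymmetricAlgebra A M)) (ih ha) (h hb)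
    exact h' hs
  have hV : veronese A M m ≤ V := by
    refine Algebra.adjoin_le ?_
    rintro r ⟨k, hr⟩
    induction hr using Submodule.span_induction with
    | zero => exact zero_mem V
    | add r r' _ _ h h' => exact add_mem h h'
    | smul b r _ h => exact V.smul_mem h b
    | mem r hr =>
      obtain ⟨i, j, s, hs, hij, rfl⟩ := hr
      have hjk : j ≤ k := le_of_mul_le_mul_left (by omega) hm
      obtain rfl : i = m * (k - j) := by rw [Nat.mul_sub]; omega
      exact mul_mem (hC _ s hs) (pow_mem hX j)
  refine AlgHom.ext fun r => ?_
  obtain ⟨r', hr', he⟩ := hV r.2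
  obtain rfl : r' = r := Subtype.ext he
  exact hr'

/-- The evaluation of the elements of `Sym(M)[x₀]` at a linear form on `M` and a value of `x₀`. -/
def evalW (l : Module.Dual A M) (a : A) : WSym A M →ₐ[A] A :=
  { Polynomial.eval₂RingHom (evalSym l).toRingHom a with
    commutes' := fun b => by
      simp [Polynomial.algebraMap_apply] }

theorem evalW_C (l : Module.Dual A M) (a : A) (s : SymmetricAlgebra A M) :
    evalW l a (Polynomial.C s) = evalSym l s :=
  Polynomial.eval₂_C _ _

theorem evalW_X (l : Module.Dual A M) (a : A) : evalW l a Polynomial.X = a :=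
  Polynomial.eval₂_X _ _

namespace WPt

variable (p : WPt A M m)

/-- The restriction `Sym^m(M) → L` of `h`. -/
def sym : symPiece A M m →ₗ[A] p.L :=
  (symProj A p.L).comp <| p.h.toLinearMap.comp
    ({ toFun := veroneseC
       map_add' := fun s t => Subtype.ext (by simp [veroneseC])
       map_smul' := fun a s => Subtype.ext (by simp [veroneseC, ← Polynomial.smul_C]) } :
      symPiece A M m →ₗ[A] veronese A M m)

/-- The element `h(x₀)` of `L`. -/
def x₀ : p.L := symProj A p.L (p.h (veroneseX A M m))

theorem ι_sym (s : symPiece A M m) : SymmetricAlgebra.ι A p.L (p.sym s) = p.h (veroneseC s) :=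
  ι_symProj (p.graded 1 _ (by rw [mul_one]; exact veroneseC_mem_wPiece s))

theorem ι_x₀ : SymmetricAlgebra.ι A p.L p.x₀ = p.h (veroneseX A M m) :=
  ι_symProj (p.graded 1 _ (by rw [mul_one]; exact veroneseX_mem_wPiece))

/-- The restriction `Sym^m(M) ⊕ A x₀ → L` of `h`. -/
def deg : symPiece A M m × A →ₗ[A] p.L := p.sym.coprod (LinearMap.toSpanSingleton A p.L p.x₀)

theorem deg_apply (s : symPiece A M m) (a : A) : p.deg (s, a) = p.sym s + a • p.x₀ := by
  simp [deg]

theorem deg_surjective [NeZero m] : Function.Surjective p.deg := by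
  intro l
  obtain ⟨r, hr, h⟩ := p.surj l
  obtain ⟨s, a, e⟩ := exists_of_mem_wPiece hr
  obtain rfl : r = veroneseC s + a • veroneseX A M m := Subtype.ext e
  refine ⟨(s, a), ι_injective (A := A) ?_⟩
  rw [deg_apply, ← h, map_add, map_add, map_smul, map_smul, ι_sym, ι_x₀]

theorem evalSym_h [NeZero m] {κ : Module.Dual A p.L} {l : Module.Dual A M} {a : A}
    (h₁ : ∀ s : symPiece A M m, κ (p.sym s) = evalSym l (s : SymmetricAlgebra A M))
    (h₂ : κ p.x₀ = a) (r : veronese A M m) :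
    evalSym κ (p.h r) = evalW l a (r : WSym A M) := by
  have h : (evalSym κ).comp p.h = (evalW l a).comp (veronese A M m).val := by
    refine veronese_algHom_ext (fun s => ?_) ?_
    · rw [AlgHom.comp_apply, ← ι_sym, SymmetricAlgebra.lift_ι_apply, h₁]
      exact (evalW_C l a _).symm
    · rw [AlgHom.comp_apply, ← ι_x₀, SymmetricAlgebra.lift_ι_apply, h₂]
      exact (evalW_X l a).symm
  exact AlgHom.congr_fun h r

/-- Two points are equivalent if their restrictions to degree `m` differ by an isomorphism. -/
theorem equiv_of_deg [NeZero m] {p p' : WPt A M m} (e : p.L ≃ₗ[A] p'.L)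
    (he : ∀ x, e (p.deg x) = p'.deg x) : p ≈ p' := by
  have h₁ : ∀ s, e (p.sym s) = p'.sym s := fun s => by
    simpa [deg_apply] using he (s, 0)
  have h₂ : e p.x₀ = p'.x₀ := by simpa [deg_apply] using he (0, 1)
  let f : SymmetricAlgebra A p.L →ₐ[A] SymmetricAlgebra A p'.L :=
    { symMap e.toLinearMap with commutes' := fun a => symMap_algebraMap _ a }
  have h : f.comp p.h = p'.h := by
    refine veronese_algHom_ext (fun s => ?_) ?_
    · rw [AlgHom.comp_apply, ← ι_sym, ← ι_sym, ← h₁]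
      exact symMap_ι _ _
    · rw [AlgHom.comp_apply, ← ι_x₀, ← ι_x₀, ← h₂]
      exact symMap_ι _ _
  exact ⟨e, fun r => AlgHom.congr_fun h r⟩

theorem exists_deg_of_equiv {p p' : WPt A M m} (h : p ≈ p') :
    ∃ e : p.L ≃ₗ[A] p'.L, (∀ s, e (p.sym s) = p'.sym s) ∧ e p.x₀ = p'.x₀ := by
  obtain ⟨e, he⟩ := h
  refine ⟨e, fun s => ι_injective (A := A) ?_, ι_injective (A := A) ?_⟩
  · rw [ι_sym, ← he, ← ι_sym, symMap_ι]
    rfl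
  · rw [ι_x₀, ← he, ← ι_x₀, symMap_ι]
    rfl

end WPt

/-- Two surjections with the same kernel differ by an isomorphism. -/
theorem exists_equiv_of_ker {X L L' : Type*} [AddCommGroup X] [Module A X] [AddCommGroup L]
    [Module A L] [AddCommGroup L'] [Module A L'] {f : X →ₗ[A] L} {g : X →ₗ[A] L'}
    (hf : Function.Surjective f) (hg : Function.Surjective g) (h : ∀ x, f x = 0 ↔ g x = 0) :
    ∃ e : L ≃ₗ[A] L', ∀ x, e (f x) = g x := by
  have hk : LinearMap.ker f = LinearMap.ker g := Submodule.ext h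
  refine ⟨(f.quotKerEquivOfSurjective hf).symm.trans
    ((Submodule.quotEquivOfEq _ _ hk).trans (g.quotKerEquivOfSurjective hg)), fun x => ?_⟩
  have : (f.quotKerEquivOfSurjective hf).symm (f x) = Submodule.Quotient.mk x := by
    rw [LinearEquiv.symm_apply_eq]
    rfl
  rw [LinearEquiv.trans_apply, this]
  rfl

end Veronese

/-! ### Tautological submodules -/

section Taut

variable {A F : Type u} [CommRing A] [AddCommGroup F] [Module A F]

/-- The properties of a line subbundle `T` of `F` that the arguments below use: it has rank at
most one, and the linear forms on `F` have no common zero on it. -/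
structure IsTaut (T : Submodule A F) : Prop where
  swap : ∀ (ξ : Module.Dual A F), ∀ v ∈ T, ∀ w ∈ T, ξ v • w = ξ w • v
  span : Ideal.span {c : A | ∃ (ξ : Module.Dual A F), ∃ v ∈ T, ξ v = c} = ⊤

namespace IsTaut

variable {T : Submodule A F} (hT : IsTaut T)
include hT

theorem invertible : Module.Invertible A T := by
  refine invertible_of_swap ?_
  rw [eq_top_iff, ← hT.span]
  refine Ideal.span_mono ?_
  rintro _ ⟨ξ, v, hv, rfl⟩
  exact ⟨ξ.comp T.subtype, ⟨v, hv⟩, rfl, fun x => Subtype.ext (hT.swap ξ v hv x x.2)⟩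

theorem mem_of_map {B N : Type*} [CommRing B] (σ : A →+* B) [AddCommGroup N] [Module B N]
    (N' : Submodule B N) {x : N} (n : ℕ)
    (h : ∀ (ξ : Module.Dual A F), ∀ v ∈ T, σ (ξ v) ^ n • x ∈ N') : x ∈ N' := by
  have hs := congrArg (Ideal.map σ) hT.span
  rw [Ideal.map_span, Ideal.map_top] at hs
  refine Submodule.mem_of_span_eq_top_of_smul_pow_mem N' _ hs x ?_
  rintro ⟨_, _, ⟨ξ, v, hv, rfl⟩, rfl⟩
  exact ⟨n, h ξ v hv⟩

theorem eq_zero {N : Type*} [AddCommGroup N] [Module A N] {x : N} (n : ℕ)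
    (h : ∀ (ξ : Module.Dual A F), ∀ v ∈ T, ξ v ^ n • x = 0) : x = 0 := by
  rw [← Submodule.mem_bot A]
  exact hT.mem_of_map (RingHom.id A) ⊥ n h

end IsTaut

namespace LinePt

variable [Module.Finite A F] [Module.Projective A F] (p : LinePt A (Module.Dual A F))

theorem exists_mem_taut (l : Module.Dual A p.L) : ∃ v ∈ p.taut, ∀ ξ, ξ v = l (p.q ξ) := by
  have h : ∀ ξ, ξ ((Module.evalEquiv A F).symm (l.comp p.q)) = l (p.q ξ) := fun ξ => by
    simp
  exact ⟨_, ⟨l, h⟩, h⟩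

theorem isTaut : IsTaut p.taut where
  swap ξ v hv w hw := by
    obtain ⟨l, hl⟩ := hv
    obtain ⟨l', hl'⟩ := hw
    refine (Module.evalEquiv A F).injective (LinearMap.ext fun η => ?_)
    simp only [map_smul, Module.evalEquiv_apply, LinearMap.smul_apply, Module.Dual.eval_apply,
      smul_eq_mul, hl, hl']
    rw [mul_swap, mul_comm]
  span := by
    rw [eq_top_iff, ← span_pairing_eq_top A p.L]
    refine Ideal.span_mono ?_
    rintro _ ⟨l, y, rfl⟩
    obtain ⟨v, hv, hl⟩ := p.exists_mem_taut l
    obtain ⟨ξ, rfl⟩ := p.surj y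
    exact ⟨ξ, v, hv, hl ξ⟩

theorem q_eq_zero_iff (ξ : Module.Dual A F) : p.q ξ = 0 ↔ ∀ v ∈ p.taut, ξ v = 0 := by
  constructor
  · rintro h v ⟨l, hl⟩
    rw [hl, h, map_zero]
  · intro h
    refine eq_zero_of_forall_dual (A := A) fun l => ?_
    obtain ⟨v, hv, hl⟩ := p.exists_mem_taut l
    rw [← hl, h v hv]

theorem symMap_q_eq_zero_iff {k : ℕ} {s : SymmetricAlgebra A (Module.Dual A F)}
    (hs : s ∈ symPiece A (Module.Dual A F) k) :
    symMap p.q s = 0 ↔ ∀ v ∈ p.taut, evalSym (Module.Dual.eval A F v) s = 0 := by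
  constructor
  · rintro h v ⟨l, hl⟩
    have := evalSym_symMap (φ := p.q) (l := Module.Dual.eval A F v) (l' := l)
      (fun ξ => (hl ξ).symm) s
    rw [h, map_zero] at this
    exact this.symm
  · intro h
    refine symPiece_eq_zero (symMap_mem p.q hs) fun l => ?_
    obtain ⟨v, hv, hl⟩ := p.exists_mem_taut l
    have := evalSym_symMap (φ := p.q) (l := Module.Dual.eval A F v) (l' := l)
      (fun ξ => (hl ξ).symm) s
    rw [this, h v hv]
    rfl

end LinePt

end Taut

/-! ### Compatibility of points of the two bundles -/

section Compat

theorem symPiece_hom_ext {A B M N P : Type u} [CommRing A] [CommRing B] {σ : A →+* B}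
    [AddCommGroup M] [Module A M] [AddCommGroup N] [Module B N] [AddCommGroup P] [Module B P]
    {φ : M →ₛₗ[σ] N} (h : IsScalarExtension φ) {k : ℕ} {g g' : symPiece B N k →ₗ[B] P}
    (e : ∀ s : symPiece A M k,
      g ⟨symMap φ s, symMap_mem φ s.2⟩ = g' ⟨symMap φ s, symMap_mem φ s.2⟩) :
    g = g' := by
  have hle : Submodule.span B (symMap φ '' symPiece A M k) ≤
      (LinearMap.eqLocus g g').map (symPiece B N k).subtype := by
    rw [Submodule.span_le]
    rintro _ ⟨s, hs, rfl⟩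
    exact ⟨_, e ⟨s, hs⟩, rfl⟩
  refine LinearMap.ext fun s => ?_
  obtain ⟨s', hs', he⟩ := hle ((symPiece_eq_span h k).le s.2)
  obtain rfl : s' = s := Subtype.ext he
  exact hs'

variable {A F : Type u} [CommRing A] [AddCommGroup F] [Module A F] {m : ℕ}

/-- The point `(L, h)` is compatible with the function `t` on the submodule `T` of `F` if for
every `v ∈ T` there is a linear form `κ` on `L` such that `κ ∘ h` evaluates the elements of
`Sym^m(F^∨) ⊕ A x₀` at `(v, t(v))`. -/
def WPt.Compat (p : WPt A (Module.Dual A F) m) (T : Submodule A F) (t : T → A) : Prop :=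
  ∀ v : T, ∃ κ : Module.Dual A p.L,
    (∀ s : symPiece A (Module.Dual A F) m,
      κ (p.sym s) = evalSym (Module.Dual.eval A F (v : F)) (s : SymmetricAlgebra A _)) ∧
    κ p.x₀ = t v

namespace WPt

variable {p p' : WPt A (Module.Dual A F) m} {T : Submodule A F} {t : T → A}

theorem Compat.of_equiv (h : p.Compat T t) (e : p ≈ p') : p'.Compat T t := by
  obtain ⟨e, h₁, h₂⟩ := exists_deg_of_equiv e
  intro v
  obtain ⟨κ, h₃, h₄⟩ := h v
  exact ⟨κ.comp e.symm.toLinearMap, fun s => by simp [← h₁, h₃], by simp [← h₂, h₄]⟩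

theorem evalSym_ι_pow (ξ : Module.Dual A F) (v : F) (n : ℕ) :
    evalSym (Module.Dual.eval A F v) (SymmetricAlgebra.ι A _ ξ ^ n) = ξ v ^ n := by
  simp

theorem evalSym_eval_smul (a : A) (v : F) {k : ℕ} {s : SymmetricAlgebra A (Module.Dual A F)}
    (hs : s ∈ symPiece A _ k) : evalSym (Module.Dual.eval A F (a • v)) s =
      a ^ k * evalSym (Module.Dual.eval A F v) s := by
  rw [map_smul, evalSym_smul a _ hs]

/-- The linear forms in the definition of compatibility separate the elements of `L`. -/
theorem Compat.eq_zero (hT : IsTaut T) (h : p.Compat T t) {l : p.L}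
    (hl : ∀ (v : T) (κ : Module.Dual A p.L), (∀ s : symPiece A (Module.Dual A F) m,
      κ (p.sym s) = evalSym (Module.Dual.eval A F (v : F)) (s : SymmetricAlgebra A _)) →
        κ p.x₀ = t v → κ l = 0) : l = 0 := by
  refine hT.eq_zero m fun ξ v hv => ?_
  obtain ⟨κ, h₁, h₂⟩ := h ⟨v, hv⟩
  have h₃ := h₁ ⟨_, ι_pow_mem_symPiece ξ m⟩
  rw [evalSym_ι_pow] at h₃
  rw [← h₃, smul_swap, hl _ κ h₁ h₂, zero_smul]

theorem Compat.deg_eq_zero_iff (hT : IsTaut T) (h : p.Compat T t)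
    (s : symPiece A (Module.Dual A F) m) (a : A) : p.deg (s, a) = 0 ↔
      ∀ v : T, evalSym (Module.Dual.eval A F (v : F)) (s : SymmetricAlgebra A _) + a * t v = 0 := by
  rw [deg_apply]
  constructor
  · intro h0 v
    obtain ⟨κ, h₁, h₂⟩ := h v
    rw [← h₁, ← h₂, ← smul_eq_mul, ← map_smul, ← map_add, h0, map_zero]
  · intro h0
    refine h.eq_zero hT fun v κ h₁ h₂ => ?_
    rw [map_add, map_smul, h₁, h₂, smul_eq_mul, h0]

theorem Compat.sym_eq_zero_iff (hT : IsTaut T) (h : p.Compat T t)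
    (s : symPiece A (Module.Dual A F) m) : p.sym s = 0 ↔
      ∀ v ∈ T, evalSym (Module.Dual.eval A F v) (s : SymmetricAlgebra A _) = 0 := by
  have := h.deg_eq_zero_iff hT s 0
  simpa [deg_apply] using this

theorem Compat.sym_surjective (hT : IsTaut T) (h : p.Compat T t) : Function.Surjective p.sym := by
  intro l
  rw [← LinearMap.mem_range]
  refine hT.mem_of_map (RingHom.id A) _ m fun ξ v hv => ?_
  obtain ⟨κ, h₁, -⟩ := h ⟨v, hv⟩
  have h₃ := h₁ ⟨_, ι_pow_mem_symPiece ξ m⟩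
  rw [evalSym_ι_pow] at h₃
  rw [RingHom.id_apply, ← h₃, smul_swap]
  exact Submodule.smul_mem _ _ ⟨_, rfl⟩

/-- The point `(L, h)` is determined by `T` and `t`. -/
theorem Compat.equiv [NeZero m] (hT : IsTaut T) (h : p.Compat T t) (h' : p'.Compat T t) :
    p ≈ p' := by
  obtain ⟨e, he⟩ := exists_equiv_of_ker p.deg_surjective p'.deg_surjective fun x => by
    rw [h.deg_eq_zero_iff hT, h'.deg_eq_zero_iff hT]
  exact equiv_of_deg e he

theorem Compat.weight_unique (hT : IsTaut T) {t' : T → A} (h : p.Compat T t)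
    (h' : p.Compat T t') : t = t' := by
  funext v
  obtain ⟨κ, h₁, h₂⟩ := h v
  obtain ⟨κ', h₁', h₂'⟩ := h' v
  obtain ⟨s, hs⟩ := h.sym_surjective hT p.x₀
  rw [← h₂, ← h₂', ← hs, h₁, h₁']

/-- The linear forms on `F` that vanish on `T` are determined by `(L, h)`. -/
theorem Compat.forall_eq_zero_iff [NeZero m] (hT : IsTaut T) (h : p.Compat T t)
    (ξ : Module.Dual A F) : (∀ v ∈ T, ξ v = 0) ↔
      ∀ r : symPiece A (Module.Dual A F) m, (∃ s ∈ symPiece A (Module.Dual A F) (m - 1),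
        (r : SymmetricAlgebra A _) = SymmetricAlgebra.ι A _ ξ * s) → p.sym r = 0 := by
  have hm := Nat.pos_of_neZero m
  constructor
  · rintro h0 r ⟨s, -, hr⟩
    refine (h.sym_eq_zero_iff hT r).mpr fun v hv => ?_
    rw [hr, map_mul, SymmetricAlgebra.lift_ι_apply, Module.Dual.eval_apply, h0 v hv, zero_mul]
  · intro h0 v hv
    refine hT.eq_zero m fun η w hw => ?_
    have hmem : SymmetricAlgebra.ι A _ ξ * SymmetricAlgebra.ι A _ η ^ (m - 1) ∈
        symPiece A (Module.Dual A F) m := by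
      have := mul_mem_symPiece (ι_mem_symPiece (A := A) ξ)
        (ι_pow_mem_symPiece (A := A) η (m - 1))
      rwa [Nat.add_sub_cancel' hm] at this
    have h₁ := (h.sym_eq_zero_iff hT _).mp
      (h0 ⟨_, hmem⟩ ⟨_, ι_pow_mem_symPiece η (m - 1), rfl⟩) w hw
    rw [map_mul, evalSym_ι_pow, SymmetricAlgebra.lift_ι_apply, Module.Dual.eval_apply] at h₁
    have h₂ := congrArg ξ (hT.swap η w hw v hv)
    rw [map_smul, map_smul, smul_eq_mul, smul_eq_mul] at h₂
    obtain ⟨k, rfl⟩ := Nat.exists_eq_add_of_lt hm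
    rw [zero_add, Nat.add_sub_cancel] at h₁
    rw [zero_add, smul_eq_mul, pow_succ]
    linear_combination η w ^ k * h₂ + η v * h₁

section LinePt

variable {q q' : LinePt A (Module.Dual A F)}

theorem LiesOver.exists_compat (h : p.LiesOver q) : ∃ t, p.Compat q.taut t := by
  obtain ⟨e, he⟩ := h
  have hκ : ∀ v : q.taut, ∃ κ : Module.Dual A p.L, ∀ s : symPiece A (Module.Dual A F) m,
      κ (p.sym s) = evalSym (Module.Dual.eval A F (v : F)) (s : SymmetricAlgebra A _) := by
    rintro ⟨v, l, hl⟩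
    refine ⟨(evalSym l).toLinearMap.comp ((symPiece A q.L m).subtype.comp e.toLinearMap),
      fun s => ?_⟩
    have h := evalSym_symMap (φ := q.q) (l := Module.Dual.eval A F v) (l' := l)
      (fun ξ => (hl ξ).symm) s
    rw [← he (veroneseC s) s (p.sym s) s.2 rfl (p.ι_sym s).symm] at h
    exact h
  choose κ hκ using hκ
  exact ⟨fun v => κ v p.x₀, fun v => ⟨κ v, hκ v, rfl⟩⟩

variable [Module.Finite A F] [Module.Projective A F]

theorem Compat.linePt_unique [NeZero m] {t : q.taut → A} {t' : q'.taut → A}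
    (h : p.Compat q.taut t) (h' : p.Compat q'.taut t') : q ≈ q' :=
  exists_equiv_of_ker q.surj q'.surj fun ξ => by
    rw [q.q_eq_zero_iff, q'.q_eq_zero_iff, h.forall_eq_zero_iff q.isTaut,
      h'.forall_eq_zero_iff q'.isTaut]

theorem Compat.liesOver {t : q.taut → A} (h : p.Compat q.taut t) : p.LiesOver q := by
  let g : symPiece A (Module.Dual A F) m →ₗ[A] symPiece A q.L m :=
    { toFun := fun s => ⟨symMap q.q s, symMap_mem q.q s.2⟩
      map_add' := fun s s' => Subtype.ext (map_add (symMap q.q) _ _)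
      map_smul' := fun a s => Subtype.ext (symMap_smul q.q a _) }
  have hg : Function.Surjective g := by
    rintro ⟨a, ha⟩
    obtain ⟨s, hs, h⟩ := exists_symMap_eq q.surj ha
    exact ⟨⟨s, hs⟩, Subtype.ext h⟩
  obtain ⟨e, he⟩ := exists_equiv_of_ker (h.sym_surjective q.isTaut) hg fun s => by
    rw [h.sym_eq_zero_iff q.isTaut, ← q.symMap_q_eq_zero_iff s.2]
    exact ⟨fun h => Subtype.ext h, fun h => congrArg Subtype.val h⟩
  refine ⟨e, fun r s l hs hr hl => ?_⟩
  obtain rfl : r = veroneseC ⟨s, hs⟩ := Subtype.ext hr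
  obtain rfl : l = p.sym ⟨s, hs⟩ := ι_injective (A := A) (by rw [ι_sym, hl])
  rw [he]
  rfl

end LinePt

section Pullback

variable {B F' : Type u} [CommRing B] [AddCommGroup F'] [Module B F'] {σ : A →+* B}
  {φ : F →ₛₗ[σ] F'} {φ' : Module.Dual A F →ₛₗ[σ] Module.Dual B F'}

theorem IsPullback.exists_sym {p : WPt A (Module.Dual A F) m} {p' : WPt B (Module.Dual B F') m}
    (h : p.IsPullback φ' p') : ∃ j : p.L →ₛₗ[σ] p'.L, IsScalarExtension j ∧
      (∀ s : symPiece A (Module.Dual A F) m,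
        p'.sym ⟨symMap φ' s, symMap_mem φ' s.2⟩ = j (p.sym s)) ∧ p'.x₀ = j p.x₀ := by
  obtain ⟨j, hj, h⟩ := h
  refine ⟨j, hj, fun s => ι_injective (A := B) ?_, ι_injective (A := B) ?_⟩
  · rw [ι_sym, ← symMap_ι, ι_sym, ← h]
    exact congrArg p'.h (Subtype.ext (wMap_C φ' _).symm)
  · rw [ι_x₀, ← symMap_ι, ι_x₀, ← h]
    exact congrArg p'.h (Subtype.ext (wMap_X φ').symm)

/-- Compatibility is stable under pullback. -/
theorem Compat.pullback (hφ' : IsScalarExtension φ') (hφ : ∀ ξ v, φ' ξ (φ v) = σ (ξ v))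
    (hT : IsTaut T) {T' : Submodule B F'} (hT' : IsTaut T') (hTT' : ∀ v ∈ T, φ v ∈ T')
    {p' : WPt B (Module.Dual B F') m} (hp : p.IsPullback φ' p') (h : p.Compat T t) {t' : T' → B}
    (ht' : ∀ (b : B) (v : T'), t' (b • v) = b ^ m * t' v)
    (htt' : ∀ v : T, t' ⟨φ v, hTT' v v.2⟩ = σ (t v)) : p'.Compat T' t' := by
  obtain ⟨j, hj, hs, hx⟩ := hp.exists_sym
  intro v'
  let Φ : Module.Dual B p'.L →ₗ[B] (symPiece B (Module.Dual B F') m → B) × B :=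
    { toFun := fun κ => (fun s => κ (p'.sym s), κ p'.x₀)
      map_add' := fun _ _ => rfl
      map_smul' := fun _ _ => rfl }
  suffices hw : ((fun s : symPiece B (Module.Dual B F') m =>
      evalSym (Module.Dual.eval B F' (v' : F')) (s : SymmetricAlgebra B _)), t' v') ∈
        LinearMap.range Φ by
    obtain ⟨κ, hκ⟩ := hw
    exact ⟨κ, fun s => congrFun (congrArg Prod.fst hκ) s, congrArg Prod.snd hκ⟩
  refine hT.mem_of_map σ _ m fun ξ v hv => ?_
  obtain ⟨κ, h₁, h₂⟩ := h ⟨v, hv⟩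
  obtain ⟨κ', hκ'⟩ := hj.exists_lift (P := B)
    { toFun := fun x => σ (κ x), map_add' := fun x y => by simp, map_smul' := fun r x => by simp }
  change ∀ x, κ' (j x) = σ (κ x) at hκ'
  have h₁' : ∀ s : symPiece B (Module.Dual B F') m,
      κ' (p'.sym s) = evalSym (Module.Dual.eval B F' (φ v)) (s : SymmetricAlgebra B _) := by
    refine LinearMap.congr_fun (symPiece_hom_ext hφ' (g := κ'.comp p'.sym)
      (g' := (evalSym (Module.Dual.eval B F' (φ v))).toLinearMap.comp
        (symPiece B (Module.Dual B F') m).subtype) fun s => ?_)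
    refine (congrArg κ' (hs s)).trans ((hκ' _).trans ((congrArg σ (h₁ s)).trans ?_))
    exact (evalSym_symMap (φ := φ') (l := Module.Dual.eval A F v)
      (l' := Module.Dual.eval B F' (φ v)) (fun ξ => hφ ξ v) s).symm
  -- After multiplication by `ξ(v)`, the vector `v'` becomes a multiple of `φ(v)`, where the linear
  -- form `κ'` is available.
  have hswap : σ (ξ v) • (v' : F') = φ' ξ v' • φ v := by
    rw [← hφ, hT'.swap _ _ (hTT' v hv) _ v'.2]
  refine ⟨φ' ξ v' ^ m • κ', Prod.ext (funext fun s => ?_) ?_⟩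
  · change φ' ξ v' ^ m * κ' (p'.sym s) = σ (ξ v) ^ m * evalSym (Module.Dual.eval B F' (v' : F')) _
    rw [h₁', ← evalSym_eval_smul _ _ s.2, ← evalSym_eval_smul _ _ s.2, hswap]
  · change φ' ξ v' ^ m * κ' p'.x₀ = σ (ξ v) ^ m * t' v'
    rw [hx, hκ', h₂, ← htt', ← ht', ← ht']
    exact congrArg t' (Subtype.ext hswap.symm)

end Pullback

end WPt

end Compat

/-! ### Points of the hypersurface with a given weight -/

section Hypersurface

variable {A M : Type u} [CommRing A] [AddCommGroup M] [Module A M] {m d : ℕ}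

theorem evalW_hyperElement (l : Module.Dual A M) (a : A)
    (s : Fin (d + 1) → SymmetricAlgebra A M) : evalW l a (hyperElement s) =
      ∑ i : Fin d, evalSym l (s i.castSucc) * a ^ (d - (i : ℕ)) - evalSym l (s (Fin.last d)) := by
  rw [hyperElement, map_sub, map_sum, evalW_C]
  congr 1
  refine Finset.sum_congr rfl fun i _ => ?_
  rw [map_mul, map_pow, evalW_C, evalW_X]

/-- The homomorphism `Sym(M)[x₀] → Sym(L)` given by a linear map `M → L` and the value `e` of
`x₀`. -/
def quotW {L : Type u} [AddCommGroup L] [Module A L] (q : M →ₗ[A] L) (e : SymmetricAlgebra A L) :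
    WSym A M →ₐ[A] SymmetricAlgebra A L :=
  { Polynomial.eval₂RingHom (symMap q) e with
    commutes' := fun b => by
      have h := symMap_algebraMap q b
      simp [Polynomial.algebraMap_apply, h] }

section QuotW

variable {L : Type u} [AddCommGroup L] [Module A L] (q : M →ₗ[A] L) {e : SymmetricAlgebra A L}

theorem quotW_C (s : SymmetricAlgebra A M) : quotW q e (Polynomial.C s) = symMap q s :=
  Polynomial.eval₂_C _ _

theorem quotW_X : quotW q e Polynomial.X = e :=
  Polynomial.eval₂_X _ _

theorem quotW_mem (he : e ∈ symPiece A L m) {k : ℕ} {r : WSym A M} (hr : r ∈ wPiece A M m k) :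
    quotW q e r ∈ symPiece A L k := by
  induction hr using Submodule.span_induction with
  | zero => rw [map_zero]; exact zero_mem _
  | add r r' _ _ h h' => rw [map_add]; exact add_mem h h'
  | smul b r _ h => rw [map_smul]; exact Submodule.smul_mem _ _ h
  | mem r hr =>
    obtain ⟨i, j, s, hs, rfl, rfl⟩ := hr
    rw [map_mul, map_pow, quotW_C, quotW_X]
    exact mul_mem_symPiece (symMap_mem q hs) (pow_mem_symPiece he j)

theorem evalSym_quotW {l : Module.Dual A M} {l' : Module.Dual A L} (h : ∀ x, l' (q x) = l x)
    (r : WSym A M) : evalSym l' (quotW q e r) = evalW l (evalSym l' e) r := by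
  refine RingHom.congr_fun (f := (evalSym l').toRingHom.comp (quotW q e).toRingHom)
    (g := (evalW l (evalSym l' e)).toRingHom)
    (Polynomial.ringHom_ext (fun s => ?_) ?_) r
  · change evalSym l' (quotW q e (Polynomial.C s)) = evalW l _ (Polynomial.C s)
    rw [quotW_C, evalW_C]
    exact evalSym_symMap (σ := RingHom.id A) h s
  · change evalSym l' (quotW q e Polynomial.X) = evalW l _ Polynomial.X
    rw [quotW_X, evalW_X]

theorem quotW_mem_range (he : e ∈ symPiece A L m) (r : veronese A M m) :
    quotW q e r ∈ (symSym A L m).range := by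
  have h : veronese A M m ≤ (symSym A L m).range.comap (quotW q e) := by
    refine Algebra.adjoin_le ?_
    rintro r ⟨k, hr⟩
    obtain ⟨b, -, hb⟩ := exists_symSym_eq (quotW_mem q he hr)
    exact ⟨b, hb⟩
  exact h r.2

end QuotW

/-- The point `(L^{⊗ m}, h)` attached to a quotient `q : M → L` and an element of `L^{⊗ m}`, the
value of `h` at `x₀`. -/
theorem LinePt.exists_wPt [NeZero m] (q : LinePt A M) (e : symPiece A q.L m) :
    ∃ p : WPt A M m, ∃ i : p.L ≃ₗ[A] symPiece A q.L m,
      (∀ s, (i (p.sym s) : SymmetricAlgebra A q.L) = symMap q.q s) ∧ i p.x₀ = e ∧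
      ∀ r, p.h r = 0 ↔ quotW q.q e r = 0 := by
  have hinj := symSym_injective (A := A) (L := q.L) (NeZero.ne m)
  let h : veronese A M m →ₐ[A] SymmetricAlgebra A (symPiece A q.L m) :=
    (AlgEquiv.ofInjective (symSym A q.L m) hinj).symm.toAlgHom.comp
      (((quotW q.q (e : SymmetricAlgebra A q.L)).comp (veronese A M m).val).codRestrict _
        (quotW_mem_range q.q e.2))
  have hh : ∀ r, symSym A q.L m (h r) = quotW q.q e r := fun r =>
    congrArg Subtype.val ((AlgEquiv.ofInjective (symSym A q.L m) hinj).apply_symm_apply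
      ⟨quotW q.q e r, quotW_mem_range q.q e.2 r⟩)
  have hC : ∀ s : symPiece A M m, h (veroneseC s) =
      SymmetricAlgebra.ι A (symPiece A q.L m) ⟨symMap q.q s, symMap_mem q.q s.2⟩ := fun s =>
    hinj ((hh _).trans ((quotW_C q.q _).trans
      (symSym_ι (⟨symMap q.q s, symMap_mem q.q s.2⟩ : symPiece A q.L m)).symm))
  let p : WPt A M m :=
    { L := symPiece A q.L m
      h := h
      graded := fun k r hr => by
        obtain ⟨b, hb, hb'⟩ := exists_symSym_eq (quotW_mem q.q e.2 hr)
        rw [← hh] at hb'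
        rwa [← hinj hb']
      surj := fun l => by
        obtain ⟨s, hs, hl⟩ := exists_symMap_eq q.surj l.2
        refine ⟨veroneseC ⟨s, hs⟩, veroneseC_mem_wPiece _, (hC _).trans ?_⟩
        exact congrArg _ (Subtype.ext hl) }
  refine ⟨p, LinearEquiv.refl A _, fun s => ?_, ?_, fun r => ?_⟩
  · exact congrArg Subtype.val (ι_injective (A := A) ((p.ι_sym s).trans (hC s)))
  · refine ι_injective (A := A) (p.ι_x₀.trans (hinj ((hh _).trans ?_)))
    exact (quotW_X q.q).trans (symSym_ι e).symm
  · rw [← hh]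
    exact (map_eq_zero_iff _ hinj).symm

variable {F : Type u} [AddCommGroup F] [Module A F] [Module.Finite A F] [Module.Projective A F]

/-- A homogeneous function of degree `m` on the line `T = L^∨` is an element of `L^{⊗ m}`. -/
theorem LinePt.exists_evalSym_eq (q : LinePt A (Module.Dual A F)) {t : q.taut → A}
    (ht : ∀ (a : A) (v : q.taut), t (a • v) = a ^ m * t v) :
    ∃ e : symPiece A q.L m, ∀ (v : q.taut) (l : Module.Dual A q.L), (∀ ξ, ξ (v : F) = l (q.q ξ)) →
      evalSym l (e : SymmetricAlgebra A q.L) = t v := by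
  choose l hl using fun v : q.taut => v.2
  let Φ : symPiece A q.L m →ₗ[A] (q.taut → A) :=
    { toFun := fun a v => evalSym (l v) (a : SymmetricAlgebra A q.L)
      map_add' := fun a b => funext fun v => by simp
      map_smul' := fun a b => funext fun v => by simp }
  suffices h : t ∈ LinearMap.range Φ by
    obtain ⟨e, he⟩ := h
    refine ⟨e, fun v l' hl' => ?_⟩
    obtain rfl : l' = l v := LinearMap.ext fun y => by
      obtain ⟨ξ, rfl⟩ := q.surj y
      rw [← hl', ← hl]
    exact congrFun he v
  -- Where `ξ(w)` is invertible, `w` generates `T`, and `t` is `t(w) / ξ(w)ᵐ` times the `m`-th power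
  -- of the image of `ξ` in `L`.
  refine q.isTaut.mem_of_map (RingHom.id A) _ m fun ξ w hw =>
    ⟨t ⟨w, hw⟩ • ⟨_, ι_pow_mem_symPiece (A := A) (q.q ξ) m⟩, funext fun v => ?_⟩
  have h₁ : Φ ⟨_, ι_pow_mem_symPiece (A := A) (q.q ξ) m⟩ v = ξ v ^ m := by
    change evalSym (l v) (SymmetricAlgebra.ι A q.L (q.q ξ) ^ m) = _
    rw [map_pow, SymmetricAlgebra.lift_ι_apply, hl]
  rw [map_smul, Pi.smul_apply, h₁, smul_eq_mul, mul_comm, ← ht]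
  change _ = ξ w ^ m * t v
  rw [← ht]
  exact congrArg t (Subtype.ext (q.isTaut.swap ξ v v.2 w hw))

/-- Every weight on the tautological line of a point `q` of the projective bundle comes from a point
of the hypersurface. -/
theorem LinePt.exists_compat [NeZero m] (q : LinePt A (Module.Dual A F))
    {s : Fin (d + 1) → SymmetricAlgebra A (Module.Dual A F)}
    (hs : ∀ i : Fin (d + 1), s i ∈ symPiece A (Module.Dual A F) (i * m)) {t : q.taut → A}
    (ht : IsWeight m (fun i (v : q.taut) => evalSym (Module.Dual.eval A F (v : F)) (s i)) t) :
    ∃ p : WPt A (Module.Dual A F) m, p.Compat q.taut t ∧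
      p.h ⟨hyperElement s, hyperElement_mem hs⟩ = 0 := by
  obtain ⟨e, he⟩ := q.exists_evalSym_eq ht.smul
  obtain ⟨p, i, hi, hi₀, hp⟩ := q.exists_wPt e
  refine ⟨p, fun v => ?_, (hp _).mpr ?_⟩
  · obtain ⟨l, hl⟩ := v.2
    refine ⟨((evalSym l).toLinearMap.comp (symPiece A q.L m).subtype).comp i.toLinearMap,
      fun s => ?_, ?_⟩
    · change evalSym l (i (p.sym s) : SymmetricAlgebra A q.L) = _
      rw [hi]
      exact evalSym_symMap (σ := RingHom.id A) (fun ξ => (hl ξ).symm) _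
    · change evalSym l (i p.x₀ : SymmetricAlgebra A q.L) = _
      rw [hi₀, he v l hl]
  · have hmem : hyperElement s ∈ wPiece A (Module.Dual A F) m (d * m) := by
      refine sub_mem (Submodule.sum_mem _ fun i _ => ?_) ?_
      · refine C_mul_X_pow_mem_wPiece (hs i.castSucc) ?_
        rw [Fin.val_castSucc, mul_comm m, ← add_mul, Nat.add_sub_cancel' i.2.le]
      · rw [← mul_one (Polynomial.C _), ← pow_zero Polynomial.X]
        exact C_mul_X_pow_mem_wPiece (hs (Fin.last d)) (by simp)
    refine symPiece_eq_zero (quotW_mem q.q e.2 hmem) fun l => ?_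
    obtain ⟨v, hv, hl⟩ := q.exists_mem_taut l
    refine (evalSym_quotW q.q (l := Module.Dual.eval A F v) (l' := l)
      (fun ξ => (hl ξ).symm) _).trans ?_
    rw [he ⟨v, hv⟩ l hl, evalW_hyperElement]
    exact sub_eq_zero.mpr (ht.law ⟨v, hv⟩)

end Hypersurface

/-! ### The quotient attached to a point of the hypersurface -/

section Quotient

variable {A M : Type u} [CommRing A] [AddCommGroup M] [Module A M] {m d : ℕ}

theorem exists_dual_factor {X L : Type*} [AddCommGroup X] [Module A X] [AddCommGroup L]
    [Module A L] {f : X →ₗ[A] L} (hf : Function.Surjective f) (g : Module.Dual A X)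
    (h : ∀ x, f x = 0 → g x = 0) : ∃ k : Module.Dual A L, ∀ x, k (f x) = g x := by
  refine ⟨((LinearMap.ker f).liftQ g h).comp (f.quotKerEquivOfSurjective hf).symm.toLinearMap,
    fun x => ?_⟩
  have : (f.quotKerEquivOfSurjective hf).symm (f x) = Submodule.Quotient.mk x := by
    rw [LinearEquiv.symm_apply_eq]
    rfl
  rw [LinearMap.comp_apply, LinearEquiv.coe_coe, this]
  rfl

/-- Equality of the products `a b` and `c e` in `L^{⊗ 2}`, contracted with a linear form. -/
theorem smul_eq_smul_of_ι_mul {L : Type u} [AddCommGroup L] [Module A L] [Module.Invertible A L]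
    {a b c e : L} (h : SymmetricAlgebra.ι A L a * SymmetricAlgebra.ι A L b =
      SymmetricAlgebra.ι A L c * SymmetricAlgebra.ι A L e) (l : Module.Dual A L) :
    l a • b = l c • e := by
  refine eq_of_pairing (A := A) L 2 fun μ y => ?_
  have key : ∀ a b : L, μ y ^ 2 • l a • b =
      evalSym μ (SymmetricAlgebra.ι A L a * SymmetricAlgebra.ι A L b) • l y • y := by
    intro a b
    have h₁ : μ y * l a = μ a * l y := mul_swap _ _ _ _
    rw [map_mul, SymmetricAlgebra.lift_ι_apply, SymmetricAlgebra.lift_ι_apply, pow_two, smul_smul,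
      show μ y * μ y * l a = μ a * l y * μ y by linear_combination μ y * h₁, mul_smul,
      smul_swap μ y b, smul_smul, smul_smul]
    congr 1
    ring
  rw [key, key, h]

namespace WPt

variable (p : WPt A M m) {s : Fin (d + 1) → SymmetricAlgebra A M}

/-- The map `sym`, extended by zero to the whole symmetric algebra. -/
def symLin [NeZero m] : SymmetricAlgebra A M →ₗ[A] p.L :=
  (symProj A p.L).comp <| p.h.toLinearMap.comp <| (veroneseProj A M m).comp
    (Polynomial.CAlgHom (R := A) (A := SymmetricAlgebra A M)).toLinearMap

theorem symLin_coe [NeZero m] (s : symPiece A M m) : p.symLin s = p.sym s :=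
  congrArg (fun r => symProj A p.L (p.h r)) (veroneseProj_coe m (veroneseC s))

theorem ι_symLin_mul [NeZero m] {a b : SymmetricAlgebra A M} (ha : a ∈ symPiece A M m)
    (hb : b ∈ symPiece A M m) : SymmetricAlgebra.ι A p.L (p.symLin a) *
      SymmetricAlgebra.ι A p.L (p.symLin b) =
        p.h (veroneseProj A M m (Polynomial.C (a * b))) := by
  have h₁ := p.symLin_coe ⟨a, ha⟩
  have h₂ := p.symLin_coe ⟨b, hb⟩
  change p.symLin a = _ at h₁
  change p.symLin b = _ at h₂
  rw [h₁, h₂, ι_sym, ι_sym, ← map_mul, Polynomial.C_mul]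
  exact congrArg p.h (veroneseProj_coe m (veroneseC ⟨a, ha⟩ * veroneseC ⟨b, hb⟩)).symm

theorem smul_symLin [NeZero m] {a b c e : SymmetricAlgebra A M} (ha : a ∈ symPiece A M m)
    (hb : b ∈ symPiece A M m) (hc : c ∈ symPiece A M m) (he : e ∈ symPiece A M m)
    (h : a * b = c * e) (l : Module.Dual A p.L) :
    l (p.symLin a) • p.symLin b = l (p.symLin c) • p.symLin e :=
  smul_eq_smul_of_ι_mul (by rw [ι_symLin_mul p ha hb, ι_symLin_mul p hc he, h]) l

/-- At a point of the hypersurface the form `x₀ᵈ` lies in the ideal generated by the forms of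
positive degree on `M`. -/
theorem x₀_pow_mem (hs : ∀ i : Fin (d + 1), s i ∈ symPiece A M (i * m)) (hs₀ : s 0 = 1)
    (hp : p.h ⟨hyperElement s, hyperElement_mem hs⟩ = 0) (l : Module.Dual A p.L) (J : Ideal A)
    (hJ : ∀ a, l (p.sym a) ∈ J) : l p.x₀ ^ d ∈ J := by
  let ν : veronese A M m →ₐ[A] A := (evalSym l).comp p.h
  -- The preimage of `J` under `l ∘ h`, as a set of elements of `Sym(M)[x₀]`.
  let V : Submodule A (WSym A M) :=
    { carrier := {w | ∃ r : veronese A M m, (r : WSym A M) = w ∧ ν r ∈ J}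
      zero_mem' := ⟨0, rfl, by rw [map_zero]; exact zero_mem J⟩
      add_mem' := by
        rintro _ _ ⟨r, rfl, hr⟩ ⟨r', rfl, hr'⟩
        exact ⟨r + r', rfl, by rw [map_add]; exact add_mem hr hr'⟩
      smul_mem' := by
        rintro a _ ⟨r, rfl, hr⟩
        exact ⟨a • r, rfl, by rw [map_smul]; exact Ideal.mul_mem_left _ _ hr⟩ }
  have hV : ∀ w, w ∈ V ↔ ∃ r : veronese A M m, (r : WSym A M) = w ∧ ν r ∈ J := fun _ => Iff.rfl
  have hmul : ∀ (v : WSym A M) (r : veronese A M m), v ∈ V → v * (r : WSym A M) ∈ V := by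
    intro v r hv
    obtain ⟨v, rfl, hv'⟩ := (hV v).mp hv
    refine (hV _).mpr ⟨v * r, Subalgebra.coe_mul (veronese A M m) v r, ?_⟩
    rw [map_mul]
    exact Ideal.mul_mem_right _ _ hv'
  have hC : ∀ a ∈ symPiece A M m, Polynomial.C a ∈ V := fun a ha => by
    refine ⟨veroneseC ⟨a, ha⟩, rfl, ?_⟩
    change evalSym l (p.h (veroneseC ⟨a, ha⟩)) ∈ J
    rw [← ι_sym, SymmetricAlgebra.lift_ι_apply]
    exact hJ _
  have hpos : ∀ (k j : ℕ) (a : SymmetricAlgebra A M), a ∈ symPiece A M ((k + 1) * m) →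
      Polynomial.C a * Polynomial.X ^ j ∈ V := by
    intro k j a ha
    rw [add_mul, one_mul, add_comm, symPiece, pow_add] at ha
    induction ha using Submodule.mul_induction_on' with
    | mem_mul_mem b hb c hc =>
      rw [Polynomial.C_mul, mul_assoc]
      exact hmul _ ⟨_, wPiece_le_veronese (k := k + j) (C_mul_X_pow_mem_wPiece hc (by ring))⟩
        (hC b hb)
    | add b _ c _ hb hc => rw [Polynomial.C_add, add_mul]; exact add_mem hb hc
  have hH : hyperElement s ∈ V := by
    refine ⟨⟨hyperElement s, hyperElement_mem hs⟩, rfl, ?_⟩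
    change evalSym l (p.h ⟨hyperElement s, hyperElement_mem hs⟩) ∈ J
    rw [hp, map_zero]
    exact zero_mem J
  -- For `d = 0` the equation reads `-1 = 0`; otherwise `x₀ᵈ` is its only term without a factor
  -- from `Symᵐ(M)`.
  have hX : Polynomial.X ^ d ∈ V := by
    cases d with
    | zero =>
      rw [pow_zero]
      have h := neg_mem hH
      rw [hyperElement, show s (Fin.last 0) = 1 from hs₀] at h
      simpa using h
    | succ e =>
      have h₁ : Polynomial.X ^ (e + 1) = hyperElement s - (∑ i : Fin e,
          Polynomial.C (s i.succ.castSucc) * Polynomial.X ^ (e + 1 - (i.succ : ℕ)) -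
            Polynomial.C (s (Fin.last (e + 1))) * Polynomial.X ^ 0) := by
        rw [hyperElement, Fin.sum_univ_succ, Fin.castSucc_zero, hs₀]
        simp
      rw [h₁]
      refine sub_mem hH (sub_mem (Submodule.sum_mem _ fun i _ => hpos i _ _ ?_) (hpos e _ _ ?_))
      · exact hs i.succ.castSucc
      · exact hs (Fin.last (e + 1))
  obtain ⟨r, he, hr⟩ := hX
  obtain rfl : r = veroneseX A M m ^ d := Subtype.ext he
  change evalSym l (p.h (veroneseX A M m ^ d)) ∈ J at hr
  rwa [map_pow, map_pow, ← ι_x₀, SymmetricAlgebra.lift_ι_apply] at hr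

theorem span_sym_eq_top [NeZero m] (hs : ∀ i : Fin (d + 1), s i ∈ symPiece A M (i * m))
    (hs₀ : s 0 = 1) (hp : p.h ⟨hyperElement s, hyperElement_mem hs⟩ = 0) :
    Ideal.span {c : A | ∃ (l : Module.Dual A p.L) (a : symPiece A M m), l (p.sym a) = c} = ⊤ := by
  rw [← Ideal.radical_eq_top, eq_top_iff, ← span_pairing_eq_top A p.L, Ideal.span_le]
  rintro _ ⟨l, y, rfl⟩
  obtain ⟨⟨a, b⟩, rfl⟩ := p.deg_surjective y
  rw [deg_apply, map_add, map_smul]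
  refine add_mem (Ideal.le_radical (Ideal.subset_span ⟨l, a, rfl⟩)) (Ideal.mul_mem_left _ _ ?_)
  exact ⟨d, p.x₀_pow_mem hs hs₀ hp l _ fun a => Ideal.subset_span ⟨l, a, rfl⟩⟩

theorem sym_surjective_of_span (h : Ideal.span {c : A | ∃ (l : Module.Dual A p.L)
    (a : symPiece A M m), l (p.sym a) = c} = ⊤) : Function.Surjective p.sym := by
  intro y
  rw [← LinearMap.mem_range]
  refine Submodule.mem_of_span_eq_top_of_smul_pow_mem _ _ h y ?_
  rintro ⟨_, l, a, rfl⟩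
  refine ⟨1, ?_⟩
  change l (p.sym a) ^ 1 • y ∈ _
  rw [pow_one, smul_swap]
  exact Submodule.smul_mem _ _ ⟨a, rfl⟩

section Kernel

variable {n : ℕ} (p : WPt A M (n + 1))

/-- The elements `x ∈ M` such that `h(s x) = 0` for all `s ∈ Symⁿ(M)`. -/
def linKer : Submodule A M where
  carrier := {x | ∀ s ∈ symPiece A M n, p.symLin (s * SymmetricAlgebra.ι A M x) = 0}
  zero_mem' s _ := by rw [map_zero, mul_zero, map_zero]
  add_mem' hx hy s hs := by rw [map_add, mul_add, map_add, hx s hs, hy s hs, add_zero]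
  smul_mem' a x hx s hs := by rw [map_smul, mul_smul_comm, map_smul, hx s hs, smul_zero]

theorem exists_linKer_form (l : Module.Dual A p.L) {s : SymmetricAlgebra A M}
    (hs : s ∈ symPiece A M n) : ∃ f : Module.Dual A (M ⧸ p.linKer),
      ∀ x, f (p.linKer.mkQ x) = l (p.symLin (s * SymmetricAlgebra.ι A M x)) :=
  ⟨p.linKer.liftQ (l.comp (p.symLin.comp ((LinearMap.mulLeft A s).comp (SymmetricAlgebra.ι A M))))
    fun x hx => by
      change l (p.symLin (s * SymmetricAlgebra.ι A M x)) = 0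
      rw [hx s hs, map_zero], fun _ => rfl⟩

/-- The quotient of `M` by `linKer` has rank at most one. -/
theorem linKer_swap (l : Module.Dual A p.L) {s : SymmetricAlgebra A M} (hs : s ∈ symPiece A M n)
    (x y : M) : l (p.symLin (s * SymmetricAlgebra.ι A M x)) • p.linKer.mkQ y =
      l (p.symLin (s * SymmetricAlgebra.ι A M y)) • p.linKer.mkQ x := by
  have hm : ∀ {s}, s ∈ symPiece A M n → ∀ x, s * SymmetricAlgebra.ι A M x ∈ symPiece A M (n + 1) :=
    fun hs x => mul_mem_symPiece hs (ι_mem_symPiece x)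
  rw [← map_smul, ← map_smul, ← sub_eq_zero, ← map_sub, Submodule.mkQ_apply,
    Submodule.Quotient.mk_eq_zero]
  intro s' hs'
  rw [map_sub, mul_sub, map_sub, map_smul, map_smul, mul_smul_comm, mul_smul_comm, map_smul,
    map_smul, sub_eq_zero]
  exact p.smul_symLin (hm hs x) (hm hs' y) (hm hs y) (hm hs' x) (by ring) l

theorem invertible_linKer (h : Ideal.span {c : A | ∃ (l : Module.Dual A p.L)
    (a : symPiece A M (n + 1)), l (p.sym a) = c} = ⊤) : Module.Invertible A (M ⧸ p.linKer) := by
  refine invertible_of_swap ?_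
  rw [eq_top_iff, ← h, Ideal.span_le]
  rintro _ ⟨l, ⟨a, ha⟩, rfl⟩
  rw [← symLin_coe]
  induction ha using symPiece_succ_induction with
  | mul s hs x =>
    obtain ⟨f, hf⟩ := p.exists_linKer_form l hs
    refine Ideal.subset_span ⟨f, p.linKer.mkQ x, hf x, fun y => ?_⟩
    obtain ⟨y, rfl⟩ := p.linKer.mkQ_surjective y
    rw [hf, hf, linKer_swap p l hs]
  | add a _ b _ ha hb =>
    change l (p.symLin (a + b)) ∈ _
    rw [map_add, map_add]
    exact add_mem ha hb

/-- The line bundle quotient `M → M / linKer` of `M`. -/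
def linePt (h : Ideal.span {c : A | ∃ (l : Module.Dual A p.L)
    (a : symPiece A M (n + 1)), l (p.sym a) = c} = ⊤) : LinePt A M :=
  letI := p.invertible_linKer h
  { L := M ⧸ p.linKer
    q := p.linKer.mkQ
    surj := p.linKer.mkQ_surjective }

/-- A linear form on `M` that vanishes on `linKer` satisfies the multilinear version of the rank
one condition `linKer_swap`. -/
theorem symLin_mul_evalSym {ω : Module.Dual A M} (hω : ∀ x ∈ p.linKer, ω x = 0)
    (l : Module.Dual A p.L) {k j : ℕ} (hkj : k + j = n + 1) {a b t : SymmetricAlgebra A M}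
    (ha : a ∈ symPiece A M k) (hb : b ∈ symPiece A M k) (ht : t ∈ symPiece A M j) :
    l (p.symLin (a * t)) * evalSym ω b = l (p.symLin (b * t)) * evalSym ω a := by
  have hsw : ∀ {s}, s ∈ symPiece A M n → ∀ x y,
      l (p.symLin (s * SymmetricAlgebra.ι A M x)) * ω y =
        l (p.symLin (s * SymmetricAlgebra.ι A M y)) * ω x := by
    intro s hs x y
    have h := p.linKer_swap l hs x y
    rw [← map_smul, ← map_smul, ← sub_eq_zero, ← map_sub, Submodule.mkQ_apply,
      Submodule.Quotient.mk_eq_zero] at h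
    have h' := hω _ h
    rwa [map_sub, map_smul, map_smul, smul_eq_mul, smul_eq_mul, sub_eq_zero] at h'
  induction k generalizing j a b t with
  | zero =>
    obtain ⟨a, rfl⟩ := mem_symPiece_zero ha
    obtain ⟨b, rfl⟩ := mem_symPiece_zero hb
    simp only [← Algebra.smul_def, map_smul, AlgHom.commutes, smul_eq_mul,
      Algebra.algebraMap_self_apply]
    ring
  | succ k ih =>
    induction ha using symPiece_succ_induction with
    | add a _ a' _ h h' =>
      rw [add_mul, map_add p.symLin, map_add l, add_mul, h, h', map_add (evalSym ω), mul_add]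
    | mul a ha x =>
      induction hb using symPiece_succ_induction with
      | add b _ b' _ h h' =>
        rw [add_mul, map_add p.symLin, map_add l, add_mul, ← h, ← h', map_add (evalSym ω), mul_add]
      | mul b hb y =>
        have hxt : SymmetricAlgebra.ι A M x * t ∈ symPiece A M (j + 1) := by
          rw [add_comm]
          exact mul_mem_symPiece (ι_mem_symPiece x) ht
        have hbt : b * t ∈ symPiece A M n := by
          have := mul_mem_symPiece hb ht
          rwa [show k + j = n by omega] at this
        have h₁ := ih (j := j + 1) (by omega) ha hb hxt
        have h₂ := hsw hbt x y
        rw [show b * (SymmetricAlgebra.ι A M x * t) = b * t * SymmetricAlgebra.ι A M x by ring,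
          ← mul_assoc] at h₁
        rw [show b * SymmetricAlgebra.ι A M y * t = b * t * SymmetricAlgebra.ι A M y by ring,
          map_mul (evalSym ω), map_mul (evalSym ω), SymmetricAlgebra.lift_ι_apply,
          SymmetricAlgebra.lift_ι_apply]
        linear_combination ω y * h₁ + evalSym ω a * h₂

theorem exists_factor_evalSym (h : Ideal.span {c : A | ∃ (l : Module.Dual A p.L)
    (a : symPiece A M (n + 1)), l (p.sym a) = c} = ⊤) {ω : Module.Dual A M}
    (hω : ∀ x ∈ p.linKer, ω x = 0) : ∃ κ : Module.Dual A p.L, ∀ a : symPiece A M (n + 1),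
      κ (p.sym a) = evalSym ω (a : SymmetricAlgebra A M) := by
  refine exists_dual_factor (p.sym_surjective_of_span h)
    ((evalSym ω).toLinearMap.comp (symPiece A M (n + 1)).subtype) fun a ha => ?_
  change evalSym ω (a : SymmetricAlgebra A M) = 0
  rw [← Submodule.mem_bot A]
  refine Submodule.mem_of_span_eq_top_of_smul_pow_mem ⊥ _ h _ ?_
  rintro ⟨_, l, b, rfl⟩
  refine ⟨1, ?_⟩
  have h₁ := p.symLin_mul_evalSym hω l (j := 0) rfl a.2 b.2
    (Submodule.one_le.mp (pow_zero (LinearMap.range (SymmetricAlgebra.ι A M))).ge)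
  rw [mul_one, mul_one, symLin_coe, symLin_coe, ha, map_zero, zero_mul] at h₁
  change l (p.sym b) ^ 1 • evalSym ω (a : SymmetricAlgebra A M) = 0
  rw [pow_one, smul_eq_mul, ← h₁]

end Kernel

/-- Every point of the hypersurface comes from a weight on the tautological line of a point of the
projective bundle. -/
theorem exists_compat_of_hyperElement [NeZero m] {F : Type u} [AddCommGroup F] [Module A F]
    (p : WPt A (Module.Dual A F) m) {s : Fin (d + 1) → SymmetricAlgebra A (Module.Dual A F)}
    (hs : ∀ i : Fin (d + 1), s i ∈ symPiece A (Module.Dual A F) (i * m)) (hs₀ : s 0 = 1)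
    (hp : p.h ⟨hyperElement s, hyperElement_mem hs⟩ = 0) :
    ∃ (q : LinePt A (Module.Dual A F)) (t : q.taut → A), p.Compat q.taut t ∧
      IsWeight m (fun i (v : q.taut) => evalSym (Module.Dual.eval A F (v : F)) (s i)) t := by
  obtain ⟨n, rfl⟩ := Nat.exists_eq_succ_of_ne_zero (NeZero.ne m)
  have h := p.span_sym_eq_top hs hs₀ hp
  have hω : ∀ v : (p.linePt h).taut, ∀ ξ ∈ p.linKer, Module.Dual.eval A F (v : F) ξ = 0 := by
    rintro ⟨v, l, hl⟩ ξ hξ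
    have h₀ : (p.linePt h).q ξ = 0 := (Submodule.Quotient.mk_eq_zero _).mpr hξ
    exact (hl ξ).trans (by rw [h₀, map_zero])
  choose κ hκ using fun v => p.exists_factor_evalSym h (hω v)
  -- The weight at `v` is the value at `h(x₀)` of the form on `L` that extends evaluation at `v`.
  refine ⟨p.linePt h, fun v => κ v p.x₀, fun v => ⟨κ v, hκ v, rfl⟩, fun a v => ?_, fun v => ?_⟩
  · obtain ⟨r, hr⟩ := p.sym_surjective_of_span h p.x₀
    rw [← hr, hκ, hκ]
    exact evalSym_eval_smul a (v : F) r.2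
  · have h₁ := p.evalSym_h (hκ v) rfl ⟨_, hyperElement_mem hs⟩
    rw [hp, map_zero, evalW_hyperElement] at h₁
    exact sub_eq_zero.mp h₁.symm

end WPt

end Quotient

/-! ### The tautological line bundle -/

section Global

/-- Any two linear forms on a line are proportional. -/
theorem IsTaut.smul_dual {A F : Type u} [CommRing A] [AddCommGroup F] [Module A F]
    {T : Submodule A F} (hT : IsTaut T) (l : Module.Dual A T) (ξ : Module.Dual A F) {v : F}
    (hv : v ∈ T) : ξ v • l = l ⟨v, hv⟩ • ξ.comp T.subtype := by
  refine LinearMap.ext fun x => ?_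
  have h : ξ v • x = ξ x.1 • (⟨v, hv⟩ : T) := Subtype.ext (hT.swap ξ v hv x.1 x.2)
  rw [LinearMap.smul_apply, ← map_smul, h, map_smul, smul_eq_mul, mul_comm]
  rfl

theorem IsWeight.congr {m d : ℕ} {A T : Type*} [CommRing A] [AddCommGroup T] [Module A T]
    {ψ ψ' : Fin (d + 1) → T → A} {t : T → A} (h : IsWeight m ψ t) (e : ∀ i v, ψ i v = ψ' i v) :
    IsWeight m ψ' t := by
  obtain rfl : ψ = ψ' := funext fun i => funext fun v => e i v
  exact h

variable {C : Type v} [Category.{w} C] {R : C ⥤ CommRingCat.{u}} (F : VectorBundle R)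

theorem isTaut_tautFibre {c : C} (y : (projBundle F).obj c) : IsTaut (tautFibre F y) := by
  induction y using Quotient.inductionOn with
  | h p => exact p.isTaut

theorem invertible_taut (e : (projBundle F).Elements) :
    Module.Invertible ((pointRing R (projBundle F)).obj e) ((taut F).obj e) :=
  (isTaut_tautFibre F e.2).invertible

theorem formsExtend_taut : FormsExtend (taut F) := by
  intro e e' f l
  let E : Submodule ((pointRing R (projBundle F)).obj e)
      (Module.Dual ((pointRing R (projBundle F)).obj e) ((taut F).obj e)) :=
    { carrier := {l | ∃ l' : Module.Dual ((pointRing R (projBundle F)).obj e') ((taut F).obj e'),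
        ∀ x, l' ((taut F).map f x) = (R.map f.1).hom (l x)}
      zero_mem' := ⟨0, fun x => by simp⟩
      add_mem' := by
        rintro l₁ l₂ ⟨l₁', h₁⟩ ⟨l₂', h₂⟩
        refine ⟨l₁' + l₂', fun x => ?_⟩
        rw [LinearMap.add_apply, h₁, h₂, LinearMap.add_apply, map_add]
      smul_mem' := by
        rintro a l ⟨l', h⟩
        refine ⟨(R.map f.1).hom a • l', fun x => ?_⟩
        rw [LinearMap.smul_apply, h, LinearMap.smul_apply, smul_eq_mul, smul_eq_mul, map_mul] }
  have hT := isTaut_tautFibre F e.2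
  refine hT.mem_of_map (RingHom.id _) E 1 fun ξ v hv => ?_
  have h : RingHom.id (R.obj e.1) (ξ v) ^ 1 • l =
      l ⟨v, hv⟩ • ξ.comp (tautFibre F e.2).subtype := by
    rw [RingHom.id_apply, pow_one]
    exact hT.smul_dual l ξ hv
  rw [h]
  refine E.smul_mem _ ⟨(F.dual.map f.1 ξ).comp (tautFibre F e'.2).subtype, fun x => ?_⟩
  exact F.dual_map_apply f.1 ξ x.1

theorem isHomogeneous_restrictTaut {ψ : PolyLaw F.toMod (structureSheaf R).toMod} {k : ℕ}
    (h : ψ.IsHomogeneous k) : (restrictTaut F ψ).IsHomogeneous k :=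
  fun e a v => h e.1 a v.1

theorem Represents.evalSym_eq {F : VectorBundle R} {ψ : PolyLaw F.toMod (structureSheaf R).toMod}
    {c : C} {s : SymmetricAlgebra (R.obj c) (F.dual.obj c)} (h : Represents F ψ c s)
    (z : F.toMod.obj c) :
    evalSym (Module.Dual.eval (R.obj c) (F.toMod.obj c) z) s = ψ.app c z := by
  have h₁ := h c (𝟙 c) z
  rwa [symMap_id (fun a => by simp) (F.dual.map_id c)] at h₁

theorem Represents.eq_one {F : VectorBundle R} {ψ : PolyLaw F.toMod (structureSheaf R).toMod}
    {c : C} {s : SymmetricAlgebra (R.obj c) (F.dual.obj c)} (h : Represents F ψ c s)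
    (hs : s ∈ symPiece (R.obj c) (F.dual.obj c) 0) (hψ : ψ.app c 0 = (1 : R.obj c)) : s = 1 := by
  obtain ⟨a, rfl⟩ := mem_symPiece_zero hs
  have h₁ := h.evalSym_eq 0
  rw [AlgHom.commutes, hψ] at h₁
  rw [show a = 1 from h₁, map_one]

/-! ### The correspondence between points of the hypersurface and weights -/

/-- The point `x` of `P_m(F ⊕ O)` corresponds to the point `y` of `P(F)` and the function `t` on the
tautological line at `y`. -/
def Corresponds {m : ℕ} [NeZero m] {c : C} (x : (weightedBundle F m).obj c)
    (y : (projBundle F).obj c) (t : tautFibre F y → R.obj c) : Prop :=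
  ∃ p : WPt (R.obj c) (F.dual.obj c) m, x = Quotient.mk _ p ∧ p.Compat (tautFibre F y) t

section Corresponds

variable {F} {m : ℕ} [NeZero m] {c : C} {x x' : (weightedBundle F m).obj c}
  {y y' : (projBundle F).obj c} {t : tautFibre F y → R.obj c}

theorem Corresponds.left_unique (h : Corresponds F x y t) (h' : Corresponds F x' y t) :
    x = x' := by
  obtain ⟨p, rfl, hp⟩ := h
  obtain ⟨p', rfl, hp'⟩ := h'
  exact Quotient.sound (hp.equiv (isTaut_tautFibre F y) hp')

theorem Corresponds.weight_unique {t' : tautFibre F y → R.obj c} (h : Corresponds F x y t)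
    (h' : Corresponds F x y t') : t = t' := by
  obtain ⟨p, rfl, hp⟩ := h
  obtain ⟨p', e, hp'⟩ := h'
  exact hp.weight_unique (isTaut_tautFibre F y) (hp'.of_equiv (Quotient.exact e.symm))

theorem Corresponds.point_unique {t' : tautFibre F y' → R.obj c} (h : Corresponds F x y t)
    (h' : Corresponds F x y' t') : y = y' := by
  obtain ⟨p, rfl, hp⟩ := h
  obtain ⟨p', e, hp'⟩ := h'
  induction y using Quotient.inductionOn with
  | h q =>
    induction y' using Quotient.inductionOn with
    | h q' =>
      exact Quotient.sound (WPt.Compat.linePt_unique hp (hp'.of_equiv (Quotient.exact e.symm)))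

theorem liesOver_iff : LiesOver F m x y ↔ ∃ t, Corresponds F x y t := by
  constructor
  · rintro ⟨p, q, rfl, rfl, h⟩
    obtain ⟨t, ht⟩ := h.exists_compat
    exact ⟨t, p, rfl, ht⟩
  · rintro ⟨t, p, rfl, hp⟩
    induction y using Quotient.inductionOn with
    | h q => exact ⟨p, q, rfl, rfl, WPt.Compat.liesOver hp⟩

theorem Corresponds.map (h : Corresponds F x y t) {c' : C} (f : c ⟶ c')
    {y' : (projBundle F).obj c'} (hy : (projBundle F).map f y = y')
    {t' : tautFibre F y' → R.obj c'} (ht' : ∀ (b : R.obj c') (v : tautFibre F y'),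
      t' (b • v) = b ^ m * t' v)
    (htt' : ∀ v : tautFibre F y, t' ⟨F.toMod.map f v, map_mem_tautFibre F f hy v.2⟩ =
      (R.map f).hom (t v)) : Corresponds F ((weightedBundle F m).map f x) y' t' := by
  obtain ⟨p, rfl, hp⟩ := h
  refine ⟨p.pullback (F.dual_isQuasiCoherent f), rfl, ?_⟩
  exact hp.pullback (F.dual_isQuasiCoherent f) (F.dual_map_apply f) (isTaut_tautFibre F y)
    (isTaut_tautFibre F y') (fun v hv => map_mem_tautFibre F f hy hv)
    (p.isPullback_pullback (F.dual_isQuasiCoherent f)) ht' htt'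

variable {d : ℕ} {ψ : Fin (d + 1) → PolyLaw F.toMod (structureSheaf R).toMod}

/-- The restrictions of the functions `ψᵢ` to the tautological line at a point. -/
abbrev tautValues {F : VectorBundle R} {c : C} {d : ℕ}
    (ψ : Fin (d + 1) → PolyLaw F.toMod (structureSheaf R).toMod) (y : (projBundle F).obj c) :
    Fin (d + 1) → tautFibre F y → R.obj c :=
  fun i v => (ψ i).app c v.1

theorem exists_corresponds (hrep : ∀ (c : C) (i : Fin (d + 1)),
      ∃ s ∈ symPiece (R.obj c) (F.dual.obj c) (i * m), Represents F (ψ i) c s)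
    (ht : IsWeight m (tautValues ψ y) t) :
    ∃ x ∈ (hypersurface F m ψ).obj c, Corresponds F x y t := by
  choose s hs hs' using hrep c
  induction y using Quotient.inductionOn with
  | h q =>
    have ht' : IsWeight m (fun i (v : q.taut) =>
        evalSym (Module.Dual.eval (R.obj c) (F.toMod.obj c) v.1) (s i)) t := by
      exact IsWeight.congr (A := R.obj c)
        (ψ := fun i (v : q.taut) => ((ψ i).app c v.1 : R.obj c)) ht
        fun i v => ((hs' i).evalSym_eq v.1).symm
    obtain ⟨p, hp, h⟩ := q.exists_compat hs ht'
    exact ⟨Quotient.mk _ p, ⟨p, s, hs, hs', rfl, h⟩, p, rfl, hp⟩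

theorem exists_weight_of_mem_hypersurface
    (hψ₀ : ∀ (c : C) (x : F.toMod.obj c), (ψ 0).app c x = (1 : R.obj c))
    (hx : x ∈ (hypersurface F m ψ).obj c) :
    ∃ (y : (projBundle F).obj c) (t : tautFibre F y → R.obj c),
      IsWeight m (tautValues ψ y) t ∧
        Corresponds F x y t := by
  obtain ⟨p, s, hs, hs', rfl, h⟩ := hx
  have hs₀ : s 0 = 1 := (hs' 0).eq_one (by simpa using hs 0) (hψ₀ c 0)
  obtain ⟨q, t, hp, ht⟩ := p.exists_compat_of_hyperElement hs hs₀ h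
  exact ⟨Quotient.mk _ q, t, ht.congr fun i v => (hs' i).evalSym_eq v.1, p, rfl, hp⟩

end Corresponds

section Iso

variable {F} {m d : ℕ}
  {ψ : Fin (d + 1) → PolyLaw F.toMod (structureSheaf R).toMod}
  {Cl : QCohAlg (pointRing R (projBundle F))}

/-- The function on the tautological line attached to a point of the relative spectrum of the
Clifford algebra. -/
def specWeight (η : restrictedWeights F m ψ ⟶ (weightFunctor _ d).obj Cl) {c : C}
    (z : RelSpecPt Cl c) : tautFibre F z.1 → R.obj c :=
  fun v => z.2 (weightGen (T := taut F) (m := m) (ψ := fun i => restrictTaut F (ψ i)) η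
    ((projBundle F).elementsMk c z.1) v)

theorem isWeight_specWeight (η : restrictedWeights F m ψ ⟶ (weightFunctor _ d).obj Cl) {c : C}
    (z : RelSpecPt Cl c) :
    IsWeight m (tautValues ψ z.1) (specWeight η z) :=
  isWeight_section (T := taut F) (m := m) (ψ := fun i => restrictTaut F (ψ i)) η
    ((projBundle F).elementsMk c z.1) z.2

theorem specWeight_map (η : restrictedWeights F m ψ ⟶ (weightFunctor _ d).obj Cl) {c c' : C}
    (f : c ⟶ c') (z : RelSpecPt Cl c) (v : tautFibre F z.1) :
    specWeight η (z.map f) ⟨F.toMod.map f v, map_mem_tautFibre F f rfl v.2⟩ =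
      (R.map f).hom (specWeight η z v) := by
  have h := weightGen_map (T := taut F) (m := m) (ψ := fun i => restrictTaut F (ψ i)) η
    (c := (projBundle F).elementsMk c z.1)
    (c' := (projBundle F).elementsMk c' ((projBundle F).map f z.1)) ⟨f, rfl⟩ v
  refine (congrArg (z.map f).2 h.symm).trans ?_
  exact Cl.extend_apply (c := (projBundle F).elementsMk c z.1)
    (c' := (projBundle F).elementsMk c' ((projBundle F).map f z.1)) ⟨f, rfl⟩ z.2 _

variable [NeZero m]

/-- The relative spectrum of the Clifford algebra is isomorphic to the hypersurface. -/
theorem exists_iso_hypersurface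
    (hψ : ∀ i : Fin (d + 1), (ψ i).IsHomogeneous (i * m))
    (hψ₀ : ∀ (c : C) (x : F.toMod.obj c), (ψ 0).app c x = (1 : R.obj c))
    (hrep : ∀ (c : C) (i : Fin (d + 1)),
      ∃ s ∈ symPiece (R.obj c) (F.dual.obj c) (i * m), Represents F (ψ i) c s)
    {η : restrictedWeights F m ψ ⟶ (weightFunctor _ d).obj Cl}
    (h : IsClifford (restrictedWeights F m ψ) Cl η) :
    ∃ e : relSpec Cl ≅ (hypersurface F m ψ).toFunctor, ∀ (c : C) (z : (relSpec Cl).obj c),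
      Corresponds F (e.hom.app c z).1 z.1 (specWeight η z) := by
  have hex : ∀ (c : C) (z : RelSpecPt Cl c), ∃ x : (hypersurface F m ψ).toFunctor.obj c,
      Corresponds F x.1 z.1 (specWeight η z) := fun c z => by
    obtain ⟨x, hx, hx'⟩ := exists_corresponds hrep (isWeight_specWeight η z)
    exact ⟨⟨x, hx⟩, hx'⟩
  choose g hg using hex
  -- Naturality holds because a point of the hypersurface is determined by its weight.
  have hnat : ∀ {c c' : C} (f : c ⟶ c') (z : RelSpecPt Cl c),
      g c' (z.map f) = (hypersurface F m ψ).toFunctor.map f (g c z) := fun f z =>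
    Subtype.ext <| (hg _ (z.map f)).left_unique <|
      (hg _ z).map f rfl (isWeight_specWeight η (z.map f)).smul (specWeight_map η f z)
  have hbij : ∀ c, Function.Bijective (g c) := by
    intro c
    constructor
    · rintro ⟨y, a⟩ ⟨y', a'⟩ hz
      have h₁ := hg c ⟨y, a⟩
      have h₂ := hg c ⟨y', a'⟩
      rw [hz] at h₁
      obtain rfl : y = y' := h₁.point_unique h₂
      have h₃ := h₁.weight_unique h₂
      obtain ⟨b, -, hb⟩ := IsClifford.existsUnique_section (T := taut F) (m := m)
        (ψ := fun i => restrictTaut F (ψ i)) h (invertible_taut F) (formsExtend_taut F)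
        (fun i => isHomogeneous_restrictTaut F (hψ i)) ((projBundle F).elementsMk c y)
        (isWeight_specWeight η ⟨y, a'⟩)
      have h₄ : a = a' := (hb a fun v => congrFun h₃ v).trans (hb a' fun v => rfl).symm
      rw [h₄]
    · rintro ⟨x, hx⟩
      obtain ⟨y, t, ht, hxy⟩ := exists_weight_of_mem_hypersurface hψ₀ hx
      obtain ⟨b, hb, -⟩ := IsClifford.existsUnique_section (T := taut F) (m := m)
        (ψ := fun i => restrictTaut F (ψ i)) h (invertible_taut F) (formsExtend_taut F)
        (fun i => isHomogeneous_restrictTaut F (hψ i)) ((projBundle F).elementsMk c y) ht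
      refine ⟨⟨y, b⟩, Subtype.ext ((hg c ⟨y, b⟩).left_unique ?_)⟩
      have h₅ : specWeight η ⟨y, b⟩ = t := funext hb
      rw [h₅]
      exact hxy
  refine ⟨NatIso.ofComponents (fun c => (Equiv.ofBijective (g c) (hbij c)).toIso) ?_, hg⟩
  intro c c' f
  ext z
  exact hnat f z

/-- The projection `φ` and the Clifford algebra over an arbitrary category of points, for polynomial
laws that are represented by elements of symmetric powers. -/
theorem exists_projection
    (hψ : ∀ i : Fin (d + 1), (ψ i).IsHomogeneous (i * m))
    (hψ₀ : ∀ (c : C) (x : F.toMod.obj c), (ψ 0).app c x = (1 : R.obj c))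
    (hrep : ∀ (c : C) (i : Fin (d + 1)),
      ∃ s ∈ symPiece (R.obj c) (F.dual.obj c) (i * m), Represents F (ψ i) c s) :
    ∃ φ : (hypersurface F m ψ).toFunctor ⟶ projBundle F,
      (∀ (c : C) (x : (hypersurface F m ψ).toFunctor.obj c) (y : (projBundle F).obj c),
        φ.app c x = y ↔ LiesOver F m x.1 y) ∧
      (∃ (Cl : QCohAlg (pointRing R (projBundle F)))
        (η : restrictedWeights F m ψ ⟶ (weightFunctor _ d).obj Cl),
        IsClifford (restrictedWeights F m ψ) Cl η) ∧
      ∀ (Cl : QCohAlg (pointRing R (projBundle F)))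
        (η : restrictedWeights F m ψ ⟶ (weightFunctor _ d).obj Cl),
        IsClifford (restrictedWeights F m ψ) Cl η →
          (∀ (p : (projBundle F).Elements) (a b : Cl.obj.obj p), a * b = b * a) ∧
          ∃ e : relSpec Cl ≅ (hypersurface F m ψ).toFunctor, e.hom ≫ φ = relSpecProj Cl := by
  have hT := invertible_taut F
  have hext := formsExtend_taut F
  have hψ' : ∀ i : Fin (d + 1), (restrictTaut F (ψ i)).IsHomogeneous (i * m) :=
    fun i => isHomogeneous_restrictTaut F (hψ i)
  have hCl := isClifford_lineCliffordHom (T := taut F) (m := m) hT hext hψ'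
  obtain ⟨e₀, he₀⟩ := exists_iso_hypersurface hψ hψ₀ hrep hCl
  let φ : (hypersurface F m ψ).toFunctor ⟶ projBundle F := e₀.inv ≫ relSpecProj _
  have hφ : ∀ (c : C) (x : (hypersurface F m ψ).toFunctor.obj c),
      ∃ t, Corresponds F x.1 (φ.app c x) t := fun c x => by
    have h₁ := he₀ c (e₀.inv.app c x)
    have h₂ : e₀.hom.app c (e₀.inv.app c x) = x :=
      congrArg (fun u => u.app c x) e₀.inv_hom_id
    rw [h₂] at h₁
    exact ⟨_, h₁⟩
  refine ⟨φ, fun c x y => ?_, ⟨_, _, hCl⟩, fun Cl η h => ⟨fun p => ?_, ?_⟩⟩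
  · rw [liesOver_iff]
    constructor
    · rintro rfl
      exact hφ c x
    · rintro ⟨t, ht⟩
      obtain ⟨t', ht'⟩ := hφ c x
      exact ht'.point_unique ht
  · exact IsClifford.mul_comm (T := taut F) (m := m) (ψ := fun i => restrictTaut F (ψ i)) h hT hext
      hψ' p
  · obtain ⟨e, he⟩ := exists_iso_hypersurface hψ hψ₀ hrep h
    refine ⟨e, ?_⟩
    ext c z
    obtain ⟨t, ht⟩ := hφ c (e.hom.app c z)
    exact ht.point_unique (he c z)

end Iso

end Global

/-! ### Homogeneous polynomial laws are elements of symmetric powers -/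

section Representation

variable {C : Type v} [Category.{w} C] {R : C ⥤ CommRingCat.{u}}

variable (R) in
/-- Up to isomorphism, ring homomorphisms from `R(c)` are values of `R` at morphisms from `c`, and
factorizations of ring homomorphisms lift to factorizations of morphisms. This holds for the points
of a functor on rings, whose category is cofibred in sets over the category of rings. -/
def HasRingExtensions : Prop :=
  ∀ (c : C) (B : Type u) [CommRing B] (g : R.obj c →+* B),
    ∃ (c' : C) (a : c ⟶ c') (e : B ≃+* R.obj c'), (∀ r, (R.map a).hom r = e (g r)) ∧
      ∀ (c'' : C) (f : c ⟶ c'') (ρ : B →+* R.obj c''), (∀ r, ρ (g r) = (R.map f).hom r) →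
        ∃ b : c' ⟶ c'', a ≫ b = f ∧ ∀ x, (R.map b).hom (e x) = ρ x

theorem hasRingExtensions_π (P : CommRingCat.{u} ⥤ Type w) :
    HasRingExtensions (CategoryOfElements.π P) := by
  intro c B _ g
  refine ⟨P.elementsMk (CommRingCat.of B) (P.map (CommRingCat.ofHom g) c.2),
    ⟨CommRingCat.ofHom g, rfl⟩, RingEquiv.refl B, fun _ => rfl, fun c'' f ρ hρ => ?_⟩
  have h : CommRingCat.ofHom g ≫ CommRingCat.ofHom ρ = f.1 :=
    CommRingCat.hom_ext (RingHom.ext hρ)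
  refine ⟨⟨CommRingCat.ofHom ρ, ?_⟩, Subtype.ext h, fun _ => rfl⟩
  have h' : P.map f.1 c.2 = P.map (CommRingCat.ofHom ρ) (P.map (CommRingCat.ofHom g) c.2) :=
    (congrArg (fun u => P.map u c.2) h.symm).trans
      (Functor.map_comp_apply P (CommRingCat.ofHom g) (CommRingCat.ofHom ρ) c.2)
  exact h'.symm.trans f.2

variable {F : VectorBundle R}

/-- A homogeneous polynomial law `ψ` on a vector bundle is represented by its value at the generic
point of the bundle, whose coordinate ring is the symmetric algebra of the dual. This value is
homogeneous because scaling the generic point corresponds to the grading of the symmetric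
algebra. -/
theorem exists_represents (hR : HasRingExtensions R) {ψ : PolyLaw F.toMod (structureSheaf R).toMod}
    {k : ℕ} (hψ : ψ.IsHomogeneous k) (c : C) :
    ∃ s ∈ symPiece (R.obj c) (F.dual.obj c) k, Represents F ψ c s := by
  obtain ⟨n, p, i, -, -, hpi⟩ :=
    Module.Finite.exists_comp_eq_id_of_projective (R.obj c) (F.toMod.obj c)
  let x : Fin n → F.toMod.obj c := fun j => p (Pi.single j 1)
  let f : Fin n → F.dual.obj c := fun j => (LinearMap.proj j).comp i
  have hx : ∀ z : F.toMod.obj c, ∑ j, f j z • x j = z := fun z => by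
    have h1 := LinearMap.congr_fun hpi z
    have h2 : i z = ∑ j, (i z j) • (Pi.single j (1 : R.obj c) : Fin n → R.obj c) := by
      ext k
      simp [Finset.sum_apply, Pi.single_apply]
    rw [LinearMap.comp_apply, h2, map_sum] at h1
    simpa [x, f] using h1
  obtain ⟨cS, a, e, ha, hdesc⟩ := hR c (SymmetricAlgebra (R.obj c) (F.dual.obj c))
    (algebraMap _ _)
  -- The generic point of the bundle, with values in the symmetric algebra.
  let γ : F.toMod.obj cS := ∑ j, e (SymmetricAlgebra.ι _ _ (f j)) • F.toMod.map a (x j)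
  have hγ : ∀ {c' : C} (b : cS ⟶ c'), F.toMod.map b γ = ∑ j,
      (R.map b).hom (e (SymmetricAlgebra.ι _ _ (f j))) • F.toMod.map (a ≫ b) (x j) := by
    intro c' b
    rw [map_sum]
    exact Finset.sum_congr rfl fun j _ => by rw [map_smulₛₗ, F.toMod.map_comp]
  let s : SymmetricAlgebra (R.obj c) (F.dual.obj c) := e.symm (ψ.app cS γ)
  have hs : ∀ {c' : C} (b : cS ⟶ c'), ψ.app c' (F.toMod.map b γ) = (R.map b).hom (e s) := by
    intro c' b
    rw [← ψ.naturality]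
    exact congrArg (R.map b).hom (e.apply_symm_apply _).symm
  refine ⟨s, ?_, fun c' g z => ?_⟩
  · obtain ⟨cT, a', e', ha', -⟩ := hR c (Polynomial (SymmetricAlgebra (R.obj c) (F.dual.obj c)))
      (algebraMap _ _)
    -- Over the polynomial ring, `b₁` gives the generic point and `b₂` its multiple by the variable.
    obtain ⟨b₁, hb₁, hb₁'⟩ := hdesc cT a' (e'.toRingHom.comp Polynomial.C) fun r => by
      rw [ha']
      rfl
    obtain ⟨b₂, hb₂, hb₂'⟩ := hdesc cT a'
      (e'.toRingHom.comp (symGrade (R.obj c) (F.dual.obj c)).toRingHom) fun r => by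
        rw [ha']
        exact congrArg e' (AlgHom.commutes (symGrade _ _) r)
    have h₁ : F.toMod.map b₂ γ = e' Polynomial.X • F.toMod.map b₁ γ := by
      rw [hγ, hγ, hb₁, hb₂, Finset.smul_sum]
      refine Finset.sum_congr rfl fun j _ => ?_
      rw [hb₁', hb₂', smul_smul]
      congr 1
      refine (congrArg e' (symGrade_ι (f j))).trans ?_
      rw [mul_comm, map_mul]
      rfl
    have h₂ : e' (symGrade _ _ s) = e' (Polynomial.X ^ k * Polynomial.C s) := by
      have h₃ := hs b₂
      rw [h₁, hψ cT, hs b₁, hb₁', hb₂'] at h₃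
      rw [map_mul, map_pow]
      exact h₃.symm
    have h₄ := congrArg (fun r => r.coeff k) (e'.injective h₂)
    have h₅ : (Polynomial.X ^ k * Polynomial.C s).coeff k = s := by
      rw [mul_comm, Polynomial.coeff_C_mul_X_pow, if_pos rfl]
    rw [← h₅, ← show _ = _ from h₄]
    exact symGrade_coeff_mem s k
  · obtain ⟨b, hb, hb'⟩ := hdesc c' g
      ((evalSym (Module.Dual.eval (R.obj c') (F.toMod.obj c') z)).toRingHom.comp
        (symMap (F.dual.map g))) fun r => by
        rw [RingHom.comp_apply, symMap_algebraMap]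
        exact AlgHom.commutes (evalSym _) _
    -- The point `z` is the specialization of the generic point along `b`.
    have h₁ : F.toMod.map b γ = z := by
      have h₂ : ∀ z : F.toMod.obj c', ∑ j, F.dual.map g (f j) z • F.toMod.map g (x j) = z := by
        intro z
        let T : F.toMod.obj c' →ₗ[R.obj c'] F.toMod.obj c' :=
          ∑ j, (F.dual.map g (f j)).smulRight (F.toMod.map g (x j))
        have hT : ∀ z, T z = ∑ j, F.dual.map g (f j) z • F.toMod.map g (x j) := fun z => by
          simp [T]
        rw [← hT]
        refine LinearMap.congr_fun ((F.quasiCoherent g).hom_ext (g := T) (g' := LinearMap.id)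
          fun y => ?_) z
        rw [hT, LinearMap.id_apply]
        conv_rhs => rw [← hx y]
        rw [map_sum]
        exact Finset.sum_congr rfl fun j _ => by rw [F.dual_map_apply, map_smulₛₗ]
      rw [hγ, hb]
      refine Eq.trans (Finset.sum_congr rfl fun j _ => ?_) (h₂ z)
      rw [hb', RingHom.comp_apply, symMap_ι]
      congr 1
      exact SymmetricAlgebra.lift_ι_apply _ _
    have h₃ := hs b
    rw [h₁, hb'] at h₃
    exact h₃.symm

end Representation

end CliffordSpec

end

theorem mainTheorem5 (S : AlgebraicGeometry.Scheme.{u})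
    (F : CliffordSpec.VectorBundle (CliffordSpec.affineRing S)) (m d : ℕ) [NeZero m]
    (ψ : Fin (d + 1) → CliffordSpec.PolyLaw F.toMod
      (CliffordSpec.structureSheaf (CliffordSpec.affineRing S)).toMod)
    (hψ : ∀ i : Fin (d + 1), (ψ i).IsHomogeneous (i * m))
    (hψ₀ : ∀ (c : (CliffordSpec.affinePoints S).Elements) (x : F.toMod.obj c),
      (ψ 0).app c x = (1 : (CliffordSpec.affineRing S).obj c)) :
    ∃ φ : (CliffordSpec.hypersurface F m ψ).toFunctor ⟶ CliffordSpec.projBundle F,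
      (∀ (c : (CliffordSpec.affinePoints S).Elements)
        (x : (CliffordSpec.hypersurface F m ψ).toFunctor.obj c)
        (y : (CliffordSpec.projBundle F).obj c),
        φ.app c x = y ↔ CliffordSpec.LiesOver F m x.1 y) ∧
      (∃ (Cl : CliffordSpec.QCohAlg
          (CliffordSpec.pointRing (CliffordSpec.affineRing S) (CliffordSpec.projBundle F)))
        (η : CliffordSpec.restrictedWeights F m ψ ⟶ (CliffordSpec.weightFunctor _ d).obj Cl),
        CliffordSpec.IsClifford (CliffordSpec.restrictedWeights F m ψ) Cl η) ∧
      ∀ (Cl : CliffordSpec.QCohAlg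
          (CliffordSpec.pointRing (CliffordSpec.affineRing S) (CliffordSpec.projBundle F)))
        (η : CliffordSpec.restrictedWeights F m ψ ⟶ (CliffordSpec.weightFunctor _ d).obj Cl),
        CliffordSpec.IsClifford (CliffordSpec.restrictedWeights F m ψ) Cl η →
          (∀ (p : (CliffordSpec.projBundle F).Elements) (a b : Cl.obj.obj p), a * b = b * a) ∧
          ∃ e : CliffordSpec.relSpec Cl ≅ (CliffordSpec.hypersurface F m ψ).toFunctor,
            e.hom ≫ φ = CliffordSpec.relSpecProj Cl :=
  CliffordSpec.exists_projection hψ hψ₀ fun c i =>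
    CliffordSpec.exists_represents (CliffordSpec.hasRingExtensions_π _) (hψ i) c
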